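/- **Setting.** Identify the plane $\mathbb R^2$ with $\mathbb C$, let $\Delta^+$ be the real axis with its usual orientation, and let $X=\{p_1,p_2,p_3\}\subset\Delta^+$ with $p_1<p_2<p_3$. An isotopy $(f_t)_{t\in[0,1]}$ is a family of homeomorphisms of the plane with $f_0=\mathrm{Id}$ such that $f_t(z)$ and $f_t^{-1}(z)$ are jointly continuous in $(t,z)$. *Turbulent homeomorphisms.* A homeomorphism $f_A$ of the plane is of type $A$ if $f_A(p_1)=p_2$, $f_A(p_2)=p_1$, $f_A(p_3)=p_3$ and there is an isotopy $(f_t)$ with $f_1=f_A$ such that, for all $t\in(0,1)$, $f_t(p_1),f_t(p_3)\in\Delta^+$ and $f_t(p_2)$ is not in the open lower half-plane. A homeomorphism $f_B$ is of type $B$ if $f_B(p_1)=p_1$, $f_B(p_2)=p_3$, $f_B(p_3)=p_2$ and there is an isotopy to $f_B$ with the same property. The set $\mathcal T^+$ of positively turbulent homeomorphisms consists of the finite (possibly empty) compositions $f=f_k\circ\dots\circ f_1$ of homeomorphisms of types $A$ and $B$. The turbulence matrix $\Phi(f)=\mathrm M_T(f)=\begin{pmatrix} g_1&r_1\\ g_2&r_2\end{pmatrix}$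 is the product $M_k\cdots M_1$, where $M_i=\begin{pmatrix}1&1\\0&1\end{pmatrix}$ if $f_i$ is of type $A$ and $M_i=\begin{pmatrix}1&0\\1&1\end{pmatrix}$ if $f_i$ is of type $B$. *Snails.* For integers $n,p\ge1$ let $z_1=-\frac n2$, $z_2=\frac{p-n}2$, $z_3=\frac p2$, and for $m\ge 1$, $i\geq 0$ let $\rho_{m,i}=\lfloor \frac m2\rfloor-\frac m2+\frac12+i$. The concrete snail is the union of the closed lower half-circles with centre $z_1$ and radii $\rho_{n,i}$, $0\le i\le\lfloor\frac{n-1}2\rfloor$, the closed lower half-circles with centre $z_3$ and radii $\rho_{p,j}$, $0\le j\le\lfloor\frac{p-1}2\rfloor$, and the closed upper half-circles with centre $z_2$ and radii $\rho_{n+p,k}$, $0\le k\le\lfloor\frac{n+p-1}2\rfloor$ (a half-circle of radius $0$ is its centre). The topological snail $\mathbb{SN}(n;p)$ is the class of all sets $f_1(S)$, where $S$ is the concrete snail and $(f_t)$ is an isotopy with $f_t(z_1),f_t(z_2),f_t(z_3)\in\Delta^+$ for all $t$ and $f_1(\{z_1,z_2,z_3\})=X$. The green snail $\mathbb{SN}(1;0)$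 and the red snail $\mathbb{SN}(0;1)$ are the classes of all sets $f_1([p_1,p_2])$, respectively $f_1([p_2,p_3])$, where $(f_t)$ is an isotopy with $f_t(X)\subset\Delta^+$ for all $t$ and $f_1(X)=X$. For a class $\mathcal C$ of subsets of the plane, $f(\mathcal C)=\{f(H): H\in\mathcal C\}$. **Theorem.** Let $f\in\mathcal T^+$ be a positively turbulent homeomorphism and let $\begin{pmatrix} g_1&r_1\\ g_2&r_2\end{pmatrix}$ be its turbulence matrix, computed from any expression of $f$ as a composition of homeomorphisms of types $A$ and $B$. Then $f(\mathbb{SN}(1;1))=\mathbb{SN}(g_1+r_1;\,g_2+r_2)$, and $$f(\mathbb{SN}(1;0))=\mathbb{SN}(g_1;g_2),\qquad f(\mathbb{SN}(0;1))=\mathbb{SN}(r_1;r_2).$$ -/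

import Mathlib

/-! The plane is `ℂ`, the oriented line `Δ⁺` is the real axis with its usual orientation, and a
marked set `X = {p₁, p₂, p₃} ⊂ Δ⁺` is given by the increasing triple `x : Fin 3 → ℝ` of the
abscissas of its points. -/

namespace Snail

/-- An isotopy of the plane starting at the identity: a path `(F t)`, `t ∈ [0,1]`, of homeomorphisms
with `F 0 = id` such that both `F t z` and `(F t)⁻¹ z` are jointly continuous in `(t, z)`. -/
structure IsIsotopy (F : unitInterval → ℂ ≃ₜ ℂ) : Prop where
  continuous_toFun : Continuous fun q : unitInterval × ℂ => F q.1 q.2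
  continuous_invFun : Continuous fun q : unitInterval × ℂ => (F q.1).symm q.2
  start : F 0 = Homeomorph.refl ℂ

/-- `f` is the end of an isotopy during which `p₁` and `p₃` move on `Δ⁺`, while `p₂`
never enters the open lower half-plane. -/
def IsTopDisplacement (x : Fin 3 → ℝ) (f : ℂ ≃ₜ ℂ) : Prop :=
  ∃ F : unitInterval → ℂ ≃ₜ ℂ, IsIsotopy F ∧ F 1 = f ∧
    ∀ t : unitInterval, 0 < t → t < 1 →
      (F t (x 0)).im = 0 ∧ (F t (x 2)).im = 0 ∧ ¬ (F t (x 1)).im < 0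

/-- Homeomorphisms of type `A`: top-displacements to the left of the middle point. -/
def IsTypeA (x : Fin 3 → ℝ) (f : ℂ ≃ₜ ℂ) : Prop :=
  f (x 0) = x 1 ∧ f (x 1) = x 0 ∧ f (x 2) = x 2 ∧ IsTopDisplacement x f

/-- Homeomorphisms of type `B`: top-displacements to the right of the middle point. -/
def IsTypeB (x : Fin 3 → ℝ) (f : ℂ ≃ₜ ℂ) : Prop :=
  f (x 0) = x 0 ∧ f (x 1) = x 2 ∧ f (x 2) = x 1 ∧ IsTopDisplacement x f

/-- `HasTurbulenceMatrix x f M`: the homeomorphism `f` is positively turbulent relative to the marked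
set, i.e. a finite composition of homeomorphisms of types `A` and `B`, and `M` is the turbulence
matrix obtained from the identity by successively multiplying on the left by
`A = [[1,1],[0,1]]` or `B = [[1,0],[1,1]]` according to the types of the successive factors.
(`f.trans a` is `a ∘ f`.) -/
inductive HasTurbulenceMatrix (x : Fin 3 → ℝ) : (ℂ ≃ₜ ℂ) → Matrix (Fin 2) (Fin 2) ℕ → Prop
  | id : HasTurbulenceMatrix x (Homeomorph.refl ℂ) 1
  | compA {f a : ℂ ≃ₜ ℂ} {M : Matrix (Fin 2) (Fin 2) ℕ} :
      HasTurbulenceMatrix x f M → IsTypeA x a → HasTurbulenceMatrix x (f.trans a) (!![1, 1; 0, 1] * M)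
  | compB {f b : ℂ ≃ₜ ℂ} {M : Matrix (Fin 2) (Fin 2) ℕ} :
      HasTurbulenceMatrix x f M → IsTypeB x b → HasTurbulenceMatrix x (f.trans b) (!![1, 0; 1, 1] * M)

/-- Closed lower half-circle centred on the real axis (the point `c` if `r = 0`). -/
def lowerHalfCircle (c r : ℝ) : Set ℂ := {z | z.im ≤ 0 ∧ ‖z - c‖ = r}

/-- Closed upper half-circle centred on the real axis (the point `c` if `r = 0`). -/
def upperHalfCircle (c r : ℝ) : Set ℂ := {z | 0 ≤ z.im ∧ ‖z - c‖ = r}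

/-- `E(m/2) - m/2 + 1/2 + i`, with `E` the integer part (`m / 2 : ℕ` is the integer quotient). -/
noncomputable def circleRadius (m i : ℕ) : ℝ := ((m / 2 : ℕ) : ℝ) - (m : ℝ) / 2 + 1 / 2 + i

/-- The centres `-n/2`, `(p-n)/2`, `p/2` of the concrete snail `SN(n;p)`, `n, p ≥ 1`. -/
noncomputable def snailCenters (n p : ℕ) : Fin 3 → ℝ :=
  ![-(n : ℝ) / 2, ((p : ℝ) - n) / 2, (p : ℝ) / 2]

/-- The concrete snail `SN(n;p)`, `n, p ≥ 1`: concentric lower half-circles around `-n/2` and around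
`p/2`, and concentric upper half-circles around `(p-n)/2`. -/
def snailCurve (n p : ℕ) : Set ℂ :=
  {z | ∃ i : ℕ, i ≤ (n - 1) / 2 ∧ z ∈ lowerHalfCircle (-(n : ℝ) / 2) (circleRadius n i)} ∪
  {z | ∃ j : ℕ, j ≤ (p - 1) / 2 ∧ z ∈ lowerHalfCircle ((p : ℝ) / 2) (circleRadius p j)} ∪
  {z | ∃ k : ℕ, k ≤ (n + p - 1) / 2 ∧
    z ∈ upperHalfCircle (((p : ℝ) - n) / 2) (circleRadius (n + p) k)}

/-- The sets `H` such that `(H, {x 0, x 1, x 2})` is the image of `(S, {y 0, y 1, y 2})` under the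
end of an isotopy of the plane during which the marked points stay on `Δ⁺`. -/
def topType (y x : Fin 3 → ℝ) (S : Set ℂ) : Set (Set ℂ) :=
  {H | ∃ F : unitInterval → ℂ ≃ₜ ℂ, IsIsotopy F ∧
    (∀ (t : unitInterval) (i : Fin 3), (F t (y i)).im = 0) ∧
    F 1 '' Set.range (fun i => (y i : ℂ)) = Set.range (fun i => (x i : ℂ)) ∧
    H = F 1 '' S}

/-- The topological type `SN(n;p)` relative to the marked set: the type of the concrete snail if
`n, p ≥ 1`, of the segment `[p₁, p₂]` for `SN(1;0)`, of the segment `[p₂, p₃]` for `SN(0;1)`.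
Only coprime `n, p` matter. -/
def SN (x : Fin 3 → ℝ) (n p : ℕ) : Set (Set ℂ) :=
  if p = 0 then topType x x (segment ℝ (x 0 : ℂ) (x 1 : ℂ))
  else if n = 0 then topType x x (segment ℝ (x 1 : ℂ) (x 2 : ℂ))
  else topType (snailCenters n p) x (snailCurve n p)

/-- The image `f(T)` of a class `T` of subsets of the plane: the class of all `f(H)`, `H ∈ T`. -/
def mapType (f : ℂ ≃ₜ ℂ) (T : Set (Set ℂ)) : Set (Set ℂ) := (fun H => f '' H) '' T

end Snail

/-! Up to isotopy, a homeomorphism of type A is one fixed half-twist exchanging the two left points,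
and one of type B is its mirror image. The heart of the matter is that A takes SN(n;p) to SN(n+p;p).
Reflection in the imaginary axis then shows that B takes SN(n;p) to SN(n;n+p), and induction on the
word turns both rules into the action of the turbulence matrix on the column (n,p), applied to
(1,1), (1,0) and (0,1).

Reduction to one model. The marked points may follow arbitrary paths during the isotopies, but these
paths stay among the admissible triples: once the outer points are sent to 0 and 1, the second point
lies above the graph of `-roof`. That region is a topological half-plane with 0 and 1 on its
boundary, so a homeomorphism depending continuously on the triple (`normalizer`) sends every
admissible triple to (0, i, 1). A map carrying one triple to another through admissible triples is
thus, in normal form, a map isotopic to the identity relative to three fixed points; this is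
`IsMove`. Such maps compose, and they can be made to follow any admissible path with the same ends
(`IsMove.exists_isotopy`). Hence topological types are orbits under moves (`mem_topType`), and
`IsTypeA.mapType_topType` replaces a homeomorphism of type A by any one model of it.

The model for n, p ≥ 1. Circles are first replaced by squares cut along the axis and pulled apart by
2η, so that every crossing of the axis becomes a vertical segment, while the poles leave the axis
(`exists_fattening`). The map of `exists_drag` turns the lower left block and the upper strands by π
about the left pole, fixes the lower right block, and stretches each of the p vertical segments
between the last two into an arc above the pole. The n+p upper strands become the new lower left
block; the n turned crossings, with p new ones on each side, make the new upper block of size n+2p.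
This is the fat SN(n+p;p) (`image_fat_of_drag`, `exists_twist_snail`).

The models for segments. A half-turn preserves the segment between the exchanged points
(`exists_twist_segment`), and the other segment is lifted and stretched to the half-circle SN(1;1)
(`exists_twist_complement`). -/

namespace Snail
open Set Filter Topology Complex

/-! ### Continuous families of homeomorphisms and explicit isotopies -/

/-- A continuous family of proper continuous bijections is a continuous family of homeomorphisms. -/
theorem exists_homeomorph_family {T : Type*} [TopologicalSpace T] [CompactSpace T] [T2Space T]
    (f : T → ℂ → ℂ) (hc : Continuous fun q : T × ℂ => f q.1 q.2)
    (hb : ∀ t, Function.Bijective (f t))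
    (hp : ∀ R : ℝ, ∃ R' : ℝ, ∀ t z, ‖f t z‖ ≤ R → ‖z‖ ≤ R') :
    ∃ F : T → ℂ ≃ₜ ℂ, (∀ t z, F t z = f t z) ∧
      Continuous fun q : T × ℂ => (F q.1).symm q.2 := by
  -- Treating all parameters at once, `Φ` is a proper continuous bijection, hence closed, hence a
  -- homeomorphism; this yields the joint continuity of the inverses.
  let Φ : T × ℂ → T × ℂ := fun q => (q.1, f q.1 q.2)
  have hΦ : Continuous Φ := continuous_fst.prodMk hc
  have hbij : Function.Bijective Φ := by
    constructor
    · rintro ⟨t, z⟩ ⟨s, w⟩ h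
      simp only [Φ, Prod.mk.injEq] at h
      obtain ⟨rfl, h⟩ := h
      rw [(hb t).1 h]
    · rintro ⟨t, z⟩
      obtain ⟨w, hw⟩ := (hb t).2 z
      exact ⟨(t, w), by simp [Φ, hw]⟩
  have hprop : IsProperMap Φ := by
    rw [isProperMap_iff_isCompact_preimage]
    refine ⟨hΦ, fun K hK => ?_⟩
    obtain ⟨R, hR⟩ := (hK.image continuous_snd).isBounded.subset_closedBall 0
    obtain ⟨R', hR'⟩ := hp R
    refine (isCompact_univ.prod (isCompact_closedBall (0 : ℂ) R')).of_isClosed_subset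
      (hK.isClosed.preimage hΦ) ?_
    rintro ⟨t, z⟩ hz
    refine ⟨mem_univ _, ?_⟩
    have : f t z ∈ Metric.closedBall (0 : ℂ) R := hR ⟨_, hz, rfl⟩
    simp only [mem_closedBall_zero_iff] at this ⊢
    exact hR' t z this
  have hhom : IsHomeomorph Φ :=
    isHomeomorph_iff_continuous_isClosedMap_bijective.2 ⟨hΦ, hprop.isClosedMap, hbij⟩
  let e := hhom.homeomorph
  have h1 : ∀ q, (e.symm q).1 = q.1 := fun q => by
    have h : Φ (e.symm q) = q := e.apply_symm_apply q
    have h3 := congrArg Prod.fst h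
    exact h3
  have h2 : ∀ t z, f t (e.symm (t, z)).2 = z := fun t z => by
    have h : Φ (e.symm (t, z)) = (t, z) := e.apply_symm_apply (t, z)
    have h3 := congrArg Prod.snd h
    simp only [Φ, h1] at h3
    exact h3
  refine ⟨fun t =>
    { toFun := f t
      invFun := fun z => (e.symm (t, z)).2
      left_inv := fun z => (hb t).1 (h2 t _)
      right_inv := fun z => h2 t z
      continuous_toFun := hc.comp (Continuous.prodMk_right t)
      continuous_invFun := (continuous_snd.comp e.symm.continuous).comp
        (Continuous.prodMk_right t) }, fun t z => rfl, ?_⟩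
  exact continuous_snd.comp e.symm.continuous

theorem exists_isotopy (f : unitInterval → ℂ → ℂ)
    (hc : Continuous fun q : unitInterval × ℂ => f q.1 q.2)
    (hb : ∀ t, Function.Bijective (f t)) (h0 : ∀ z, f 0 z = z)
    (hp : ∀ R : ℝ, ∃ R' : ℝ, ∀ t z, ‖f t z‖ ≤ R → ‖z‖ ≤ R') :
    ∃ F : unitInterval → ℂ ≃ₜ ℂ, IsIsotopy F ∧ ∀ t z, F t z = f t z := by
  obtain ⟨F, hF, hi⟩ := exists_homeomorph_family f hc hb hp
  refine ⟨F, ⟨by simpa only [hF] using hc, hi, ?_⟩, hF⟩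
  ext z
  simp [hF, h0]

namespace IsIsotopy

variable {F G : unitInterval → ℂ ≃ₜ ℂ}

/-- Isotopies are composed at each time, not run one after the other. -/
theorem trans (hF : IsIsotopy F) (hG : IsIsotopy G) : IsIsotopy fun t => (F t).trans (G t) where
  continuous_toFun := hG.continuous_toFun.comp (continuous_fst.prodMk hF.continuous_toFun)
  continuous_invFun := hF.continuous_invFun.comp (continuous_fst.prodMk hG.continuous_invFun)
  start := by rw [hF.start, hG.start]; rfl

theorem symm (hF : IsIsotopy F) : IsIsotopy fun t => (F t).symm where
  continuous_toFun := hF.continuous_invFun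
  continuous_invFun := hF.continuous_toFun
  start := by rw [hF.start]; rfl

theorem conj (hF : IsIsotopy F) (h : ℂ ≃ₜ ℂ) :
    IsIsotopy fun t => (h.symm.trans (F t)).trans h where
  continuous_toFun := h.continuous.comp
    (hF.continuous_toFun.comp (continuous_fst.prodMk (h.symm.continuous.comp continuous_snd)))
  continuous_invFun := h.continuous.comp
    (hF.continuous_invFun.comp (continuous_fst.prodMk (h.symm.continuous.comp continuous_snd)))
  start := by rw [hF.start]; ext z; simp

theorem continuous_apply (hF : IsIsotopy F) (z : ℂ) : Continuous fun t => F t z :=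
  hF.continuous_toFun.comp (Continuous.prodMk_left z)

theorem start_apply (hF : IsIsotopy F) (z : ℂ) : F 0 z = z := by rw [hF.start]; rfl

end IsIsotopy

theorem surjective_of_abs_sub_le {f : ℝ → ℝ} (hf : Continuous f) {D : ℝ}
    (hD : ∀ y, |f y - y| ≤ D) : Function.Surjective f := by
  intro c
  have h1 := abs_le.1 (hD (c - D))
  have h2 := abs_le.1 (hD (c + D))
  have h0 : 0 ≤ D := (abs_nonneg _).trans (hD 0)
  obtain ⟨y, -, hy⟩ := intermediate_value_Icc (by linarith : c - D ≤ c + D) hf.continuousOn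
    (show c ∈ Icc (f (c - D)) (f (c + D)) from ⟨by linarith, by linarith⟩)
  exact ⟨y, hy⟩

theorem continuous_complex_mk {X : Type*} [TopologicalSpace X] {f g : X → ℝ}
    (hf : Continuous f) (hg : Continuous g) : Continuous fun x => (⟨f x, g x⟩ : ℂ) :=
  Complex.equivRealProdCLM.symm.continuous.comp (hf.prodMk hg)

/-- Fibrewise increasing homeomorphisms of the vertical lines give an isotopy. -/
theorem exists_vertical_isotopy (k : ℝ → ℝ → ℝ) (hk : Continuous fun q : ℝ × ℝ => k q.1 q.2)
    (hm : ∀ x, StrictMono (k x)) (D : ℝ → ℝ) (hD : Continuous D)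
    (hkD : ∀ x y, |k x y - y| ≤ D x) :
    ∃ F : unitInterval → ℂ ≃ₜ ℂ, IsIsotopy F ∧
      ∀ (t : unitInterval) z, F t z = ⟨z.re, (1 - t) * z.im + t * k z.re z.im⟩ := by
  have hkx : ∀ x, Continuous (k x) := fun x => hk.comp (Continuous.prodMk_right x)
  have hbd : ∀ (t : unitInterval) x y, |((1 - t) * y + t * k x y) - y| ≤ D x := by
    intro t x y
    have : ((1 - (t : ℝ)) * y + t * k x y) - y = t * (k x y - y) := by ring
    rw [this, abs_mul, abs_of_nonneg t.2.1]
    calc (t : ℝ) * |k x y - y| ≤ 1 * |k x y - y| :=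
          mul_le_mul_of_nonneg_right t.2.2 (abs_nonneg _)
      _ ≤ D x := by rw [one_mul]; exact hkD x y
  have hmono : ∀ (t : unitInterval) x, StrictMono fun y => (1 - (t : ℝ)) * y + t * k x y := by
    intro t x y y' h
    have h1 := hm x h
    have ht0 := t.2.1
    have ht1 := t.2.2
    rcases eq_or_lt_of_le ht0 with h0 | h0
    · simp only [← h0]; linarith
    · have := mul_lt_mul_of_pos_left h1 h0
      have := mul_le_mul_of_nonneg_left h.le (sub_nonneg.2 ht1)
      simp only
      linarith
  refine exists_isotopy (fun t z => ⟨z.re, (1 - t) * z.im + t * k z.re z.im⟩) ?_ ?_ ?_ ?_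
  · have : Continuous fun q : unitInterval × ℂ => k q.2.re q.2.im :=
      hk.comp (by fun_prop : Continuous fun q : unitInterval × ℂ => (q.2.re, q.2.im))
    exact continuous_complex_mk (by fun_prop) (by fun_prop)
  · intro t
    constructor
    · intro z w h
      simp only [Complex.mk.injEq] at h
      obtain ⟨h1, h2⟩ := h
      rw [h1] at h2
      exact Complex.ext h1 ((hmono t w.re).injective h2)
    · intro z
      obtain ⟨y, hy⟩ := surjective_of_abs_sub_le
        (f := fun y => (1 - (t : ℝ)) * y + t * k z.re y) (by have := hkx z.re; fun_prop)
        (hbd t z.re) z.im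
      exact ⟨⟨z.re, y⟩, Complex.ext rfl hy⟩
  · intro z; simp
  · intro R
    obtain ⟨B, hB⟩ := (isCompact_Icc (a := -R) (b := R)).exists_bound_of_continuousOn hD.continuousOn
    refine ⟨R + (R + B), fun t z hz => ?_⟩
    have h1 : |z.re| ≤ R := (Complex.abs_re_le_norm
      (⟨z.re, (1 - t) * z.im + t * k z.re z.im⟩ : ℂ)).trans hz
    have h2 := (Complex.abs_im_le_norm _).trans hz
    simp only at h2
    have h3 := hbd t z.re z.im
    have h4 : D z.re ≤ B := (le_abs_self _).trans (hB z.re ⟨(abs_le.1 h1).1, (abs_le.1 h1).2⟩)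
    have h5 : |z.im| ≤ R + B := by
      rw [abs_le] at *
      constructor <;> linarith [h2.1, h2.2, h3.1, h3.2]
    exact (Complex.norm_le_abs_re_add_abs_im z).trans (add_le_add h1 h5)

/-- The exchange of the two coordinates. -/
def coordSwap : ℂ ≃ₜ ℂ where
  toFun z := ⟨z.im, z.re⟩
  invFun z := ⟨z.im, z.re⟩
  left_inv _ := rfl
  right_inv _ := rfl
  continuous_toFun := continuous_complex_mk Complex.continuous_im Complex.continuous_re
  continuous_invFun := continuous_complex_mk Complex.continuous_im Complex.continuous_re

/-- Fibrewise increasing homeomorphisms of the horizontal lines give an isotopy. -/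
theorem exists_horizontal_isotopy (k : ℝ → ℝ → ℝ) (hk : Continuous fun q : ℝ × ℝ => k q.1 q.2)
    (hm : ∀ y, StrictMono (k y)) (D : ℝ → ℝ) (hD : Continuous D)
    (hkD : ∀ y x, |k y x - x| ≤ D y) :
    ∃ F : unitInterval → ℂ ≃ₜ ℂ, IsIsotopy F ∧
      ∀ (t : unitInterval) z, F t z = ⟨(1 - t) * z.re + t * k z.im z.re, z.im⟩ := by
  obtain ⟨F, hF, hFz⟩ := exists_vertical_isotopy k hk hm D hD hkD
  refine ⟨_, hF.conj coordSwap, fun t z => ?_⟩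
  change coordSwap (F t ⟨z.im, z.re⟩) = _
  rw [hFz]
  rfl

/-- Rotations of the points of each circle around the origin by varying angles, which keep their
cyclic order, give an isotopy. -/
theorem exists_twist_isotopy (ψ : ℂ → ℝ) (hψ : ContinuousOn ψ {0}ᶜ)
    (hm : ∀ r : ℝ, 0 < r →
      StrictMonoOn (fun θ : ℝ => θ + ψ (r * exp (θ * I))) (Icc (-Real.pi) Real.pi)) :
    ∃ F : unitInterval → ℂ ≃ₜ ℂ, IsIsotopy F ∧
      ∀ (t : unitInterval) z, F t z = z * exp (((t : ℝ) * ψ z : ℝ) * I) := by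
  have hnorm : ∀ (t : unitInterval) z, ‖z * exp (((t : ℝ) * ψ z : ℝ) * I)‖ = ‖z‖ := by
    intro t z
    rw [norm_mul, norm_exp_ofReal_mul_I, mul_one]
  have hmono : ∀ (t : unitInterval) (r : ℝ), 0 < r →
      StrictMonoOn (fun θ : ℝ => θ + t * ψ (r * exp (θ * I))) (Icc (-Real.pi) Real.pi) := by
    intro t r hr θ hθ θ' hθ' h
    have h1 := hm r hr hθ hθ' h
    have ht0 := t.2.1
    have ht1 := t.2.2
    simp only at h1 ⊢
    rcases eq_or_lt_of_le ht0 with h0 | h0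
    · simp only [← h0]; linarith
    · have := mul_lt_mul_of_pos_left h1 h0
      have := mul_le_mul_of_nonneg_left h.le (sub_nonneg.2 ht1)
      linarith
  have hexp : ∀ (t : unitInterval) (r θ : ℝ),
      (r * exp (θ * I)) * exp (((t : ℝ) * ψ (r * exp (θ * I)) : ℝ) * I)
        = r * exp (((θ + t * ψ (r * exp (θ * I)) : ℝ)) * I) := by
    intro t r θ
    rw [mul_assoc, ← Complex.exp_add]
    congr 2
    push_cast
    ring
  refine exists_isotopy (fun t z => z * exp (((t : ℝ) * ψ z : ℝ) * I)) ?_ ?_ ?_ ?_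
  -- The angle need not have a limit at 0; continuity there comes from the preservation of the norm.
  · rw [continuous_iff_continuousAt]
    rintro ⟨t, z⟩
    by_cases hz : z = 0
    · subst hz
      have : Tendsto (fun q : unitInterval × ℂ => ‖q.2‖) (𝓝 (t, 0)) (𝓝 0) := by
        have : Continuous fun q : unitInterval × ℂ => ‖q.2‖ := by fun_prop
        simpa using this.tendsto (t, (0 : ℂ))
      have h2 := tendsto_zero_iff_norm_tendsto_zero.2
        (this.congr fun q : unitInterval × ℂ => (hnorm q.1 q.2).symm)
      simpa [ContinuousAt] using h2
    · have h1 : ContinuousAt ψ z := hψ.continuousAt (isOpen_compl_singleton.mem_nhds hz)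
      have h2 : ContinuousAt (fun q : unitInterval × ℂ => ψ q.2) (t, z) :=
        ContinuousAt.comp (f := fun q : unitInterval × ℂ => q.2) h1 continuousAt_snd
      have h3 : ContinuousAt (fun q : unitInterval × ℂ => ((q.1 : ℝ) * ψ q.2 : ℝ)) (t, z) :=
        ((continuous_subtype_val.comp continuous_fst).continuousAt).mul h2
      have h4 : ContinuousAt (fun q : unitInterval × ℂ => (((q.1 : ℝ) * ψ q.2 : ℝ) : ℂ) * I)
          (t, z) := (Complex.continuous_ofReal.continuousAt.comp h3).mul continuousAt_const
      exact continuousAt_snd.mul (Complex.continuous_exp.continuousAt.comp h4)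
  · intro t
    have hpi := Real.pi_pos
    constructor
    · intro z w h
      simp only at h
      have hn : ‖z‖ = ‖w‖ := by rw [← hnorm t z, ← hnorm t w, h]
      by_cases hz : z = 0
      · subst hz
        rw [norm_zero] at hn
        exact (norm_eq_zero.1 hn.symm).symm
      have hr : 0 < ‖z‖ := norm_pos_iff.2 hz
      have hz1 : z = ‖z‖ * exp (arg z * I) := (norm_mul_exp_arg_mul_I z).symm
      have hw1 : w = ‖z‖ * exp (arg w * I) := by rw [hn]; exact (norm_mul_exp_arg_mul_I w).symm
      rw [hz1, hw1, hexp, hexp] at h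
      have h3 := mul_left_cancel₀ (by exact_mod_cast hr.ne') h
      rw [Complex.exp_eq_exp_iff_exists_int] at h3
      obtain ⟨m, hm'⟩ := h3
      have h4 : arg z + t * ψ (‖z‖ * exp (arg z * I)) =
          arg w + t * ψ (‖z‖ * exp (arg w * I)) + m * (2 * Real.pi) := by
        have := congrArg Complex.im hm'
        simpa using this
      have hlow := fun u : ℂ => (hmono t ‖z‖ hr) (⟨le_refl _, by linarith⟩ : -Real.pi ∈ Icc (-Real.pi) Real.pi)
        (⟨(neg_pi_lt_arg u).le, arg_le_pi u⟩ : arg u ∈ Icc (-Real.pi) Real.pi)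
        (neg_pi_lt_arg u)
      have hup := fun u : ℂ => (hmono t ‖z‖ hr).monotoneOn
        (⟨(neg_pi_lt_arg u).le, arg_le_pi u⟩ : arg u ∈ Icc (-Real.pi) Real.pi)
        (⟨by linarith, le_refl _⟩ : Real.pi ∈ Icc (-Real.pi) Real.pi) (arg_le_pi u)
      have hper : exp ((-Real.pi : ℝ) * I) = exp ((Real.pi : ℝ) * I) := by
        rw [Complex.exp_eq_exp_iff_exists_int]
        exact ⟨-1, by push_cast; ring⟩
      have e1 := hlow z
      have e2 := hlow w
      have e3 := hup z
      have e4 := hup w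
      simp only [hper] at e1 e2 e3 e4
      -- Both lifted angles lie in the same half-open interval of length 2π, between the values at
      -- -π and π.
      have hm0 : m = 0 := by
        have a1 : (m : ℝ) * (2 * Real.pi) < 1 * (2 * Real.pi) := by linarith
        have a2 : (-1) * (2 * Real.pi) < (m : ℝ) * (2 * Real.pi) := by linarith
        have b1 : (m : ℝ) < 1 := lt_of_mul_lt_mul_right a1 (by linarith)
        have b2 : (-1 : ℝ) < m := lt_of_mul_lt_mul_right a2 (by linarith)
        have c1 : m < 1 := by exact_mod_cast b1
        have c2 : -1 < m := by exact_mod_cast b2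
        omega
      rw [hm0] at h4
      have h5 : arg z = arg w := (hmono t ‖z‖ hr).injOn
        ⟨(neg_pi_lt_arg z).le, arg_le_pi z⟩ ⟨(neg_pi_lt_arg w).le, arg_le_pi w⟩ (by simpa using h4)
      rw [hz1, h5]
      exact hw1.symm
    · intro w
      by_cases hw : w = 0
      · exact ⟨0, by simp [hw]⟩
      have hr : 0 < ‖w‖ := norm_pos_iff.2 hw
      set h := fun θ : ℝ => θ + t * ψ (‖w‖ * exp (θ * I)) with hh
      have hcont : ContinuousOn h (Icc (-Real.pi) Real.pi) := by
        have h0 : Continuous fun θ : ℝ => (‖w‖ * exp (θ * I) : ℂ) := by fun_prop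
        have : Continuous fun θ : ℝ => ψ (‖w‖ * exp (θ * I)) :=
          hψ.comp_continuous h0 fun θ => by
            simpa using hw
        exact (continuous_id.add (continuous_const.mul this)).continuousOn
      have hper : exp ((-Real.pi : ℝ) * I) = exp ((Real.pi : ℝ) * I) := by
        rw [Complex.exp_eq_exp_iff_exists_int]
        exact ⟨-1, by push_cast; ring⟩
      have hends : h Real.pi = h (-Real.pi) + 2 * Real.pi := by
        simp only [hh, hper]; ring
      -- The lifted angle sweeps an interval of length exactly 2π, which contains a determination of
      -- the argument of `w`.
      obtain ⟨m, hm1, hm2⟩ : ∃ m : ℤ, h (-Real.pi) ≤ arg w + m * (2 * Real.pi) ∧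
          arg w + m * (2 * Real.pi) ≤ h (-Real.pi) + 2 * Real.pi := by
        refine ⟨⌈(h (-Real.pi) - arg w) / (2 * Real.pi)⌉, ?_, ?_⟩
        · have := Int.le_ceil ((h (-Real.pi) - arg w) / (2 * Real.pi))
          rw [div_le_iff₀ (by linarith)] at this
          linarith
        · have := (Int.ceil_lt_add_one ((h (-Real.pi) - arg w) / (2 * Real.pi))).le
          rw [← sub_le_iff_le_add, le_div_iff₀ (by linarith)] at this
          linarith
      obtain ⟨θ, -, hθ⟩ := intermediate_value_Icc (by linarith : -Real.pi ≤ Real.pi) hcont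
        (show arg w + m * (2 * Real.pi) ∈ Icc (h (-Real.pi)) (h Real.pi) from
          ⟨hm1, hends ▸ hm2⟩)
      refine ⟨‖w‖ * exp (θ * I), ?_⟩
      simp only
      rw [hexp]
      have : θ + t * ψ (‖w‖ * exp (θ * I)) = arg w + m * (2 * Real.pi) := hθ
      rw [this]
      conv_rhs => rw [← norm_mul_exp_arg_mul_I w]
      congr 1
      rw [Complex.exp_eq_exp_iff_exists_int]
      exact ⟨m, by push_cast; ring⟩
  · intro z; simp
  · exact fun R => ⟨R, fun t z hz => by rwa [hnorm] at hz⟩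

/-! ### Admissible triples and their normal form -/

/-- The distance of a real number to `{0, 1}`. -/
noncomputable def roof (x : ℝ) : ℝ := min |x| |x - 1|

theorem continuous_roof : Continuous roof := by unfold roof; fun_prop

theorem roof_zero : roof 0 = 0 := by simp [roof]

theorem roof_one : roof 1 = 0 := by simp [roof]

theorem roof_pos {x : ℝ} (h0 : x ≠ 0) (h1 : x ≠ 1) : 0 < roof x :=
  lt_min (abs_pos.2 h0) (abs_pos.2 (sub_ne_zero.2 h1))

theorem roof_nonneg (x : ℝ) : 0 ≤ roof x := le_min (abs_nonneg _) (abs_nonneg _)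

/-- The position of the second point of `c` after the affine map which takes the first point to `0`
and the third one to `1`. -/
noncomputable def shape (c : Fin 3 → ℂ) : ℂ := (c 1 - c 0) / (c 2 - c 0)

/-- The distance of the second point above the graph of `-roof`. -/
noncomputable def height (c : Fin 3 → ℂ) : ℝ := (shape c).im + roof (shape c).re

/-- The triples whose second point is, up to an affine map taking the others to `0` and `1`, above
the graph of `-roof`. -/
def Admissible (c : Fin 3 → ℂ) : Prop := c 0 ≠ c 2 ∧ 0 < height c

/-- The map taking the triple `c` to `(0, I, 1)`. -/
noncomputable def normFun (c : Fin 3 → ℂ) (z : ℂ) : ℂ :=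
  let ζ := (z - c 0) / (c 2 - c 0)
  -- A vertical shear flattens the graph of `-roof` onto the real axis, fixing 0 and 1; a linear map
  -- fixing the real axis then sends the second point to i.
  let y := ζ.im + roof ζ.re
  ⟨ζ.re - (shape c).re * (y / height c), y / height c⟩

/-- The inverse of `normFun`. -/
noncomputable def normInv (c : Fin 3 → ℂ) (z : ℂ) : ℂ :=
  let x := z.re + (shape c).re * z.im
  c 0 + (c 2 - c 0) * ⟨x, height c * z.im - roof x⟩

theorem normInv_normFun {c : Fin 3 → ℂ} (h : Admissible c) (z : ℂ) :
    normInv c (normFun c z) = z := by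
  have h1 : c 2 - c 0 ≠ 0 := sub_ne_zero.2 h.1.symm
  have h2 := h.2.ne'
  have e : ∀ a b : ℝ, height c * (a / height c) - b = a - b := fun a b => by
    rw [mul_div_cancel₀ _ h2]
  simp only [normInv, normFun, sub_add_cancel, e, add_sub_cancel_right, Complex.eta]
  rw [mul_div_cancel₀ _ h1]
  ring

theorem normFun_normInv {c : Fin 3 → ℂ} (h : Admissible c) (z : ℂ) :
    normFun c (normInv c z) = z := by
  have h1 : c 2 - c 0 ≠ 0 := sub_ne_zero.2 h.1.symm
  have h2 := h.2.ne'
  simp only [normInv, normFun, add_sub_cancel_left, mul_div_cancel_left₀ _ h1, sub_add_cancel,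
    mul_div_cancel_left₀ _ h2, add_sub_cancel_right, Complex.eta]

section

variable {X : Type*} [TopologicalSpace X] {c : X → Fin 3 → ℂ}

theorem continuous_shape (hc : Continuous c) (h : ∀ x, Admissible (c x)) :
    Continuous fun x => shape (c x) := by
  unfold shape
  exact Continuous.div₀ (by fun_prop) (by fun_prop) fun x => sub_ne_zero.2 (h x).1.symm

theorem continuous_height (hc : Continuous c) (h : ∀ x, Admissible (c x)) :
    Continuous fun x => height (c x) := by
  have := continuous_shape hc h
  unfold height
  exact (Complex.continuous_im.comp this).add
    (continuous_roof.comp (Complex.continuous_re.comp this))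

theorem continuous_normFun (hc : Continuous c) (h : ∀ x, Admissible (c x)) :
    Continuous fun q : X × ℂ => normFun (c q.1) q.2 := by
  have h1 := (continuous_shape hc h).comp (continuous_fst (X := X) (Y := ℂ))
  have h2 := (continuous_height hc h).comp (continuous_fst (X := X) (Y := ℂ))
  simp only [Function.comp_def] at h1 h2
  have h3 : Continuous fun q : X × ℂ => (q.2 - c q.1 0) / (c q.1 2 - c q.1 0) :=
    Continuous.div₀ (by fun_prop) (by fun_prop) fun q => sub_ne_zero.2 (h q.1).1.symm
  have h4 : Continuous fun q : X × ℂ => (((q.2 - c q.1 0) / (c q.1 2 - c q.1 0)).im +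
      roof ((q.2 - c q.1 0) / (c q.1 2 - c q.1 0)).re) / height (c q.1) :=
    ((Complex.continuous_im.comp h3).add
      (continuous_roof.comp (Complex.continuous_re.comp h3))).div₀ h2 fun q => (h q.1).2.ne'
  exact continuous_complex_mk
    ((Complex.continuous_re.comp h3).sub ((Complex.continuous_re.comp h1).mul h4)) h4

theorem continuous_normInv (hc : Continuous c) (h : ∀ x, Admissible (c x)) :
    Continuous fun q : X × ℂ => normInv (c q.1) q.2 := by
  have h1 := (continuous_shape hc h).comp (continuous_fst (X := X) (Y := ℂ))
  have h2 := (continuous_height hc h).comp (continuous_fst (X := X) (Y := ℂ))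
  simp only [Function.comp_def] at h1 h2
  have h3 : Continuous fun q : X × ℂ => q.2.re + (shape (c q.1)).re * q.2.im := by fun_prop
  unfold normInv
  refine Continuous.add (by fun_prop) (Continuous.mul (by fun_prop) ?_)
  exact continuous_complex_mk h3
    ((h2.mul (Complex.continuous_im.comp continuous_snd)).sub (continuous_roof.comp h3))

end

/-- The homeomorphism of the plane taking an admissible triple to `(0, I, 1)`. -/
noncomputable def normalizer (c : Fin 3 → ℂ) (h : Admissible c) : ℂ ≃ₜ ℂ where
  toFun := normFun c
  invFun := normInv c
  left_inv := normInv_normFun h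
  right_inv := normFun_normInv h
  continuous_toFun := (continuous_normFun (X := Unit) (c := fun _ => c) continuous_const
    fun _ => h).comp (Continuous.prodMk_right ())
  continuous_invFun := (continuous_normInv (X := Unit) (c := fun _ => c) continuous_const
    fun _ => h).comp (Continuous.prodMk_right ())

/-- The reference triple. -/
noncomputable def baseTriple : Fin 3 → ℂ := ![0, I, 1]

theorem normalizer_apply {c : Fin 3 → ℂ} (h : Admissible c) (i : Fin 3) :
    normalizer c h (c i) = baseTriple i := by
  have h1 : c 2 - c 0 ≠ 0 := sub_ne_zero.2 h.1.symm
  have h2 := h.2.ne'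
  change normFun c (c i) = _
  fin_cases i
  · simp [normFun, baseTriple, roof_zero, Complex.ext_iff]
  · have : (c 1 - c 0) / (c 2 - c 0) = shape c := rfl
    have h3 : (shape c).im + roof (shape c).re = height c := rfl
    simp [normFun, baseTriple, this, h3, h2, Complex.ext_iff]
  · simp [normFun, baseTriple, roof_one, h1, Complex.ext_iff]

theorem normalizer_symm_apply {c : Fin 3 → ℂ} (h : Admissible c) (i : Fin 3) :
    (normalizer c h).symm (baseTriple i) = c i := by
  rw [← normalizer_apply h, Homeomorph.symm_apply_apply]

/-! ### Moves between admissible triples -/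

/-- The ends of the isotopies which fix the reference triple all along. -/
def IsPure (g : ℂ ≃ₜ ℂ) : Prop :=
  ∃ F : unitInterval → ℂ ≃ₜ ℂ, IsIsotopy F ∧ F 1 = g ∧
    ∀ t i, F t (baseTriple i) = baseTriple i

theorem IsPure.trans {f g : ℂ ≃ₜ ℂ} (hf : IsPure f) (hg : IsPure g) : IsPure (f.trans g) := by
  obtain ⟨F, hF, rfl, hF'⟩ := hf
  obtain ⟨G, hG, rfl, hG'⟩ := hg
  exact ⟨_, hF.trans hG, rfl, fun t i => by simp [hF', hG']⟩

theorem IsPure.symm {f : ℂ ≃ₜ ℂ} (hf : IsPure f) : IsPure f.symm := by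
  obtain ⟨F, hF, rfl, hF'⟩ := hf
  refine ⟨_, hF.symm, rfl, fun t i => ?_⟩
  rw [Homeomorph.symm_apply_eq, hF']

/-- `f` takes the admissible triple `c` to the admissible triple `c'`, by an isotopy which moves it
through admissible triples. -/
def IsMove (c : Fin 3 → ℂ) (f : ℂ ≃ₜ ℂ) (c' : Fin 3 → ℂ) : Prop :=
  ∃ (h : Admissible c) (h' : Admissible c'),
    IsPure ((normalizer c h).symm.trans (f.trans (normalizer c' h')))

/-- The intermediate normalizer cancels against its inverse, so no paths have to be concatenated. -/
theorem IsMove.trans {c c' c'' : Fin 3 → ℂ} {f g : ℂ ≃ₜ ℂ} (hf : IsMove c f c')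
    (hg : IsMove c' g c'') : IsMove c (f.trans g) c'' := by
  obtain ⟨h, h', hf⟩ := hf
  obtain ⟨_, h'', hg⟩ := hg
  refine ⟨h, h'', ?_⟩
  convert hf.trans hg using 1
  ext z
  simp

theorem IsMove.symm {c c' : Fin 3 → ℂ} {f : ℂ ≃ₜ ℂ} (hf : IsMove c f c') :
    IsMove c' f.symm c := by
  obtain ⟨h, h', hf⟩ := hf
  exact ⟨h', h, hf.symm⟩

/-- Composing each `F t` with the normalizer of the triple reached at time t gives an isotopy that
fixes the reference triple. -/
theorem IsIsotopy.isMove {F : unitInterval → ℂ ≃ₜ ℂ} (hF : IsIsotopy F) {c c' : Fin 3 → ℂ}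
    (h : ∀ t, Admissible fun i => F t (c i)) (h1 : ∀ i, F 1 (c i) = c' i) :
    IsMove c (F 1) c' := by
  have hγ : Continuous fun t i => F t (c i) := continuous_pi fun i => hF.continuous_apply _
  have e0 : (fun i => F 0 (c i)) = c := funext fun i => hF.start_apply _
  have e1 : (fun i => F 1 (c i)) = c' := funext h1
  have a0 : Admissible c := e0 ▸ h 0
  have a1 : Admissible c' := e1 ▸ h 1
  refine ⟨a0, a1,
    fun t => (normalizer c a0).symm.trans ((F t).trans (normalizer _ (h t))), ⟨?_, ?_, ?_⟩, ?_, ?_⟩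
  · exact (continuous_normFun hγ h).comp (continuous_fst.prodMk (hF.continuous_toFun.comp
      (continuous_fst.prodMk ((normalizer c a0).symm.continuous.comp continuous_snd))))
  · exact (normalizer c a0).continuous.comp (hF.continuous_invFun.comp
      (continuous_fst.prodMk (continuous_normInv hγ h)))
  · ext z
    simp [hF.start_apply]
  · have : normalizer _ (h 1) = normalizer c' a1 := by congr 1
    simp only [this]
  · intro t i
    simp only [Homeomorph.trans_apply, normalizer_symm_apply]
    exact normalizer_apply (h t) i

/-- The path may be chosen freely because the normalizer depends on the triple alone. Even a full
turn of the triple is harmless, isotopies of the plane being unconstrained near infinity. -/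
theorem IsMove.exists_isotopy {c c' : Fin 3 → ℂ} {f : ℂ ≃ₜ ℂ} (hf : IsMove c f c')
    (γ : unitInterval → Fin 3 → ℂ) (hγ : Continuous γ) (h : ∀ t, Admissible (γ t))
    (h0 : γ 0 = c) (h1 : γ 1 = c') :
    ∃ F : unitInterval → ℂ ≃ₜ ℂ, IsIsotopy F ∧ F 1 = f ∧ ∀ t i, F t (c i) = γ t i := by
  subst h0 h1
  obtain ⟨a0, a1, G, hG, hG1, hG'⟩ := hf
  refine ⟨fun t => (normalizer _ a0).trans ((G t).trans (normalizer _ (h t)).symm),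
    ⟨?_, ?_, ?_⟩, ?_, ?_⟩
  · exact (continuous_normInv hγ h).comp (continuous_fst.prodMk (hG.continuous_toFun.comp
      (continuous_fst.prodMk ((normalizer _ a0).continuous.comp continuous_snd))))
  · exact (normalizer _ a0).symm.continuous.comp (hG.continuous_invFun.comp
      (continuous_fst.prodMk (continuous_normFun hγ h)))
  · ext z
    simp [hG.start_apply]
  · ext z
    simp [hG1]
  · intro t i
    simp only [Homeomorph.trans_apply, normalizer_apply, hG']
    exact normalizer_symm_apply (h t) i

/-! ### Real triples, topological types and reduction to one model -/

/-- Three real points as a triple of points of the plane. -/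
noncomputable def realTriple (x : Fin 3 → ℝ) : Fin 3 → ℂ := fun i => x i

/-- On the real axis `roof` vanishes only at 0 and 1, the positions where the second point would
meet an outer one. -/
theorem admissible_of_im_nonneg {c : Fin 3 → ℂ} (hc : Function.Injective c)
    (h : 0 ≤ (shape c).im) : Admissible c := by
  have h20 : c 2 - c 0 ≠ 0 := sub_ne_zero.2 (hc.ne (by decide))
  have h10 : c 1 - c 0 ≠ 0 := sub_ne_zero.2 (hc.ne (by decide))
  have h12 : c 1 ≠ c 2 := hc.ne (by decide)
  refine ⟨hc.ne (by decide), ?_⟩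
  rcases h.lt_or_eq with h | h
  · exact add_pos_of_pos_of_nonneg h (roof_nonneg _)
  · rw [height, ← h, zero_add]
    refine roof_pos (fun h0 => ?_) (fun h1 => ?_)
    · have : shape c = 0 := Complex.ext h0 h.symm
      exact div_ne_zero h10 h20 this
    · have : shape c = 1 := Complex.ext h1 h.symm
      rw [shape, div_eq_one_iff_eq h20] at this
      exact h12 (sub_left_injective this)

theorem shape_im_of_real {c : Fin 3 → ℂ} (h0 : (c 0).im = 0) (h2 : (c 2).im = 0) :
    (shape c).im = (c 1).im / ((c 2).re - (c 0).re) := by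
  have : c 2 - c 0 = (((c 2).re - (c 0).re : ℝ) : ℂ) := Complex.ext (by simp) (by simp [h0, h2])
  rw [shape, this, Complex.div_ofReal_im]
  simp [h0]

theorem admissible_realTriple {x : Fin 3 → ℝ} (hx : Function.Injective x) :
    Admissible (realTriple x) :=
  admissible_of_im_nonneg (Complex.ofReal_injective.comp hx) (by
    rw [shape_im_of_real] <;> simp [realTriple])

/-- The straight path from a real triple to another one. -/
noncomputable def straightPath (y x : Fin 3 → ℝ) (t : unitInterval) : Fin 3 → ℝ :=
  fun i => (1 - t) * y i + t * x i

theorem straightPath_strictMono {y x : Fin 3 → ℝ} (hy : StrictMono y) (hx : StrictMono x)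
    (t : unitInterval) : StrictMono (straightPath y x t) := by
  intro i j h
  have h1 := hy h
  have h2 := hx h
  have ht0 := t.2.1
  have ht1 := t.2.2
  simp only [straightPath]
  rcases eq_or_lt_of_le ht0 with h0 | h0
  · simp only [← h0]; linarith
  · have := mul_lt_mul_of_pos_left h2 h0
    have := mul_le_mul_of_nonneg_left h1.le (sub_nonneg.2 ht1)
    linarith

/-- A real triple is admissible as soon as its points are distinct, in whatever order they are
labelled; the relabelled straight path is therefore allowed. -/
theorem IsMove.exists_isotopy_straight {y x : Fin 3 → ℝ} (hy : StrictMono y) (hx : StrictMono x)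
    (σ : Equiv.Perm (Fin 3)) {f : ℂ ≃ₜ ℂ}
    (hf : IsMove (realTriple (y ∘ σ)) f (realTriple (x ∘ σ))) :
    ∃ F : unitInterval → ℂ ≃ₜ ℂ, IsIsotopy F ∧ F 1 = f ∧
      ∀ t i, F t (y i) = (straightPath y x t i : ℂ) := by
  obtain ⟨F, hF, hF1, hFt⟩ := hf.exists_isotopy (fun t => realTriple (straightPath y x t ∘ σ))
    (continuous_pi fun i => by simp only [realTriple, straightPath, Function.comp]; fun_prop)
    (fun t => admissible_realTriple
      ((straightPath_strictMono hy hx t).injective.comp σ.injective))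
    (by funext i; simp [realTriple, straightPath]) (by funext i; simp [realTriple, straightPath])
  refine ⟨F, hF, hF1, fun t i => ?_⟩
  have := hFt t (σ.symm i)
  simpa [realTriple] using this

/-- A move realised along the straight path is a move for every labelling, since that path is
admissible for all of them. This undoes the exchange of labels made by type A. -/
theorem IsMove.perm {y x : Fin 3 → ℝ} (hy : StrictMono y) (hx : StrictMono x)
    (σ τ : Equiv.Perm (Fin 3)) {f : ℂ ≃ₜ ℂ}
    (hf : IsMove (realTriple (y ∘ σ)) f (realTriple (x ∘ σ))) :
    IsMove (realTriple (y ∘ τ)) f (realTriple (x ∘ τ)) := by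
  obtain ⟨F, hF, rfl, hFt⟩ := hf.exists_isotopy_straight hy hx σ
  refine hF.isMove (fun t => ?_) fun i => ?_
  · have : (fun i => F t (realTriple (y ∘ τ) i)) = realTriple (straightPath y x t ∘ τ) :=
      funext fun i => hFt t _
    rw [this]
    exact admissible_realTriple ((straightPath_strictMono hy hx t).injective.comp τ.injective)
  · have := hFt 1 (τ i)
    simpa [realTriple, straightPath] using this

theorem pos_of_continuous_ne_zero {f : unitInterval → ℝ} (hf : Continuous f) (h : ∀ t, f t ≠ 0)
    (h0 : 0 < f 0) (t : unitInterval) : 0 < f t := by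
  by_contra ht
  obtain ⟨s, hs⟩ := mem_range_of_exists_le_of_exists_ge hf ⟨t, not_lt.1 ht⟩ ⟨0, h0.le⟩
  exact h s hs

theorem IsIsotopy.re_lt_re {F : unitInterval → ℂ ≃ₜ ℂ} (hF : IsIsotopy F) {z w : ℂ}
    (hz : ∀ t, (F t z).im = 0) (hw : ∀ t, (F t w).im = 0) (h : z.re < w.re) (t : unitInterval) :
    (F t z).re < (F t w).re := by
  have h1 := hF.continuous_apply z
  have h2 := hF.continuous_apply w
  refine sub_pos.1 (pos_of_continuous_ne_zero (f := fun t => (F t w).re - (F t z).re)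
    (by fun_prop) (fun t ht => ?_) (by simpa [hF.start_apply] using h) t)
  have : F t w = F t z := Complex.ext (sub_eq_zero.1 ht) (by rw [hz, hw])
  exact h.ne' (congrArg Complex.re ((F t).injective this))

/-- Points moving on the axis keep their order, so the isotopies in the definition are moves;
conversely a move can be realised along the straight path, which stays on the axis. -/
theorem mem_topType {y x : Fin 3 → ℝ} (hy : StrictMono y) (hx : StrictMono x) {S H : Set ℂ} :
    H ∈ topType y x S ↔ ∃ f, IsMove (realTriple y) f (realTriple x) ∧ f '' S = H := by
  constructor
  · rintro ⟨F, hF, him, hr, rfl⟩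
    refine ⟨F 1, ?_, rfl⟩
    have hm : ∀ t, StrictMono fun i => (F t (y i)).re := fun t i j hij =>
      hF.re_lt_re (fun t => him t i) (fun t => him t j) (by simpa using hy hij) t
    have hre : ∀ t i, F t (y i) = ((F t (y i)).re : ℂ) := fun t i =>
      Complex.ext (by simp) (by simp [him])
    refine hF.isMove (fun t => ?_) fun i => ?_
    · have : (fun i => F t (realTriple y i)) = realTriple fun i => (F t (y i)).re :=
        funext fun i => hre t i
      rw [this]
      exact admissible_realTriple (hm t).injective
    · have hrange : range (fun i => (F 1 (y i)).re) = range x := by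
        have : range (fun i => (F 1 (y i)).re) = Complex.re '' (F 1 '' range fun i => (y i : ℂ)) := by
          rw [← range_comp, ← range_comp]; rfl
        rw [this, hr, ← range_comp]
        rfl
      -- Only the set of final positions is prescribed; the preserved order recovers the individual
      -- points.
      have := StrictMono.range_inj (hm 1) hx |>.1 hrange
      simp only [realTriple]
      rw [hre, congrFun this i]
  · rintro ⟨f, hf, rfl⟩
    obtain ⟨F, hF, rfl, hFt⟩ := IsMove.exists_isotopy_straight (σ := Equiv.refl _) hy hx hf
    refine ⟨F, hF, fun t i => by rw [hFt]; simp, ?_, rfl⟩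
    rw [← range_comp]
    congr 1
    funext i
    simp [hFt, straightPath]

/-- The outer points remain on the axis in the same order, so normalising them to 0 and 1 preserves
the sign of the imaginary part of the second point. -/
theorem IsTypeA.isMove {x : Fin 3 → ℝ} (hx : StrictMono x) {f : ℂ ≃ₜ ℂ} (hf : IsTypeA x f) :
    IsMove (realTriple x) f (realTriple (x ∘ Equiv.swap 0 1)) := by
  obtain ⟨h0, h1, h2, F, hF, rfl, hFt⟩ := hf
  have key : ∀ t : unitInterval,
      (F t (x 0)).im = 0 ∧ (F t (x 2)).im = 0 ∧ 0 ≤ (F t (x 1)).im := by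
    intro t
    rcases eq_or_lt_of_le t.2.1 with h | h
    · have : t = 0 := Subtype.ext h.symm
      simp [this, hF.start_apply]
    rcases eq_or_lt_of_le t.2.2 with h' | h'
    · have : t = 1 := Subtype.ext h'
      simp [this, h0, h1, h2]
    · obtain ⟨a, b, c⟩ := hFt t h h'
      exact ⟨a, b, not_lt.1 c⟩
  refine hF.isMove (fun t => ?_) fun i => ?_
  · refine admissible_of_im_nonneg
      ((F t).injective.comp (Complex.ofReal_injective.comp hx.injective)) ?_
    rw [shape_im_of_real (key t).1 (key t).2.1]
    refine div_nonneg (key t).2.2 (sub_nonneg.2 (le_of_lt ?_))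
    exact hF.re_lt_re (fun t => (key t).1) (fun t => (key t).2.1)
      (by simpa [realTriple] using hx (by decide : (0 : Fin 3) < 2)) t
  · fin_cases i
    · simpa [realTriple] using h0
    · simpa [realTriple] using h1
    · have : (Equiv.swap (0 : Fin 3) 1) 2 = 2 := by decide
      simpa [realTriple, this] using h2

/-- The effect of homeomorphisms of type `A` on topological types is that of any one model. -/
theorem IsTypeA.mapType_topType {x y y' : Fin 3 → ℝ} (hx : StrictMono x) (hy : StrictMono y)
    (hy' : StrictMono y') {f K : ℂ ≃ₜ ℂ} (hf : IsTypeA x f)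
    (hK : IsMove (realTriple y) K (realTriple (y' ∘ Equiv.swap 0 1))) (S : Set ℂ) :
    mapType f (topType y x S) = topType y' x (K '' S) := by
  have hf' := hf.isMove hx
  ext H
  simp only [mapType, mem_image, mem_topType hy hx, mem_topType hy' hx]
  constructor
  · rintro ⟨_, ⟨g, hg, rfl⟩, rfl⟩
    refine ⟨K.symm.trans (g.trans f), ?_, ?_⟩
    -- The composite joins triples that both carry the exchanged labels, and `IsMove.perm` restores
    -- the natural ones.
    · exact (hK.symm.trans (hg.trans hf')).perm hy' hx (Equiv.swap 0 1) (Equiv.refl _)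
    · simp [image_image]
  · rintro ⟨g, hg, rfl⟩
    have hg' := IsMove.perm hy' hx (Equiv.refl _) (Equiv.swap 0 1) hg
    refine ⟨_, ⟨K.trans (g.trans f.symm), hK.trans (hg'.trans hf'.symm), rfl⟩, ?_⟩
    simp [image_image]

/-! ### Sawtooth rotations -/

/-- An angle of rotation on the plane: it increases like `B` along an arc of each circle around
the origin, and decreases with slope `-k` on the complementary arc. -/
noncomputable def sawtooth (k α : ℝ) (B : ℝ → ℝ → ℝ) (z : ℂ) : ℝ :=
  max (k * (α - arg z)) (min (B ‖z‖ (arg z)) (k * (α + 2 * Real.pi - arg z)))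

section

variable {k α : ℝ} {B : ℝ → ℝ → ℝ}

/-- On the left half-plane only the descending branch is active, and its two expressions on either
side of the cut of `arg` agree. This is the role of the two bounds on `B`. -/
theorem sawtooth_of_re_neg
    (h1 : ∀ r θ, 0 < r → Real.pi / 2 ≤ θ → θ ≤ Real.pi → k * (α + 2 * Real.pi - θ) ≤ B r θ)
    (h2 : ∀ r θ, 0 < r → -Real.pi ≤ θ → θ ≤ -(Real.pi / 2) → B r θ ≤ k * (α - θ))
    (hk : 0 ≤ k) {z : ℂ} (hz : z.re < 0) :
    sawtooth k α B z = k * (α + Real.pi - arg (-z)) := by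
  have hz0 : 0 < ‖z‖ := norm_pos_iff.2 fun h => by simp [h] at hz
  have hpi := Real.pi_pos
  have habs : ¬ |arg z| ≤ Real.pi / 2 := fun h =>
    absurd (Complex.abs_arg_le_pi_div_two_iff.1 h) (not_le.2 hz)
  rw [sawtooth]
  by_cases him : 0 ≤ z.im
  · have h3 : arg (-z) = arg z - Real.pi := Complex.arg_neg_eq_arg_sub_pi_iff.2 (by
      rcases him.lt_or_eq with h | h
      · exact Or.inl h
      · exact Or.inr ⟨h.symm, hz⟩)
    have h4 : 0 ≤ arg z := Complex.arg_nonneg_iff.2 him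
    rw [abs_of_nonneg h4] at habs
    rw [min_eq_right (h1 _ _ hz0 (not_le.1 habs).le (arg_le_pi z)), max_eq_right, h3]
    · ring
    · exact mul_le_mul_of_nonneg_left (by linarith) hk
  · have h3 : arg (-z) = arg z + Real.pi :=
      Complex.arg_neg_eq_arg_add_pi_iff.2 (Or.inl (not_le.1 him))
    have h4 : arg z < 0 := Complex.arg_neg_iff.2 (not_le.1 him)
    rw [abs_of_neg h4] at habs
    rw [max_eq_left, h3]
    · ring
    · exact (min_le_left _ _).trans (h2 _ _ hz0 (neg_pi_lt_arg z).le (by linarith))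

/-- Away from the cut the formula is continuous; near the cut it equals the smooth expression of
`sawtooth_of_re_neg`. -/
theorem continuousOn_sawtooth
    (hB : ContinuousOn (fun q : ℝ × ℝ => B q.1 q.2) (Ioi 0 ×ˢ univ))
    (h1 : ∀ r θ, 0 < r → Real.pi / 2 ≤ θ → θ ≤ Real.pi → k * (α + 2 * Real.pi - θ) ≤ B r θ)
    (h2 : ∀ r θ, 0 < r → -Real.pi ≤ θ → θ ≤ -(Real.pi / 2) → B r θ ≤ k * (α - θ))
    (hk : 0 ≤ k) : ContinuousOn (sawtooth k α B) {0}ᶜ := by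
  intro z hz
  have hz0 : 0 < ‖z‖ := norm_pos_iff.2 hz
  refine ContinuousAt.continuousWithinAt ?_
  by_cases hs : z ∈ slitPlane
  · have ha : ContinuousAt arg z := continuousAt_arg hs
    have hb : ContinuousAt (fun z : ℂ => B ‖z‖ (arg z)) z :=
      ContinuousAt.comp (f := fun z : ℂ => (‖z‖, arg z)) (g := fun q : ℝ × ℝ => B q.1 q.2)
        (hB.continuousAt ((isOpen_Ioi.prod isOpen_univ).mem_nhds ⟨hz0, mem_univ _⟩))
        (continuousAt_id.norm.prodMk ha)
    exact (continuousAt_const.mul (continuousAt_const.sub ha)).max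
      (hb.min (continuousAt_const.mul (continuousAt_const.sub ha)))
  · have hre : z.re < 0 := by
      rw [mem_slitPlane_iff, not_or, not_lt, not_not] at hs
      exact lt_of_le_of_ne hs.1 fun h => hz (Complex.ext h hs.2)
    have ha : ContinuousAt (fun z : ℂ => arg (-z)) z :=
      ContinuousAt.comp (g := arg) (continuousAt_arg (Or.inl (by simpa using hre)))
        continuousAt_neg
    have hc : ContinuousAt (fun z : ℂ => k * (α + Real.pi - arg (-z))) z := by fun_prop
    refine hc.congr ?_
    filter_upwards [(isOpen_lt Complex.continuous_re continuous_const).mem_nhds hre] with w hw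
    exact (sawtooth_of_re_neg h1 h2 hk hw).symm

theorem sawtooth_polar
    (h1 : ∀ r θ, 0 < r → Real.pi / 2 ≤ θ → θ ≤ Real.pi → k * (α + 2 * Real.pi - θ) ≤ B r θ)
    (h2 : ∀ r θ, 0 < r → -Real.pi ≤ θ → θ ≤ -(Real.pi / 2) → B r θ ≤ k * (α - θ))
    (hk : 0 ≤ k) {r : ℝ} (hr : 0 < r) {θ : ℝ} (hθ : θ ∈ Icc (-Real.pi) Real.pi) :
    sawtooth k α B (r * exp (θ * I)) =
      max (k * (α - θ)) (min (B r θ) (k * (α + 2 * Real.pi - θ))) := by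
  have hpi := Real.pi_pos
  -- At -π the function `arg` takes the value π instead, so this end needs its own computation.
  rcases hθ.1.eq_or_lt with rfl | h
  · have : (r * exp ((-Real.pi : ℝ) * I) : ℂ) = ((-r : ℝ) : ℂ) := by
      rw [show ((-Real.pi : ℝ) * I : ℂ) = -(Real.pi * I) by push_cast; ring, Complex.exp_neg,
        Complex.exp_pi_mul_I]
      norm_num
    rw [this, sawtooth_of_re_neg h1 h2 hk (by simpa using hr), max_eq_left]
    · rw [← Complex.ofReal_neg, neg_neg, Complex.arg_ofReal_of_nonneg hr.le]
      ring
    · exact (min_le_left _ _).trans (h2 _ _ hr le_rfl (by linarith))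
  · have h3 : arg (r * exp (θ * I)) = θ := by
      rw [Complex.arg_real_mul _ hr, Complex.arg_exp_mul_I, toIocMod_eq_self]
      exact ⟨h, by linarith [hθ.2]⟩
    have h4 : ‖(r * exp (θ * I) : ℂ)‖ = r := by
      rw [norm_mul, norm_exp_ofReal_mul_I, mul_one, Complex.norm_of_nonneg hr.le]
    rw [sawtooth, h3, h4]

/-- After adding θ, the two descending branches have slope 1 - k > 0 and the ascending one has slope
at least 1; maxima and minima preserve strict growth. -/
theorem strictMonoOn_sawtooth
    (h1 : ∀ r θ, 0 < r → Real.pi / 2 ≤ θ → θ ≤ Real.pi → k * (α + 2 * Real.pi - θ) ≤ B r θ)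
    (h2 : ∀ r θ, 0 < r → -Real.pi ≤ θ → θ ≤ -(Real.pi / 2) → B r θ ≤ k * (α - θ))
    (hm : ∀ r, 0 < r → Monotone (B r)) (hk : 0 ≤ k) (hk1 : k < 1) {r : ℝ} (hr : 0 < r) :
    StrictMonoOn (fun θ : ℝ => θ + sawtooth k α B (r * exp (θ * I)))
      (Icc (-Real.pi) Real.pi) := by
  intro θ hθ θ' hθ' h
  simp only
  rw [sawtooth_polar h1 h2 hk hr hθ, sawtooth_polar h1 h2 hk hr hθ']
  have e1 := hm r hr h.le
  have e2 : k * (θ' - θ) < θ' - θ := by nlinarith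
  rw [← max_add_add_left, ← max_add_add_left, ← min_add_add_left, ← min_add_add_left]
  refine max_lt_max (by linarith) (min_lt_min (by linarith) (by linarith))

end

/-! ### Polar coordinates adapted to cut squares -/

/-- On each ray the gauge grows strictly from 0 to infinity, so it can replace the distance to 0 as
radial coordinate. -/
theorem exists_radial_homeomorph (G : ℂ → ℝ) (hG : Continuous G) {δ : ℝ} (hδ0 : 0 < δ)
    (hδ : ∀ z, δ * ‖z‖ ≤ G z) (h0 : G 0 = 0)
    (hs : ∀ z ≠ 0, ∀ c : ℝ, 0 < c → c < 1 → G (c * z) < G z) :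
    ∃ Γ : ℂ ≃ₜ ℂ, ∀ z, Γ z = ((G z / ‖z‖ : ℝ) : ℂ) * z := by
  have hpos : ∀ z ≠ 0, 0 < G z := fun z hz =>
    (mul_pos hδ0 (norm_pos_iff.2 hz)).trans_le (hδ z)
  have hnorm : ∀ z, ‖((G z / ‖z‖ : ℝ) : ℂ) * z‖ = G z := by
    intro z
    by_cases hz : z = 0
    · simp [hz, h0]
    · rw [norm_mul, Complex.norm_of_nonneg (div_nonneg (hpos z hz).le (norm_nonneg _)),
        div_mul_cancel₀ _ (norm_ne_zero_iff.2 hz)]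
  have hcont : Continuous fun z => ((G z / ‖z‖ : ℝ) : ℂ) * z := by
    rw [continuous_iff_continuousAt]
    intro z
    by_cases hz : z = 0
    · subst hz
      have h1 : Tendsto G (𝓝 0) (𝓝 0) := by simpa [h0] using hG.tendsto 0
      have h2 := tendsto_zero_iff_norm_tendsto_zero.2 (h1.congr fun q => (hnorm q).symm)
      simpa [ContinuousAt] using h2
    · have : ContinuousAt (fun z => G z / ‖z‖) z :=
        hG.continuousAt.div continuousAt_id.norm (norm_ne_zero_iff.2 hz)
      exact (Complex.continuous_ofReal.continuousAt.comp this).mul continuousAt_id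
  have hlt : ∀ z w : ℂ, z ≠ 0 → ∀ c : ℝ, 0 < c → w = c * z → G z = G w → c = 1 := by
    intro z w hz c hc hw hzw
    rcases lt_trichotomy c 1 with h | h | h
    · exact absurd hzw (hw ▸ (hs z hz c hc h).ne')
    · exact h
    · have hw0 : w ≠ 0 := by rw [hw]; exact mul_ne_zero (by exact_mod_cast hc.ne') hz
      have : z = ((c⁻¹ : ℝ) : ℂ) * w := by
        rw [hw, ← mul_assoc, ← Complex.ofReal_mul, inv_mul_cancel₀ hc.ne']; simp
      have h2 := hs w hw0 c⁻¹ (inv_pos.2 hc) (inv_lt_one_of_one_lt₀ h)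
      rw [← this, hzw] at h2
      exact absurd h2 (lt_irrefl _)
  have hbij : Function.Bijective fun z => ((G z / ‖z‖ : ℝ) : ℂ) * z := by
    constructor
    · intro z w h
      simp only at h
      have hGzw : G z = G w := by rw [← hnorm z, ← hnorm w, h]
      by_cases hz : z = 0
      · by_contra hw
        have := hpos w fun h' => hw (hz.trans h'.symm)
        rw [← hGzw, hz, h0] at this
        exact lt_irrefl _ this
      have hw : w ≠ 0 := fun hw => by
        have := hpos z hz
        rw [hGzw, hw, h0] at this
        exact lt_irrefl _ this
      have a := div_pos (hpos z hz) (norm_pos_iff.2 hz)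
      have b := div_pos (hpos w hw) (norm_pos_iff.2 hw)
      have hb : ((G w / ‖w‖ : ℝ) : ℂ) ≠ 0 := by exact_mod_cast b.ne'
      have hwz : w = (((G z / ‖z‖) / (G w / ‖w‖) : ℝ) : ℂ) * z := by
        rw [Complex.ofReal_div, div_mul_eq_mul_div, eq_div_iff hb, h]
        ring
      have := hlt z w hz _ (div_pos a b) hwz hGzw
      rw [this] at hwz
      simpa using hwz.symm
    · intro w
      by_cases hw : w = 0
      · exact ⟨0, by simp [hw]⟩
      have hw' := norm_pos_iff.2 hw
      set u : ℂ := w / ‖w‖ with hu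
      have hun : ‖u‖ = 1 := by simp [hu, hw]
      have hc : Continuous fun s : ℝ => G (s * u) := by fun_prop
      have hb : ‖w‖ ≤ G (((‖w‖ / δ : ℝ) : ℂ) * u) := by
        refine le_trans ?_ (hδ _)
        rw [norm_mul, hun, mul_one, Complex.norm_of_nonneg (by positivity)]
        rw [mul_div_cancel₀ _ hδ0.ne']
      obtain ⟨s, ⟨hs0, -⟩, hs⟩ := intermediate_value_Icc (by positivity : 0 ≤ ‖w‖ / δ)
        hc.continuousOn (show ‖w‖ ∈ Icc _ _ from ⟨by simp [h0], hb⟩)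
      simp only at hs
      have hs1 : 0 < s := by
        rcases hs0.lt_or_eq with h | h
        · exact h
        · rw [← h] at hs
          simp only [Complex.ofReal_zero, zero_mul, h0] at hs
          exact absurd hs.symm hw'.ne'
      refine ⟨s * u, ?_⟩
      have : ‖(s * u : ℂ)‖ = s := by rw [norm_mul, hun, Complex.norm_of_nonneg hs0, mul_one]
      simp only [this, hs]
      have h1 : (s : ℂ) ≠ 0 := by exact_mod_cast hs1.ne'
      have h2 : (‖w‖ : ℂ) ≠ 0 := by exact_mod_cast hw'.ne'
      rw [hu]
      push_cast
      field_simp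
  obtain ⟨F, hF, -⟩ := exists_homeomorph_family (T := Unit)
    (fun _ z => ((G z / ‖z‖ : ℝ) : ℂ) * z) (hcont.comp continuous_snd) (fun _ => hbij)
    (fun R => ⟨R / δ, fun _ z hz => by
      rw [hnorm] at hz
      rw [le_div_iff₀ hδ0, mul_comm]
      exact (hδ z).trans hz⟩)
  exact ⟨F (), fun z => hF () z⟩

/-- The gauge whose level sets are squares cut open along the real axis and moved apart by `2η`. -/
noncomputable def gauge (η : ℝ) (z : ℂ) : ℝ := |z.re| + max (|z.im| - η) 0

/-- A modification of `gauge` near `0` which is positive outside `0`. -/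
noncomputable def fullGauge (η : ℝ) (z : ℂ) : ℝ := max (gauge η z) (‖z‖ / (1 + 8 * η))

section

variable {η : ℝ}

theorem continuous_gauge : Continuous (gauge η) := by unfold gauge; fun_prop

theorem gauge_neg (z : ℂ) : gauge η (-z) = gauge η z := by simp [gauge]

theorem abs_re_le_gauge (z : ℂ) : |z.re| ≤ gauge η z :=
  le_add_of_nonneg_right (le_max_right _ _)

theorem gauge_of_abs_im_le {z : ℂ} (h : |z.im| ≤ η) : gauge η z = |z.re| := by
  rw [gauge, max_eq_right (by linarith), add_zero]

theorem gauge_of_le_abs_im {z : ℂ} (h : η ≤ |z.im|) : gauge η z = |z.re| + |z.im| - η := by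
  rw [gauge, max_eq_left (by linarith)]; ring

theorem norm_le_gauge_add (z : ℂ) : ‖z‖ ≤ gauge η z + η := by
  have := Complex.norm_le_abs_re_add_abs_im z
  have h2 := le_max_left (|z.im| - η) 0
  rw [gauge]
  linarith

theorem gauge_le_norm_one (hη : 0 ≤ η) (z : ℂ) : gauge η z ≤ |z.re| + |z.im| := by
  rw [gauge]
  have : max (|z.im| - η) 0 ≤ |z.im| := max_le (by linarith) (abs_nonneg _)
  linarith

theorem gauge_le_fullGauge (z : ℂ) : gauge η z ≤ fullGauge η z := le_max_left _ _

/-- The norm is at most `gauge + η`, and r + η ≤ r(1 + 8η) when r ≥ 1/8. This is why the correction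
is divided by 1 + 8η: it is invisible from level 1/8 on. -/
theorem fullGauge_le (hη : 0 < η) {z : ℂ} {r : ℝ} (hr : 1 / 8 ≤ r) (h : gauge η z ≤ r) :
    fullGauge η z ≤ r := by
  refine max_le h ?_
  have := norm_le_gauge_add (η := η) z
  rw [div_le_iff₀ (by linarith)]
  nlinarith

theorem fullGauge_eq (hη : 0 < η) {z : ℂ} (h : 1 / 8 ≤ gauge η z) :
    fullGauge η z = gauge η z :=
  le_antisymm (fullGauge_le hη h le_rfl) (gauge_le_fullGauge z)

theorem gauge_eq_of_fullGauge_eq (hη : 0 < η) {z : ℂ} {r : ℝ} (hr : 1 / 8 ≤ r)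
    (h : fullGauge η z = r) : gauge η z = r := by
  by_contra hne
  have h1 : gauge η z < r := lt_of_le_of_ne (h ▸ gauge_le_fullGauge z) hne
  have h2 : ‖z‖ / (1 + 8 * η) = r := by
    rw [fullGauge] at h
    rcases max_choice (gauge η z) (‖z‖ / (1 + 8 * η)) with h3 | h3
    · exact absurd (h3.symm.trans h) hne
    · exact h3.symm.trans h
  rw [div_eq_iff (by linarith)] at h2
  have := norm_le_gauge_add (η := η) z
  nlinarith

theorem fullGauge_neg (z : ℂ) : fullGauge η (-z) = fullGauge η z := by
  simp [fullGauge, gauge_neg]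

theorem exists_gaugeHomeomorph (hη : 0 < η) :
    ∃ Γ : ℂ ≃ₜ ℂ, ∀ z, Γ z = ((fullGauge η z / ‖z‖ : ℝ) : ℂ) * z := by
  refine exists_radial_homeomorph _ ?_ (δ := 1 / (1 + 8 * η)) (by positivity) ?_ ?_ ?_
  · exact continuous_gauge.max (by fun_prop)
  · intro z
    rw [one_div_mul_eq_div]
    exact le_max_right _ _
  · simp [fullGauge, gauge, hη.le]
  · intro z hz c hc hc1
    have h1 : fullGauge η (c * z) ≤ c * fullGauge η z := by
      rw [fullGauge, fullGauge, mul_max_of_nonneg _ _ hc.le]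
      refine max_le_max ?_ (le_of_eq ?_)
      · simp only [gauge, Complex.re_ofReal_mul, Complex.im_ofReal_mul, abs_mul, abs_of_pos hc,
          mul_add]
        refine add_le_add le_rfl ?_
        rw [mul_max_of_nonneg _ _ hc.le, mul_zero]
        exact max_le_max (by nlinarith) le_rfl
      · rw [norm_mul, Complex.norm_of_nonneg hc.le, mul_div_assoc]
    have h2 : 0 < fullGauge η z :=
      lt_max_of_lt_right (div_pos (norm_pos_iff.2 hz) (by positivity))
    nlinarith

/-- The homeomorphism of the plane which preserves the rays from `0` and takes the level sets of
`fullGauge` to circles. -/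
noncomputable def gaugeHomeomorph (hη : 0 < η) : ℂ ≃ₜ ℂ :=
  Classical.choose (exists_gaugeHomeomorph hη)

variable (hη : 0 < η)

theorem gaugeHomeomorph_apply (z : ℂ) :
    gaugeHomeomorph hη z = ((fullGauge η z / ‖z‖ : ℝ) : ℂ) * z :=
  Classical.choose_spec (exists_gaugeHomeomorph hη) z

theorem fullGauge_pos (hη : 0 < η) {z : ℂ} (hz : z ≠ 0) : 0 < fullGauge η z :=
  lt_max_of_lt_right (div_pos (norm_pos_iff.2 hz) (by positivity))

theorem norm_gaugeHomeomorph (z : ℂ) : ‖gaugeHomeomorph hη z‖ = fullGauge η z := by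
  by_cases hz : z = 0
  · simp [hz, gaugeHomeomorph_apply, fullGauge, gauge, hη.le]
  · rw [gaugeHomeomorph_apply, norm_mul, Complex.norm_of_nonneg
      (div_nonneg (fullGauge_pos hη hz).le (norm_nonneg _)),
      div_mul_cancel₀ _ (norm_ne_zero_iff.2 hz)]

theorem arg_gaugeHomeomorph {z : ℂ} (hz : z ≠ 0) : arg (gaugeHomeomorph hη z) = arg z := by
  rw [gaugeHomeomorph_apply]
  exact Complex.arg_real_mul _ (div_pos (fullGauge_pos hη hz) (norm_pos_iff.2 hz))

theorem gaugeHomeomorph_neg (z : ℂ) : gaugeHomeomorph hη (-z) = -gaugeHomeomorph hη z := by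
  rw [gaugeHomeomorph_apply, gaugeHomeomorph_apply, fullGauge_neg, norm_neg, mul_neg]

/-- The points on a given ray are determined by their gauge. -/
theorem gaugeHomeomorph_eq {z : ℂ} {r θ : ℝ}
    (hr : fullGauge η z = r) (hz : z ≠ 0) (ha : arg z = θ) :
    gaugeHomeomorph hη z = r * exp (θ * I) := by
  rw [← norm_mul_exp_arg_mul_I (gaugeHomeomorph hη z), norm_gaugeHomeomorph,
    arg_gaugeHomeomorph hη hz, hr, ha]

end

/-! ### The drag map -/

/-- The truncation of a real number to `[0, 1]`. -/
noncomputable def clamp (x : ℝ) : ℝ := max 0 (min x 1)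

theorem continuous_clamp : Continuous clamp := by unfold clamp; fun_prop

theorem clamp_nonneg (x : ℝ) : 0 ≤ clamp x := le_max_left _ _

theorem clamp_le_one (x : ℝ) : clamp x ≤ 1 := max_le zero_le_one (min_le_right _ _)

theorem clamp_mono : Monotone clamp := fun _ _ h => max_le_max le_rfl (min_le_min h le_rfl)

theorem clamp_of_nonpos {x : ℝ} (h : x ≤ 0) : clamp x = 0 :=
  max_eq_left ((min_le_left _ _).trans h)

theorem clamp_of_one_le {x : ℝ} (h : 1 ≤ x) : clamp x = 1 := by
  rw [clamp, min_eq_right h, max_eq_right zero_le_one]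

theorem clamp_of_mem {x : ℝ} (h0 : 0 ≤ x) (h1 : x ≤ 1) : clamp x = x := by
  rw [clamp, min_eq_left h1, max_eq_right h0]

/-- The angle of the end of the vertical segment of half-length `η` at distance `r`. -/
noncomputable def wallAngle (η r : ℝ) : ℝ := Real.arctan (η / r)

/-- An angle increasing from `0` to `π` between the ends of a vertical segment. -/
noncomputable def rampAngle (η r θ : ℝ) : ℝ :=
  Real.pi * clamp ((θ + wallAngle η r) / (2 * wallAngle η r))

/-- The angle of rotation of the drag map, a half-turn near `0`. -/
noncomputable def dragAngle (η : ℝ) (n : ℕ) (w : ℂ) : ℝ :=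
  -- The cutoff passes from 0 to 1 between the radii (n-1)/2 + 1/4 and n/2. The slope 4/5 and the
  -- phase -π/4 make the descending branch equal to π at angle π/2 and to 0 at 7π/4, leaving the
  -- sector from -π/4 to the wall fixed.
  (1 - clamp (4 * ‖w‖ - 2 * n + 1)) * Real.pi +
    clamp (4 * ‖w‖ - 2 * n + 1) * sawtooth (4 / 5) (-(Real.pi / 4)) (rampAngle η) w

section

variable {η : ℝ} (hη : 0 < η) {n : ℕ}
include hη

theorem wallAngle_pos {r : ℝ} (hr : 0 < r) : 0 < wallAngle η r :=
  Real.arctan_pos.2 (div_pos hη hr)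

omit hη in
theorem wallAngle_lt (r : ℝ) : wallAngle η r < Real.pi / 2 := Real.arctan_lt_pi_div_two _

omit hη in
theorem wallAngle_le {r : ℝ} (hr : 0 < r) (h : η ≤ r) : wallAngle η r ≤ Real.pi / 4 := by
  rw [← Real.arctan_one]
  exact Real.arctan_mono ((div_le_one hr).2 h)

theorem rampAngle_of_ge {r θ : ℝ} (hr : 0 < r) (h : wallAngle η r ≤ θ) :
    rampAngle η r θ = Real.pi := by
  have := wallAngle_pos hη hr
  rw [rampAngle, clamp_of_one_le, mul_one]
  rw [one_le_div (by linarith)]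
  linarith

theorem rampAngle_of_le {r θ : ℝ} (hr : 0 < r) (h : θ ≤ -wallAngle η r) :
    rampAngle η r θ = 0 := by
  have := wallAngle_pos hη hr
  rw [rampAngle, clamp_of_nonpos, mul_zero]
  exact div_nonpos_of_nonpos_of_nonneg (by linarith) (by linarith)

theorem rampAngle_monotone {r : ℝ} (hr : 0 < r) : Monotone (rampAngle η r) := by
  have := wallAngle_pos hη hr
  intro θ θ' h
  refine mul_le_mul_of_nonneg_left (clamp_mono ?_) Real.pi_pos.le
  gcongr

theorem continuousOn_rampAngle :
    ContinuousOn (fun q : ℝ × ℝ => rampAngle η q.1 q.2) (Ioi 0 ×ˢ univ) := by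
  have h1 : ContinuousOn (fun q : ℝ × ℝ => wallAngle η q.1) (Ioi 0 ×ˢ univ) :=
    Real.continuous_arctan.comp_continuousOn
      (continuousOn_const.div continuousOn_fst fun q hq => (mem_prod.1 hq).1.ne')
  refine continuousOn_const.mul (continuous_clamp.comp_continuousOn
    ((continuousOn_snd.add h1).div (continuousOn_const.mul h1) fun q hq => ?_))
  have := wallAngle_pos hη (mem_prod.1 hq).1
  positivity

theorem rampAngle_ge (r θ : ℝ) (hr : 0 < r) (h : Real.pi / 2 ≤ θ) (_ : θ ≤ Real.pi) :
    4 / 5 * (-(Real.pi / 4) + 2 * Real.pi - θ) ≤ rampAngle η r θ := by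
  rw [rampAngle_of_ge hη hr ((wallAngle_lt r).le.trans h)]
  linarith

theorem rampAngle_le (r θ : ℝ) (hr : 0 < r) (_ : -Real.pi ≤ θ) (h : θ ≤ -(Real.pi / 2)) :
    rampAngle η r θ ≤ 4 / 5 * (-(Real.pi / 4) - θ) := by
  have := wallAngle_lt (η := η) r
  have := Real.pi_pos
  rw [rampAngle_of_le hη hr (by linarith)]
  linarith

/-- The cutoff depends on the radius only, so on each circle the rotated angle is a convex
combination of two strictly increasing functions. -/
theorem exists_drag_twist (n : ℕ) : ∃ F : unitInterval → ℂ ≃ₜ ℂ, IsIsotopy F ∧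
    ∀ (t : unitInterval) z, F t z = z * exp (((t : ℝ) * dragAngle η n z : ℝ) * I) := by
  have hk : (0 : ℝ) ≤ 4 / 5 := by norm_num
  have hcl : Continuous fun w : ℂ => clamp (4 * ‖w‖ - 2 * n + 1) :=
    continuous_clamp.comp (by fun_prop)
  refine exists_twist_isotopy (dragAngle η n) ?_ fun r hr => ?_
  · exact ((continuous_const.sub hcl).mul continuous_const).continuousOn.add
      (hcl.continuousOn.mul (continuousOn_sawtooth (continuousOn_rampAngle hη)
        (rampAngle_ge hη) (rampAngle_le hη) hk))
  · have h := strictMonoOn_sawtooth (rampAngle_ge hη) (rampAngle_le hη)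
      (fun r hr => rampAngle_monotone hη hr) hk (by norm_num) hr
    intro θ hθ θ' hθ' hlt
    have h1 := h hθ hθ' hlt
    have hn : ∀ θ : ℝ, ‖(r * exp (θ * I) : ℂ)‖ = r := fun θ => by
      rw [norm_mul, norm_exp_ofReal_mul_I, mul_one, Complex.norm_of_nonneg hr.le]
    simp only [dragAngle, hn] at h1 ⊢
    have e0 := clamp_nonneg (4 * r - 2 * n + 1)
    have e1 := clamp_le_one (4 * r - 2 * n + 1)
    set l := clamp (4 * r - 2 * n + 1)
    rcases e0.eq_or_lt with h0 | h0
    · rw [← h0]; linarith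
    · have := mul_lt_mul_of_pos_left h1 h0
      have := mul_le_mul_of_nonneg_left hlt.le (sub_nonneg.2 e1)
      linarith

end

theorem arg_eq_arctan {z : ℂ} (h : 0 < z.re) : arg z = Real.arctan (z.im / z.re) := by
  have h1 := abs_lt.1 (Complex.abs_arg_lt_pi_div_two_iff.2 (Or.inl h))
  rw [← Complex.tan_arg, Real.arctan_tan h1.1 h1.2]

section

variable {η : ℝ} (hη : 0 < η)
include hη

theorem polar_of_gaugeHomeomorph {z : ℂ} {r θ : ℝ} (hr : 0 < r)
    (h : gaugeHomeomorph hη z = r * exp (θ * I)) :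
    fullGauge η z = r ∧ ∃ c : ℝ, 0 < c ∧ c * z.re = r * Real.cos θ ∧ c * z.im = r * Real.sin θ := by
  have hG : fullGauge η z = r := by
    rw [← norm_gaugeHomeomorph hη, h, norm_mul, norm_exp_ofReal_mul_I, mul_one,
      Complex.norm_of_nonneg hr.le]
  have hz : z ≠ 0 := by
    rintro rfl
    simp [fullGauge, gauge, hη.le] at hG
    exact hr.ne hG
  refine ⟨hG, fullGauge η z / ‖z‖, div_pos (fullGauge_pos hη hz) (norm_pos_iff.2 hz), ?_, ?_⟩
  · have := congrArg Complex.re h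
    rwa [gaugeHomeomorph_apply, Complex.re_ofReal_mul, Complex.re_ofReal_mul,
      Complex.exp_ofReal_mul_I_re] at this
  · have := congrArg Complex.im h
    rwa [gaugeHomeomorph_apply, Complex.im_ofReal_mul, Complex.im_ofReal_mul,
      Complex.exp_ofReal_mul_I_im] at this

/-- Within the wall angle, |im| ≤ re · η/r with re ≤ r; hence |im| ≤ η, where the gauge reduces to
|re|. -/
theorem wall_of_gaugeHomeomorph {z : ℂ} {r θ : ℝ} (hr : 1 / 8 ≤ r)
    (h : gaugeHomeomorph hη z = r * exp (θ * I)) (hθ : |θ| ≤ wallAngle η r) :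
    z.re = r ∧ |z.im| ≤ η := by
  have hr0 : 0 < r := by linarith
  obtain ⟨hG, c, hc, hre, him⟩ := polar_of_gaugeHomeomorph hη hr0 h
  have hg := gauge_eq_of_fullGauge_eq hη hr hG
  have hw := wallAngle_lt (η := η) r
  obtain ⟨h1, h2⟩ := abs_le.1 hθ
  have hcos : 0 < Real.cos θ := Real.cos_pos_of_mem_Ioo ⟨by linarith, by linarith⟩
  have hre0 : 0 < z.re := by
    have : 0 < c * z.re := by rw [hre]; positivity
    exact pos_of_mul_pos_right this hc.le
  have hrer : z.re ≤ r := (le_abs_self _).trans ((abs_re_le_gauge z).trans hg.le)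
  have htan : z.im = z.re * Real.tan θ := by
    rw [Real.tan_eq_sin_div_cos, ← mul_div_assoc, eq_div_iff hcos.ne']
    have : c * (z.im * Real.cos θ) = c * (z.re * Real.sin θ) := by
      rw [← mul_assoc, ← mul_assoc, him, hre]; ring
    exact mul_left_cancel₀ hc.ne' this
  have ht : |Real.tan θ| ≤ η / r := by
    have e : Real.tan (wallAngle η r) = η / r := Real.tan_arctan _
    have m := Real.strictMonoOn_tan.monotoneOn
    rw [abs_le, ← e, ← Real.tan_neg]
    exact ⟨m ⟨by linarith, by linarith⟩ ⟨by linarith, by linarith⟩ h1,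
      m ⟨by linarith, by linarith⟩ ⟨by linarith, by linarith⟩ h2⟩
  have him' : |z.im| ≤ η := by
    rw [htan, abs_mul, abs_of_pos hre0]
    calc z.re * |Real.tan θ| ≤ r * (η / r) := mul_le_mul hrer ht (abs_nonneg _) hr0.le
      _ = η := mul_div_cancel₀ _ hr0.ne'
  rw [gauge_of_abs_im_le him', abs_of_pos hre0] at hg
  exact ⟨hg, him'⟩

theorem gaugeHomeomorph_wall {z : ℂ} {r : ℝ} (hr : 1 / 8 ≤ r) (hz : z.re = r)
    (him : |z.im| ≤ η) : gaugeHomeomorph hη z = r * exp ((Real.arctan (z.im / r) : ℝ) * I) := by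
  have hr0 : 0 < r := by linarith
  have hg : gauge η z = r := by rw [gauge_of_abs_im_le him, hz, abs_of_pos hr0]
  refine gaugeHomeomorph_eq hη ?_ (fun h => ?_) ?_
  · rw [fullGauge_eq hη (hg ▸ hr), hg]
  · rw [h] at hz
    exact hr0.ne hz
  · rw [arg_eq_arctan (hz ▸ hr0), hz]

omit hη in
theorem abs_arctan_le_wallAngle {y r : ℝ} (hr : 0 < r) (h : |y| ≤ η) :
    |Real.arctan (y / r)| ≤ wallAngle η r := by
  obtain ⟨h1, h2⟩ := abs_le.1 h
  rw [abs_le, wallAngle, ← Real.arctan_neg, ← neg_div]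
  exact ⟨Real.arctan_mono (by gcongr), Real.arctan_mono (by gcongr)⟩

theorem dragAngle_wall {n : ℕ} {r θ : ℝ} (hr : 1 / 8 ≤ r) (hη' : η ≤ 1 / 8) (hn : (n : ℝ) / 2 ≤ r)
    (hθ : |θ| ≤ wallAngle η r) :
    dragAngle η n (r * exp (θ * I)) =
      Real.pi * ((θ + wallAngle η r) / (2 * wallAngle η r)) := by
  have hr0 : 0 < r := by linarith
  have hpi := Real.pi_pos
  have hn' : ‖(r * exp (θ * I) : ℂ)‖ = r := by
    rw [norm_mul, norm_exp_ofReal_mul_I, mul_one, Complex.norm_of_nonneg hr0.le]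
  have hw := wallAngle_le (η := η) hr0 (hη'.trans hr)
  have hw0 := wallAngle_pos hη hr0
  obtain ⟨h1, h2⟩ := abs_le.1 hθ
  have e0 : 0 ≤ (θ + wallAngle η r) / (2 * wallAngle η r) :=
    div_nonneg (by linarith) (by linarith)
  have e1 : (θ + wallAngle η r) / (2 * wallAngle η r) ≤ 1 :=
    (div_le_one (by linarith)).2 (by linarith)
  rw [dragAngle, hn', clamp_of_one_le (by linarith),
    sawtooth_polar (rampAngle_ge hη) (rampAngle_le hη) (by norm_num) hr0
      ⟨by linarith, by linarith⟩, rampAngle, clamp_of_mem e0 e1, min_eq_left, max_eq_right]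
  · ring
  · have := mul_nonneg hpi.le e0
    linarith
  · have := mul_le_mul_of_nonneg_left e1 hpi.le
    linarith

theorem dragAngle_of_gauge_le {n : ℕ} (hn : 1 ≤ n) {z : ℂ} (h : gauge η z ≤ ((n : ℝ) - 1) / 2) :
    dragAngle η n (gaugeHomeomorph hη z) = Real.pi := by
  have hn' : (1 : ℝ) ≤ n := by exact_mod_cast hn
  have : fullGauge η z ≤ ((n : ℝ) - 1) / 2 + 1 / 4 :=
    fullGauge_le hη (by linarith) (by linarith)
  rw [dragAngle, norm_gaugeHomeomorph, clamp_of_nonpos (by linarith)]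
  ring

/-- Above the wall the ramp has already reached π, and the descending branch is still at least π up
to angle π/2. Both terms of the interpolation are then π, whatever the radius. -/
theorem dragAngle_of_upper {n : ℕ} {z : ℂ} (h : 0 < z.re) (him : η ≤ z.im) :
    dragAngle η n (gaugeHomeomorph hη z) = Real.pi := by
  have hpi := Real.pi_pos
  have hz : z ≠ 0 := fun h0 => by simp [h0] at h
  have hG := fullGauge_pos hη hz
  have hre : z.re ≤ fullGauge η z :=
    (le_abs_self _).trans ((abs_re_le_gauge z).trans (gauge_le_fullGauge z))
  have e1 : wallAngle η (fullGauge η z) ≤ arg z := by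
    rw [arg_eq_arctan h]
    exact Real.arctan_mono (div_le_div₀ (by linarith) him h hre)
  have e2 := (abs_lt.1 (Complex.abs_arg_lt_pi_div_two_iff.2 (Or.inl h))).2
  have e3 := wallAngle_pos hη hG
  have : sawtooth (4 / 5) (-(Real.pi / 4)) (rampAngle η) (gaugeHomeomorph hη z) = Real.pi := by
    rw [sawtooth, norm_gaugeHomeomorph, arg_gaugeHomeomorph hη hz, rampAngle_of_ge hη hG e1,
      min_eq_left (by linarith), max_eq_right (by linarith)]
  rw [dragAngle, this]
  ring

/-- Below the wall the ramp is 0, and `-z.im ≤ z.re` keeps the argument above -π/4, where the other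
branch is not yet positive. -/
theorem dragAngle_of_lower {n : ℕ} {z : ℂ} (h : 0 < z.re) (him : z.im ≤ -η) (hz' : -z.im ≤ z.re)
    (hn : (n : ℝ) / 2 ≤ gauge η z) : dragAngle η n (gaugeHomeomorph hη z) = 0 := by
  have hpi := Real.pi_pos
  have hz : z ≠ 0 := fun h0 => by simp [h0] at h
  have hG := fullGauge_pos hη hz
  have hre : z.re ≤ fullGauge η z :=
    (le_abs_self _).trans ((abs_re_le_gauge z).trans (gauge_le_fullGauge z))
  have e1 : arg z ≤ -wallAngle η (fullGauge η z) := by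
    rw [arg_eq_arctan h, wallAngle, ← Real.arctan_neg]
    refine Real.arctan_mono ?_
    rw [le_neg, ← neg_div]
    exact div_le_div₀ (by linarith) (by linarith) h hre
  have e2 : -(Real.pi / 4) ≤ arg z := by
    rw [arg_eq_arctan h, ← Real.arctan_one, ← Real.arctan_neg]
    refine Real.arctan_mono ?_
    rw [le_div_iff₀ h]
    linarith
  have : sawtooth (4 / 5) (-(Real.pi / 4)) (rampAngle η) (gaugeHomeomorph hη z) = 0 := by
    have e3 := wallAngle_pos hη hG
    rw [sawtooth, norm_gaugeHomeomorph, arg_gaugeHomeomorph hη hz, rampAngle_of_le hη hG e1,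
      min_eq_left (by linarith), max_eq_right (by linarith)]
  have hG' := gauge_le_fullGauge (η := η) z
  rw [dragAngle, this, norm_gaugeHomeomorph, clamp_of_one_le (by linarith)]
  ring

/-- The half-twist of the disc `gauge η z ≤ (n - 1) / 2` around `0`, which drags along the points
of the upper half-plane and leaves fixed the lower right quarter of the plane outside the disc. -/
theorem exists_drag (hη' : η ≤ 1 / 8) {n : ℕ} (hn : 1 ≤ n) :
    ∃ F : unitInterval → ℂ ≃ₜ ℂ, IsIsotopy F ∧
      (∀ z, (gauge η z ≤ ((n : ℝ) - 1) / 2 ∨ 0 < z.re ∧ η ≤ z.im) → F 1 z = -z) ∧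
      (∀ z, 0 < z.re → z.im ≤ -η → -z.im ≤ z.re → (n : ℝ) / 2 ≤ gauge η z → ∀ t, F t z = z) ∧
      (∀ r : ℝ, (n : ℝ) / 2 ≤ r →
        F 1 '' {z | z.re = r ∧ |z.im| ≤ η} = {z | gauge η z = r ∧ -η ≤ z.im}) ∧
      (∀ t, ‖F t (-(η * I))‖ ≤ η) ∧
      (∀ r : ℝ, 1 / 2 ≤ r → ∀ t, gauge η (F t ⟨r, η⟩) = r ∧
        (0 ≤ (F t ⟨r, η⟩).im ∨ -η ≤ (F t ⟨r, η⟩).im ∧ (F t ⟨r, η⟩).re ≤ 0)) := by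
  have hpi := Real.pi_pos
  have hn' : (1 : ℝ) ≤ n := by exact_mod_cast hn
  obtain ⟨T, hT, hTz⟩ := exists_drag_twist hη n
  set Γ := gaugeHomeomorph hη with hΓ
  have hF : ∀ t z, Γ ((((Γ.symm.symm.trans (T t)).trans Γ.symm)) z) =
      Γ z * exp (((t : ℝ) * dragAngle η n (Γ z) : ℝ) * I) := by
    intro t z
    simp [hTz]
  refine ⟨_, hT.conj Γ.symm, ?_, ?_, ?_, ?_, ?_⟩
  · intro z hz
    apply Γ.injective
    rw [hF, hΓ, gaugeHomeomorph_neg, Set.Icc.coe_one, one_mul]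
    have : dragAngle η n (gaugeHomeomorph hη z) = Real.pi := by
      rcases hz with h | h
      · exact dragAngle_of_gauge_le hη hn h
      · exact dragAngle_of_upper hη h.1 h.2
    rw [this, Complex.exp_pi_mul_I]
    ring
  · intro z h1 h2 h3 h4 t
    apply Γ.injective
    rw [hF, hΓ, dragAngle_of_lower hη h1 h2 h3 h4]
    simp
  · intro r hr
    have hr8 : 1 / 8 ≤ r := by linarith
    have hr0 : 0 < r := by linarith
    have hw0 := wallAngle_pos hη hr0
    have hw := wallAngle_lt (η := η) r
    set ρ := wallAngle η r with hρ
    ext w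
    constructor
    · rintro ⟨z, ⟨hz1, hz2⟩, rfl⟩
      have hz := gaugeHomeomorph_wall hη hr8 hz1 hz2
      have hθ := abs_arctan_le_wallAngle hr0 hz2
      set θ := Real.arctan (z.im / r)
      have h1 := hF 1 z
      rw [hΓ, hz, dragAngle_wall hη hr8 hη' hr hθ, Set.Icc.coe_one, one_mul, mul_assoc,
        ← Complex.exp_add, ← add_mul, ← Complex.ofReal_add, ← hρ] at h1
      set w := ((Γ.symm.symm.trans (T 1)).trans Γ.symm) z
      obtain ⟨t1, t2⟩ := abs_le.1 hθ
      have e0 : 0 ≤ (θ + ρ) / (2 * ρ) := div_nonneg (by linarith) (by linarith)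
      have e1 : (θ + ρ) / (2 * ρ) ≤ 1 := (div_le_one (by linarith)).2 (by linarith)
      have e2 := mul_le_mul_of_nonneg_left e1 hpi.le
      have e3 := mul_nonneg hpi.le e0
      -- While θ runs over [-ρ, ρ], φ runs over [-ρ, π + ρ]. Negative φ and φ > π give short
      -- vertical pieces below the axis on the right and on the left; the rest lies above the axis.
      set φ := θ + Real.pi * ((θ + ρ) / (2 * ρ))
      obtain ⟨hG, c, hc, -, him⟩ := polar_of_gaugeHomeomorph hη hr0 h1
      refine ⟨gauge_eq_of_fullGauge_eq hη hr8 hG, ?_⟩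
      rcases le_total φ 0 with hφ | hφ
      · have := (wall_of_gaugeHomeomorph hη hr8 h1 (by
          rw [abs_le]; constructor <;> linarith)).2
        exact (abs_le.1 this).1
      rcases le_total φ Real.pi with hφ' | hφ'
      · have : 0 ≤ c * w.im := by
          rw [him]; exact mul_nonneg hr0.le (Real.sin_nonneg_of_nonneg_of_le_pi hφ hφ')
        have := nonneg_of_mul_nonneg_right this hc
        linarith
      · have h2 : gaugeHomeomorph hη (-w) = r * exp ((φ - Real.pi : ℝ) * I) := by
          rw [gaugeHomeomorph_neg, h1, Complex.ofReal_sub, sub_mul, Complex.exp_sub,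
            Complex.exp_pi_mul_I]
          ring
        have := (wall_of_gaugeHomeomorph hη hr8 h2 (by
          rw [abs_le]; constructor <;> linarith)).2
        have := (abs_le.1 this).2
        simp only [Complex.neg_im] at this
        linarith
    · rintro ⟨hw1, hw2⟩
      have hG : fullGauge η w = r := by rw [fullGauge_eq hη (hw1 ▸ hr8), hw1]
      have hw0' : w ≠ 0 := by
        rintro rfl
        simp [gauge, hη.le] at hw1
        exact hr0.ne hw1
      obtain ⟨φ, hφ1, hφ2, hφ⟩ : ∃ φ : ℝ, -ρ ≤ φ ∧ φ ≤ Real.pi + ρ ∧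
          gaugeHomeomorph hη w = r * exp (φ * I) := by
        rcases le_total 0 w.im with him | him
        · exact ⟨arg w, by linarith [Complex.arg_nonneg_iff.2 him], by linarith [arg_le_pi w],
            gaugeHomeomorph_eq hη hG hw0' rfl⟩
        · have hwi : |w.im| ≤ η := abs_le.2 ⟨hw2, by linarith⟩
          have hre : |w.re| = r := by rwa [gauge_of_abs_im_le hwi] at hw1
          rcases abs_choice w.re with h | h
          · have hb := abs_le.1 (abs_arctan_le_wallAngle hr0 hwi)
            exact ⟨_, hb.1, by linarith [hb.2], gaugeHomeomorph_wall hη hr8 (h ▸ hre) hwi⟩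
          · have hwi' : |(-w).im| ≤ η := by simpa using hwi
            have hb := abs_le.1 (abs_arctan_le_wallAngle hr0 hwi')
            refine ⟨Real.arctan ((-w).im / r) + Real.pi, by linarith [hb.1], by linarith [hb.2], ?_⟩
            have h3 := gaugeHomeomorph_wall hη hr8 (z := -w) (by
              rw [Complex.neg_re, ← h]; exact hre) hwi'
            rw [gaugeHomeomorph_neg] at h3
            rw [Complex.ofReal_add, add_mul, Complex.exp_add, Complex.exp_pi_mul_I]
            linear_combination -h3
      -- Inverse of the affine map from [-ρ, ρ] onto [-ρ, π + ρ].
      set θ := (φ - Real.pi / 2) * ((2 * ρ) / (Real.pi + 2 * ρ)) with hθdef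
      have hq0 : 0 < (2 * ρ) / (Real.pi + 2 * ρ) := by positivity
      have hq : (Real.pi / 2 + ρ) * ((2 * ρ) / (Real.pi + 2 * ρ)) = ρ := by
        field_simp
      have hθ : |θ| ≤ ρ := by
        rw [abs_le]
        constructor <;> nlinarith
      refine ⟨Γ.symm (r * exp (θ * I)), wall_of_gaugeHomeomorph hη hr8 (Γ.apply_symm_apply _) hθ, ?_⟩
      apply Γ.injective
      rw [hF, Homeomorph.apply_symm_apply, hΓ, hφ, dragAngle_wall hη hr8 hη' hr hθ,
        Set.Icc.coe_one, one_mul, mul_assoc, ← Complex.exp_add, ← add_mul,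
        ← Complex.ofReal_add, ← hρ]
      congr 4
      rw [hθdef]
      field_simp
      ring
  · intro t
    set w := ((Γ.symm.symm.trans (T t)).trans Γ.symm) (-(η * I))
    have h1 : fullGauge η w = fullGauge η (-(η * I)) := by
      rw [← norm_gaugeHomeomorph hη, ← norm_gaugeHomeomorph hη, ← hΓ, hF, norm_mul,
        norm_exp_ofReal_mul_I, mul_one]
    -- The gauge vanishes at this point, so only the correction by the norm counts; the rotation
    -- preserves it and keeps the orbit within distance η of 0.
    have h2 : fullGauge η (-(η * I)) = η / (1 + 8 * η) := by
      rw [fullGauge, max_eq_right] <;> simp [gauge, abs_of_pos hη]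
      positivity
    have h3 : ‖w‖ / (1 + 8 * η) ≤ η / (1 + 8 * η) := by
      rw [← h2, ← h1]; exact le_max_right _ _
    exact (div_le_div_iff_of_pos_right (by positivity)).1 h3
  · intro r hr t
    have hr8 : 1 / 8 ≤ r := by linarith
    have hr0 : 0 < r := by linarith
    have hz := gaugeHomeomorph_wall hη (z := ⟨r, η⟩) hr8 rfl (abs_of_pos hη).le
    have h1 := hF t ⟨r, η⟩
    -- The top of a wall turns by π at constant speed, through the upper arc and down to the bottom
    -- of the opposite wall.
    rw [hΓ, dragAngle_of_upper hη (z := ⟨r, η⟩) hr0 le_rfl, hz, mul_assoc, ← Complex.exp_add,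
      ← add_mul, ← Complex.ofReal_add] at h1
    have hw0 := wallAngle_pos hη hr0
    have hw := wallAngle_lt (η := η) r
    change gaugeHomeomorph hη _ = r * exp ((wallAngle η r + t * Real.pi : ℝ) * I) at h1
    set w := ((Γ.symm.symm.trans (T t)).trans Γ.symm) ⟨r, η⟩
    obtain ⟨hG, c, hc, hre, him⟩ := polar_of_gaugeHomeomorph hη hr0 h1
    refine ⟨gauge_eq_of_fullGauge_eq hη hr8 hG, ?_⟩
    have ht0 := mul_nonneg t.2.1 hpi.le
    have ht1 := mul_le_mul_of_nonneg_right t.2.2 hpi.le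
    rcases le_total (wallAngle η r + t * Real.pi) Real.pi with hφ | hφ
    · left
      have : 0 ≤ c * w.im := by
        rw [him]
        exact mul_nonneg hr0.le (Real.sin_nonneg_of_nonneg_of_le_pi (by linarith) hφ)
      exact nonneg_of_mul_nonneg_right this hc
    · right
      have h2 : gaugeHomeomorph hη (-w) =
          r * exp ((wallAngle η r + t * Real.pi - Real.pi : ℝ) * I) := by
        rw [gaugeHomeomorph_neg, h1, Complex.ofReal_sub, sub_mul, Complex.exp_sub,
          Complex.exp_pi_mul_I]
        ring
      obtain ⟨h3, h4⟩ := wall_of_gaugeHomeomorph hη hr8 h2 (by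
        rw [abs_le]; constructor <;> linarith)
      have h5 := (abs_le.1 h4).2
      simp only [Complex.neg_im, Complex.neg_re] at h3 h5
      exact ⟨by linarith, by linarith⟩

end

/-! ### Radii and crossings of the axis -/

/-- The radii of the half-circles of a block of a snail which meets the axis in `m` points. -/
def radii (m : ℕ) : Set ℝ := {r | ∃ i : ℕ, i ≤ (m - 1) / 2 ∧ r = circleRadius m i}

/-- A block of size m crosses the axis at m points with unit spacing, symmetric about its centre.
Radii start at 0 for odd m and at 1/2 for even m, hence the parity split. -/
theorem abs_mem_radii {m : ℕ} (hm : 1 ≤ m) {u : ℝ} :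
    |u| ∈ radii m ↔ ∃ k : ℕ, k < m ∧ u = k + 1 / 2 - (m : ℝ) / 2 := by
  obtain ⟨q, rfl | rfl⟩ := Nat.even_or_odd' m
  · have h2 : 2 * q / 2 = q := by omega
    have h3 : (2 * q - 1) / 2 = q - 1 := by omega
    simp only [radii, circleRadius, mem_ofPred_eq, h2, h3]
    push_cast
    constructor
    · rintro ⟨i, hi, h⟩
      rcases abs_choice u with hu | hu
      · exact ⟨q + i, by omega, by rw [hu] at h; rw [h]; push_cast; ring⟩
      · refine ⟨q - 1 - i, by omega, ?_⟩
        rw [Nat.cast_sub (by omega), Nat.cast_sub (by omega)]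
        rw [hu] at h
        push_cast
        linarith
    · rintro ⟨k, hk, rfl⟩
      rcases le_or_gt q k with h | h
      · refine ⟨k - q, by omega, ?_⟩
        have : (q : ℝ) ≤ k := by exact_mod_cast h
        rw [abs_of_nonneg (by linarith), Nat.cast_sub h]
        ring
      · refine ⟨q - 1 - k, by omega, ?_⟩
        have : (k : ℝ) + 1 ≤ q := by exact_mod_cast h
        rw [abs_of_nonpos (by linarith), Nat.cast_sub (by omega), Nat.cast_sub (by omega)]
        push_cast
        ring
  · have h2 : (2 * q + 1) / 2 = q := by omega
    have h3 : (2 * q + 1 - 1) / 2 = q := by omega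
    simp only [radii, circleRadius, mem_ofPred_eq, h2, h3]
    push_cast
    constructor
    · rintro ⟨i, hi, h⟩
      rcases abs_choice u with hu | hu
      · exact ⟨q + i, by omega, by rw [hu] at h; rw [h]; push_cast; ring⟩
      · refine ⟨q - i, by omega, ?_⟩
        rw [Nat.cast_sub (by omega)]
        rw [hu] at h
        linarith
    · rintro ⟨k, hk, rfl⟩
      rcases le_or_gt q k with h | h
      · refine ⟨k - q, by omega, ?_⟩
        have : (q : ℝ) ≤ k := by exact_mod_cast h
        rw [abs_of_nonneg (by linarith), Nat.cast_sub h]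
        ring
      · refine ⟨q - k, by omega, ?_⟩
        have : (k : ℝ) + 1 ≤ q := by exact_mod_cast h
        rw [abs_of_nonpos (by linarith), Nat.cast_sub (by omega)]
        ring

theorem nonneg_of_mem_radii {m : ℕ} {s : ℝ} (h : s ∈ radii m) : 0 ≤ s := by
  obtain ⟨i, -, rfl⟩ := h
  have : (m : ℝ) / 2 ≤ ((m / 2 : ℕ) : ℝ) + 1 / 2 := by
    have : m ≤ 2 * (m / 2) + 1 := by omega
    have : (m : ℝ) ≤ 2 * ((m / 2 : ℕ) : ℝ) + 1 := by exact_mod_cast this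
    linarith
  have : (0 : ℝ) ≤ i := Nat.cast_nonneg i
  rw [circleRadius]
  linarith

theorem mem_radii {m : ℕ} (hm : 1 ≤ m) {s : ℝ} :
    s ∈ radii m ↔ 0 ≤ s ∧ ∃ k : ℕ, k < m ∧ s = k + 1 / 2 - (m : ℝ) / 2 := by
  constructor
  · intro h
    have h0 := nonneg_of_mem_radii h
    rw [← abs_of_nonneg h0] at h
    exact ⟨h0, (abs_mem_radii hm).1 h⟩
  · rintro ⟨h0, h⟩
    rw [← abs_of_nonneg h0]
    exact (abs_mem_radii hm).2 h

theorem le_of_mem_radii {m : ℕ} (hm : 1 ≤ m) {s : ℝ} (h : s ∈ radii m) : s ≤ ((m : ℝ) - 1) / 2 := by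
  obtain ⟨-, k, hk, rfl⟩ := (mem_radii hm).1 h
  have : (k : ℝ) + 1 ≤ m := by exact_mod_cast hk
  linarith

theorem eq_zero_or_of_mem_radii {m : ℕ} (hm : 1 ≤ m) {s : ℝ} (h : s ∈ radii m) :
    s = 0 ∨ 1 / 2 ≤ s := by
  obtain ⟨h0, k, hk, rfl⟩ := (mem_radii hm).1 h
  rcases Nat.lt_or_ge (2 * k + 1) (m + 1) with h' | h'
  · left
    have : (2 : ℝ) * k + 1 ≤ m := by exact_mod_cast (by omega : 2 * k + 1 ≤ m)
    linarith
  · right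
    have : (m : ℝ) + 1 ≤ 2 * k + 1 := by exact_mod_cast h'
    linarith

/-- The larger block keeps the n inner crossings and gains p on each side: its new radii are those
of the arcs drawn by the p dragged walls. -/
theorem mem_radii_add {n p : ℕ} (hn : 1 ≤ n) {s : ℝ} :
    s ∈ radii (n + p + p) ↔ s ∈ radii n ∨ ∃ k : ℕ, k < p ∧ s = ((n : ℝ) + 1) / 2 + k := by
  rw [mem_radii (by omega), mem_radii hn]
  push_cast
  constructor
  · rintro ⟨h0, k, hk, rfl⟩
    rcases Nat.lt_or_ge k (n + p) with h | h
    · left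
      refine ⟨h0, k - p, ?_, ?_⟩
      · omega
      · have : p ≤ k := by
          by_contra h'
          have : (k : ℝ) + 1 ≤ p := by exact_mod_cast (by omega : k + 1 ≤ p)
          have : (1 : ℝ) ≤ n := by exact_mod_cast hn
          linarith
        rw [Nat.cast_sub this]
        ring
    · right
      refine ⟨k - (n + p), by omega, ?_⟩
      rw [Nat.cast_sub h]
      push_cast
      ring
  · rintro (⟨h0, k, hk, rfl⟩ | ⟨k, hk, rfl⟩)
    · exact ⟨h0, k + p, by omega, by push_cast; ring⟩
    · exact ⟨by positivity, n + p + k, by omega, by push_cast; ring⟩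

/-- The union of the curves of a snail, for half-circles measured by `γ`. -/
def snailSet (γ : ℂ → ℝ) (n p : ℕ) : Set ℂ :=
  {z | (z.im ≤ 0 ∧ γ (z - ((-(n : ℝ) / 2 : ℝ) : ℂ)) ∈ radii n) ∨
    (z.im ≤ 0 ∧ γ (z - (((p : ℝ) / 2 : ℝ) : ℂ)) ∈ radii p) ∨
    (0 ≤ z.im ∧ γ (z - ((((p : ℝ) - n) / 2 : ℝ) : ℂ)) ∈ radii (n + p))}

theorem snailCurve_eq (n p : ℕ) : snailCurve n p = snailSet norm n p := by
  ext z
  simp only [snailCurve, snailSet, lowerHalfCircle, upperHalfCircle, radii, mem_union,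
    mem_ofPred_eq, or_assoc]
  refine or_congr ?_ (or_congr ?_ ?_) <;> push_cast <;> tauto

/-- The crossings of the axis are the same from above and from below. -/
theorem radii_blocks {n p : ℕ} (hn : 1 ≤ n) (hp : 1 ≤ p) {x : ℝ} :
    |x - ((p : ℝ) - n) / 2| ∈ radii (n + p) ↔
      |x - -(n : ℝ) / 2| ∈ radii n ∨ |x - (p : ℝ) / 2| ∈ radii p := by
  rw [abs_mem_radii (by omega), abs_mem_radii hn, abs_mem_radii hp]
  push_cast
  constructor
  · rintro ⟨k, hk, h⟩
    rcases Nat.lt_or_ge k n with h' | h'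
    · exact Or.inl ⟨k, h', by linarith⟩
    · refine Or.inr ⟨k - n, by omega, ?_⟩
      rw [Nat.cast_sub h']
      linarith
  · rintro (⟨k, hk, h⟩ | ⟨k, hk, h⟩)
    · exact ⟨k, by omega, by linarith⟩
    · exact ⟨n + k, by omega, by push_cast; linarith⟩

section

variable {n p : ℕ} {γ : ℂ → ℝ}

/-- On the axis the upper and lower conditions coincide by `radii_blocks`, so a single one decides
membership in a closed half-plane. -/
theorem mem_snailSet_upper (hn : 1 ≤ n) (hp : 1 ≤ p) (hγ : ∀ z : ℂ, z.im = 0 → γ z = |z.re|)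
    {z : ℂ} (hz : 0 ≤ z.im) :
    z ∈ snailSet γ n p ↔ γ (z - ((((p : ℝ) - n) / 2 : ℝ) : ℂ)) ∈ radii (n + p) := by
  simp only [snailSet, mem_ofPred_eq, hz, true_and]
  rcases hz.lt_or_eq with h | h
  · simp [not_le.2 h]
  · have e : ∀ c : ℝ, γ (z - (c : ℂ)) = |z.re - c| := fun c => by
      rw [hγ _ (by simp [← h])]; simp
    rw [e, e, e, radii_blocks hn hp, ← h]
    simp only [le_refl, true_and]
    tauto

theorem mem_snailSet_lower (hn : 1 ≤ n) (hp : 1 ≤ p) (hγ : ∀ z : ℂ, z.im = 0 → γ z = |z.re|)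
    {z : ℂ} (hz : z.im ≤ 0) :
    z ∈ snailSet γ n p ↔ γ (z - ((-(n : ℝ) / 2 : ℝ) : ℂ)) ∈ radii n ∨
      γ (z - (((p : ℝ) / 2 : ℝ) : ℂ)) ∈ radii p := by
  simp only [snailSet, mem_ofPred_eq, hz, true_and]
  rcases hz.lt_or_eq with h | h
  · simp [not_le.2 h]
  · have e : ∀ c : ℝ, γ (z - (c : ℂ)) = |z.re - c| := fun c => by
      rw [hγ _ (by simp [h])]; simp
    rw [e, e, e, radii_blocks hn hp, h]
    simp only [le_refl, true_and]
    tauto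

end

theorem norm_of_im_eq_zero (z : ℂ) (h : z.im = 0) : ‖z‖ = |z.re| := by
  rw [show z = (z.re : ℂ) from Complex.ext rfl (by simp [h])]; simp

theorem gauge_of_im_eq_zero {η : ℝ} (hη : 0 ≤ η) (z : ℂ) (h : z.im = 0) : gauge η z = |z.re| :=
  gauge_of_abs_im_le (by simpa [h])

/-! ### From the round snail to the fat snail -/

/-- The vertical displacement which takes circles to squares. -/
noncomputable def squaring (u y : ℝ) : ℝ := √(u ^ 2 + y ^ 2) - u

theorem squaring_zero {u : ℝ} (hu : 0 ≤ u) : squaring u 0 = 0 := by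
  simp [squaring, Real.sqrt_sq hu]

theorem squaring_lt {u y y' : ℝ} (hy : 0 ≤ y) (h : y < y') : squaring u y < squaring u y' := by
  have : √(u ^ 2 + y ^ 2) < √(u ^ 2 + y' ^ 2) := Real.sqrt_lt_sqrt (by positivity) (by nlinarith)
  simp only [squaring]
  linarith

theorem squaring_mono {u y y' : ℝ} (hy : 0 ≤ y) (h : y ≤ y') : squaring u y ≤ squaring u y' := by
  rcases h.lt_or_eq with h | rfl
  · exact (squaring_lt hy h).le
  · exact le_rfl

theorem squaring_bounds {u y : ℝ} (hu : 0 ≤ u) (hy : 0 ≤ y) :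
    y - u ≤ squaring u y ∧ squaring u y ≤ y := by
  have h1 : y ≤ √(u ^ 2 + y ^ 2) := Real.le_sqrt_of_sq_le (by nlinarith)
  have h2 : √(u ^ 2 + y ^ 2) ≤ u + y := Real.sqrt_le_iff.2 ⟨by linarith, by nlinarith⟩
  simp only [squaring]
  constructor <;> linarith

/-- At horizontal distance u from a centre, height y is replaced by √(u² + y²) - u, so that the ℓ¹
distance to the centre becomes the old Euclidean one. Below the axis u has to interpolate between
the distances to two centres. -/
theorem exists_squaring {n p : ℕ} (hn : 1 ≤ n) (hp : 1 ≤ p) :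
    ∃ F : unitInterval → ℂ ≃ₜ ℂ, IsIsotopy F ∧ (∀ t (x : ℝ), F t x = x) ∧
      ∀ z, F 1 z ∈ snailSet (gauge 0) n p ↔ z ∈ snailSet norm n p := by
  have hn' : (1 : ℝ) ≤ n := by exact_mod_cast hn
  have hp' : (1 : ℝ) ≤ p := by exact_mod_cast hp
  set v : ℝ → ℝ := fun x => |x - ((p : ℝ) - n) / 2| with hv
  set u : ℝ → ℝ := fun x =>
    (1 - clamp (x + 1 / 2)) * |x - -(n : ℝ) / 2| + clamp (x + 1 / 2) * |x - (p : ℝ) / 2| with hu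
  have hv0 : ∀ x, 0 ≤ v x := fun x => abs_nonneg _
  have hu0 : ∀ x, 0 ≤ u x := fun x =>
    add_nonneg (mul_nonneg (sub_nonneg.2 (clamp_le_one _)) (abs_nonneg _))
      (mul_nonneg (clamp_nonneg _) (abs_nonneg _))
  have hvc : Continuous v := by fun_prop
  have huc : Continuous u := by
    have : Continuous fun x : ℝ => clamp (x + 1 / 2) := continuous_clamp.comp (by fun_prop)
    fun_prop
  set k : ℝ → ℝ → ℝ := fun x y => squaring (v x) (max y 0) - squaring (u x) (max (-y) 0) with hk
  have hkpos : ∀ x y, 0 ≤ y → k x y = squaring (v x) y := fun x y hy => by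
    simp only [hk, max_eq_left hy, max_eq_right (neg_nonpos.2 hy), squaring_zero (hu0 x), sub_zero]
  have hkneg : ∀ x y, y ≤ 0 → k x y = -squaring (u x) (-y) := fun x y hy => by
    simp only [hk, max_eq_right hy, max_eq_left (neg_nonneg.2 hy), squaring_zero (hv0 x), zero_sub]
  obtain ⟨F, hF, hFz⟩ := exists_vertical_isotopy k
    (by
      simp only [hk, squaring]
      fun_prop)
    (fun x y y' h => by
      rcases le_or_gt y' 0 with h' | h'
      · rw [hkneg x y (by linarith), hkneg x y' h']
        exact neg_lt_neg (squaring_lt (by linarith) (by linarith))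
      · rcases le_or_gt 0 y with h'' | h''
        · rw [hkpos x y h'', hkpos x y' h'.le]
          exact squaring_lt h'' h
        · rw [hkpos x y' h'.le, hkneg x y h''.le]
          have a := squaring_lt (u := v x) le_rfl h'
          have b := squaring_lt (u := u x) le_rfl (neg_pos.2 h'')
          rw [squaring_zero (hv0 x)] at a
          rw [squaring_zero (hu0 x)] at b
          linarith)
    (fun x => v x + u x) (by fun_prop)
    (fun x y => by
      have a := hv0 x
      have b := hu0 x
      rcases le_total 0 y with h | h
      · rw [hkpos x y h, abs_le]
        obtain ⟨c, d⟩ := squaring_bounds a h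
        constructor <;> linarith
      · rw [hkneg x y h, abs_le]
        obtain ⟨c, d⟩ := squaring_bounds b (neg_nonneg.2 h)
        constructor <;> linarith)
  have hF1 : ∀ z, F 1 z = ⟨z.re, k z.re z.im⟩ := fun z => by rw [hFz]; simp
  refine ⟨F, hF, fun t x => ?_, fun z => ?_⟩
  · rw [hFz]
    apply Complex.ext
    · simp
    · simp [hkpos x 0 le_rfl, squaring_zero (hv0 x)]
  · have hγ0 := gauge_of_im_eq_zero (le_refl (0 : ℝ))
    have hnorm : ∀ c : ℝ, ‖z - (c : ℂ)‖ = √(|z.re - c| ^ 2 + z.im ^ 2) := fun c => by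
      rw [Complex.norm_eq_sqrt_sq_add_sq]; simp
    have hdia : ∀ c w : ℝ, gauge 0 ((⟨z.re, w⟩ : ℂ) - (c : ℂ)) = |z.re - c| + |w| := fun c w => by
      simp [gauge]
    rw [hF1]
    rcases le_total 0 z.im with h | h
    · have h1 : 0 ≤ k z.re z.im := by
        rw [hkpos _ _ h, ← squaring_zero (hv0 z.re)]
        exact squaring_mono le_rfl h
      rw [mem_snailSet_upper hn hp hγ0 h1, mem_snailSet_upper hn hp norm_of_im_eq_zero h, hdia,
        abs_of_nonneg h1, hkpos _ _ h, hnorm, squaring, add_sub_cancel]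
    · have h1 : k z.re z.im ≤ 0 := by
        rw [hkneg _ _ h, ← neg_zero, neg_le_neg_iff, ← squaring_zero (hu0 z.re)]
        exact squaring_mono le_rfl (by linarith)
      rw [mem_snailSet_lower hn hp hγ0 h1, mem_snailSet_lower hn hp norm_of_im_eq_zero h, hdia,
        hdia, abs_of_nonpos h1, hkneg _ _ h, neg_neg, hnorm, hnorm]
      refine or_congr ?_ ?_
      -- The left lower block lies in re ≤ -1/2, where `u` is the distance to its centre; to the
      -- right of this line both memberships fail.
      · rcases le_or_gt z.re (-(1 / 2)) with hx | hx
        · have : u z.re = |z.re - -(n : ℝ) / 2| := by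
            simp only [hu]
            rw [clamp_of_nonpos (by linarith)]
            ring
          rw [this, squaring, add_sub_cancel, neg_sq]
        · have e : ((n : ℝ) - 1) / 2 < |z.re - -(n : ℝ) / 2| :=
            lt_of_lt_of_le (by linarith) (le_abs_self _)
          refine iff_of_false (fun h' => ?_) (fun h' => ?_)
          · have a := le_of_mem_radii hn h'
            have b := squaring_mono (u := u z.re) le_rfl (neg_nonneg.2 h)
            rw [squaring_zero (hu0 _)] at b
            linarith
          · have a := le_of_mem_radii hn h'
            have b : |z.re - -(n : ℝ) / 2| ≤ √(|z.re - -(n : ℝ) / 2| ^ 2 + z.im ^ 2) :=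
              Real.le_sqrt_of_sq_le (by nlinarith)
            linarith
      · rcases le_or_gt (1 / 2) z.re with hx | hx
        · have : u z.re = |z.re - (p : ℝ) / 2| := by
            simp only [hu]
            rw [clamp_of_one_le (by linarith)]
            ring
          rw [this, squaring, add_sub_cancel, neg_sq]
        · have e : ((p : ℝ) - 1) / 2 < |z.re - (p : ℝ) / 2| :=
            lt_of_lt_of_le (by linarith) (neg_le_abs _)
          refine iff_of_false (fun h' => ?_) (fun h' => ?_)
          · have a := le_of_mem_radii hp h'
            have b := squaring_mono (u := u z.re) le_rfl (neg_nonneg.2 h)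
            rw [squaring_zero (hu0 _)] at b
            linarith
          · have a := le_of_mem_radii hp h'
            have b : |z.re - (p : ℝ) / 2| ≤ √(|z.re - (p : ℝ) / 2| ^ 2 + z.im ^ 2) :=
              Real.le_sqrt_of_sq_le (by nlinarith)
            linarith

/-- A continuous approximation of the sign. -/
noncomputable def softSign (u : ℝ) : ℝ := max (-1) (min 1 (8 * u))

theorem continuous_softSign : Continuous softSign := by unfold softSign; fun_prop

theorem softSign_mono : Monotone softSign := fun _ _ h =>
  max_le_max le_rfl (min_le_min le_rfl (by linarith))

theorem softSign_of_ge {u : ℝ} (h : 1 / 8 ≤ u) : softSign u = 1 := by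
  rw [softSign, min_eq_left (by linarith), max_eq_right (by norm_num)]

theorem softSign_of_le {u : ℝ} (h : u ≤ -(1 / 8)) : softSign u = -1 := by
  rw [softSign, min_eq_right (by linarith), max_eq_left (by linarith)]

theorem softSign_of_abs_le {u : ℝ} (h : |u| ≤ 1 / 8) : softSign u = 8 * u := by
  obtain ⟨h1, h2⟩ := abs_le.1 h
  rw [softSign, min_eq_right (by linarith), max_eq_right (by linarith)]

theorem abs_softSign_le (u : ℝ) : |softSign u| ≤ 1 :=
  abs_le.2 ⟨le_max_left _ _, max_le (by norm_num) (min_le_left _ _)⟩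

theorem softSign_sub_le {u u' : ℝ} (h : u ≤ u') : softSign u' - softSign u ≤ 8 * (u' - u) := by
  have h1 : softSign u' ≤ softSign u + 8 * (u' - u) := by
    have h0 : -1 ≤ softSign u := le_max_left _ _
    refine max_le (by linarith) ?_
    have : min 1 (8 * u) ≤ softSign u := le_max_right _ _
    rcases le_total 1 (8 * u) with h2 | h2
    · rw [min_eq_left h2] at this
      exact (min_le_left _ _).trans (by linarith)
    · rw [min_eq_right h2] at this
      exact (min_le_right _ _).trans (by linarith)
  linarith

/-- A bump of height `η` at `0`, with support of half-length `1 / 8 + η`. -/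
noncomputable def bump (η u : ℝ) : ℝ := η * max 0 (1 - 8 * |u| / (1 + 8 * η))

section

variable {η : ℝ}

theorem continuous_bump : Continuous (bump η) := by unfold bump; fun_prop

theorem bump_nonneg (hη : 0 < η) (u : ℝ) : 0 ≤ bump η u := mul_nonneg hη.le (le_max_left _ _)

theorem bump_le (hη : 0 < η) (u : ℝ) : bump η u ≤ η := by
  have : max 0 (1 - 8 * |u| / (1 + 8 * η)) ≤ 1 :=
    max_le zero_le_one (by linarith [show 0 ≤ 8 * |u| / (1 + 8 * η) by positivity])
  rw [bump]
  nlinarith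

theorem bump_zero : bump η 0 = η := by simp [bump]

theorem bump_of_ge (hη : 0 < η) {u : ℝ} (h : 1 / 8 + η ≤ |u|) : bump η u = 0 := by
  rw [bump, max_eq_left, mul_zero]
  rw [sub_nonpos, one_le_div (by linarith)]
  linarith

/-- The displacement away from a pole, of maximal amount `η`, at distance `h` from the axis. -/
noncomputable def spread (η u h : ℝ) : ℝ := u + min h η * softSign u

theorem abs_spread_of_ge (hη : 0 < η) {u h : ℝ} (hh : 0 ≤ h) (hu : 1 / 8 ≤ |u|) :
    |spread η u h| = |u| + min h η := by
  have hm : 0 ≤ min h η := le_min hh hη.le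
  rcases le_total 0 u with h0 | h0
  · rw [abs_of_nonneg h0] at hu ⊢
    rw [spread, softSign_of_ge hu, mul_one, abs_of_nonneg (by linarith)]
  · rw [abs_of_nonpos h0] at hu ⊢
    rw [spread, softSign_of_le (by linarith), abs_of_nonpos (by linarith)]
    ring

theorem abs_spread_of_le (hη : 0 < η) {u h : ℝ} (hh : 0 ≤ h) (hu : |u| ≤ 1 / 8) :
    |spread η u h| = |u| * (1 + 8 * min h η) := by
  have hm : 0 ≤ min h η := le_min hh hη.le
  rw [spread, softSign_of_abs_le hu, show u + min h η * (8 * u) = u * (1 + 8 * min h η) by ring,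
    abs_mul, abs_of_nonneg (by linarith : 0 ≤ 1 + 8 * min h η)]

/-- For |u| ≤ 1/8 the spread distance is |u|(1 + 8η) and the bump there is η(1 - 8|u|); farther out
they are |u| + η and 0. The sum is |u| + η in both cases, which fixes the profile of `bump`. -/
theorem bump_spread (hη : 0 < η) {u h : ℝ} (hh : η ≤ h) :
    |spread η u h| + bump η (spread η u h) = |u| + η := by
  have h0 : 0 ≤ h := hη.le.trans hh
  rcases le_total (1 / 8) |u| with hu | hu
  · have e := abs_spread_of_ge hη h0 hu
    rw [min_eq_right hh] at e
    rw [bump_of_ge hη (by linarith), e, add_zero]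
  · have e := abs_spread_of_le hη h0 hu
    rw [min_eq_right hh] at e
    rw [bump, e, max_eq_right]
    · field_simp
      ring
    · rw [sub_nonneg, div_le_one (by linarith)]
      nlinarith

/-- Far from the pole and below height η, the strand |u| + h = s is straightened onto the vertical
lines at distance s. -/
theorem spread_far (hη : 0 < η) (hη' : η ≤ 1 / 16) {u h : ℝ} (hh : 0 ≤ h) (hh' : h ≤ η)
    (hu : 3 / 16 ≤ |spread η u h|) :
    |spread η u h| = |u| + h ∧ bump η (spread η u h) = 0 := by
  refine ⟨?_, bump_of_ge hη (by linarith)⟩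
  rcases le_total (1 / 8) |u| with h1 | h1
  · rw [abs_spread_of_ge hη hh h1, min_eq_left hh']
  · rw [abs_spread_of_le hη hh h1, min_eq_left hh'] at hu ⊢
    nlinarith [abs_nonneg u]

/-- From height η on, the fat gauge of the image is the ℓ¹ distance of the source, by `bump_spread`.
Lower down and near the pole both values are below 1/2, so only radius 0 is possible, and it occurs
exactly at the pole. -/
theorem fat_iff (hη : 0 < η) (hη' : η ≤ 1 / 16) {m : ℕ} (hm : 1 ≤ m) {u h : ℝ} (hh : 0 ≤ h)
    (hu : η ≤ h ∨ |spread η u h| < 3 / 16) :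
    |spread η u h| + max (h + bump η (spread η u h) - η) 0 ∈ radii m ↔ |u| + h ∈ radii m := by
  rcases le_or_gt η h with h1 | h1
  · have := bump_nonneg hη (spread η u h)
    have e := bump_spread (u := u) hη h1
    rw [max_eq_left (by linarith), show |spread η u h| + (h + bump η (spread η u h) - η) =
      |u| + h by linarith]
  · have hu := hu.resolve_left (not_le.2 h1)
    have b1 := bump_le hη (spread η u h)
    have b2 := abs_nonneg (spread η u h)
    have hle : |u| ≤ |spread η u h| := by
      have hm : 0 ≤ min h η := le_min hh hη.le
      rcases le_total (1 / 8) |u| with h2 | h2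
      · rw [abs_spread_of_ge hη hh h2]; linarith
      · rw [abs_spread_of_le hη hh h2]; nlinarith [abs_nonneg u]
    have key : |spread η u h| + max (h + bump η (spread η u h) - η) 0 = 0 ↔ |u| + h = 0 := by
      constructor
      · intro h0
        have h3 := le_max_right (h + bump η (spread η u h) - η) 0
        have h4 : |spread η u h| = 0 := by linarith
        rw [abs_eq_zero.1 h4, bump_zero, abs_zero, zero_add] at h0
        have h5 := le_max_left (h + η - η) 0
        have := abs_nonneg u
        linarith
      · intro h0
        have h3 := abs_nonneg u
        have h4 : h = 0 := by linarith
        have h5 : u = 0 := abs_eq_zero.1 (by linarith)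
        simp [spread, h4, h5, hη.le, bump_zero]
    have hmax : max (h + bump η (spread η u h) - η) 0 ≤ η := max_le (by linarith) hη.le
    constructor
    · intro h0
      have := (eq_zero_or_of_mem_radii hm h0).resolve_right (by linarith)
      rw [key.1 this, ← this]
      exact h0
    · intro h0
      have := (eq_zero_or_of_mem_radii hm h0).resolve_right (by linarith)
      rw [key.2 this, ← this]
      exact h0

/-- Near the axis, the fat snail consists of vertical segments. -/
theorem mem_fat_wall (hη : 0 ≤ η) {n p : ℕ} (hn : 1 ≤ n) (hp : 1 ≤ p) {z : ℂ} (hz : |z.im| ≤ η) :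
    z ∈ snailSet (gauge η) n p ↔ |z.re - ((p : ℝ) - n) / 2| ∈ radii (n + p) := by
  have hγ := gauge_of_im_eq_zero hη
  have e : ∀ c : ℝ, gauge η (z - (c : ℂ)) = |z.re - c| := fun c => by
    rw [gauge_of_abs_im_le (by simpa using hz)]; simp
  rcases le_total 0 z.im with h | h
  · rw [mem_snailSet_upper hn hp hγ h, e]
  · rw [mem_snailSet_lower hn hp hγ h, e, e, radii_blocks hn hp]

/-- Spreading the strands away from the poles. -/
theorem exists_spreading (hη : 0 < η) (hη' : η ≤ 1 / 16) (n p : ℕ) :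
    ∃ F : unitInterval → ℂ ≃ₜ ℂ, IsIsotopy F ∧ (∀ t (x : ℝ), F t x = x) ∧
      ∀ z, F 1 z = ⟨z.re + min (max z.im 0) η * softSign (z.re - ((p : ℝ) - n) / 2) +
        min (max (-z.im) 0) η * (softSign (z.re - -(n : ℝ) / 2) + softSign (z.re - (p : ℝ) / 2) -
          softSign z.re), z.im⟩ := by
  have hm : ∀ y : ℝ, 0 ≤ min (max y 0) η ∧ min (max y 0) η ≤ η := fun y =>
    ⟨le_min (le_max_right _ _) hη.le, min_le_right _ _⟩
  have hs := continuous_softSign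
  -- Below the axis, subtracting `softSign x` cancels the sign of the other pole on each side of 0.
  -- This term decreases near 0, but with slope at most 8η ≤ 1/2, so monotonicity survives.
  obtain ⟨F, hF, hFz⟩ := exists_horizontal_isotopy (fun y x =>
      x + min (max y 0) η * softSign (x - ((p : ℝ) - n) / 2) +
        min (max (-y) 0) η * (softSign (x - -(n : ℝ) / 2) + softSign (x - (p : ℝ) / 2) -
          softSign x)) (by fun_prop)
    (fun y x x' h => by
      obtain ⟨a0, -⟩ := hm y
      obtain ⟨b0, b1⟩ := hm (-y)
      simp only
      generalize min (max y 0) η = a at *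
      generalize min (max (-y) 0) η = b at *
      have e1 := mul_le_mul_of_nonneg_left
        (softSign_mono (show x - ((p : ℝ) - n) / 2 ≤ x' - ((p : ℝ) - n) / 2 by linarith)) a0
      have e2 := mul_le_mul_of_nonneg_left
        (softSign_mono (show x - -(n : ℝ) / 2 ≤ x' - -(n : ℝ) / 2 by linarith)) b0
      have e3 := mul_le_mul_of_nonneg_left
        (softSign_mono (show x - (p : ℝ) / 2 ≤ x' - (p : ℝ) / 2 by linarith)) b0
      have e4 := mul_le_mul_of_nonneg_left (softSign_sub_le h.le) b0
      have e5 : b * (8 * (x' - x)) ≤ 1 / 16 * (8 * (x' - x)) :=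
        mul_le_mul_of_nonneg_right (b1.trans hη') (by linarith)
      linarith)
    (fun _ => 4 * η) continuous_const
    (fun y x => by
      obtain ⟨a0, a1⟩ := hm y
      obtain ⟨b0, b1⟩ := hm (-y)
      generalize min (max y 0) η = a at *
      generalize min (max (-y) 0) η = b at *
      have c1 := abs_le.1 (abs_softSign_le (x - ((p : ℝ) - n) / 2))
      have c2 := abs_le.1 (abs_softSign_le (x - -(n : ℝ) / 2))
      have c3 := abs_le.1 (abs_softSign_le (x - (p : ℝ) / 2))
      have c4 := abs_le.1 (abs_softSign_le x)
      rw [abs_le]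
      constructor <;> nlinarith)
  refine ⟨F, hF, fun t x => ?_, fun z => ?_⟩
  · rw [hFz]
    apply Complex.ext
    · simp [hη.le]
      ring
    · simp
  · rw [hFz]
    simp

/-- Moving the poles away from the axis. -/
theorem exists_lifting (hη : 0 < η) (n p : ℕ) :
    ∃ F : unitInterval → ℂ ≃ₜ ℂ, IsIsotopy F ∧
      ∀ (t : unitInterval) z, F t z = ⟨z.re, z.im + t * (bump η (z.re - ((p : ℝ) - n) / 2) * clamp (1 + z.im / η) -
        (bump η (z.re - -(n : ℝ) / 2) + bump η (z.re - (p : ℝ) / 2)) * clamp (1 - z.im / η))⟩ := by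
  have hb := continuous_bump (η := η)
  have hc := continuous_clamp
  -- Each push has full strength on its own side of the axis and dies out at distance η on the other
  -- side, so the poles, which lie on the axis, are moved by exactly η.
  obtain ⟨F, hF, hFz⟩ := exists_vertical_isotopy (fun x y =>
      y + (bump η (x - ((p : ℝ) - n) / 2) * clamp (1 + y / η) -
        (bump η (x - -(n : ℝ) / 2) + bump η (x - (p : ℝ) / 2)) * clamp (1 - y / η)))
    (by fun_prop)
    (fun x y y' h => by
      have e1 := bump_nonneg hη (x - ((p : ℝ) - n) / 2)
      have e2 := add_nonneg (bump_nonneg hη (x - -(n : ℝ) / 2)) (bump_nonneg hη (x - (p : ℝ) / 2))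
      have hyy : y / η ≤ y' / η := by gcongr
      have f1 := mul_le_mul_of_nonneg_left
        (clamp_mono (show 1 + y / η ≤ 1 + y' / η by linarith)) e1
      have f2 := mul_le_mul_of_nonneg_left
        (clamp_mono (show 1 - y' / η ≤ 1 - y / η by linarith)) e2
      simp only
      linarith)
    (fun _ => 3 * η) continuous_const
    (fun x y => by
      have a1 := bump_nonneg hη (x - ((p : ℝ) - n) / 2)
      have a2 := bump_nonneg hη (x - -(n : ℝ) / 2)
      have a3 := bump_nonneg hη (x - (p : ℝ) / 2)
      have b1 := bump_le hη (x - ((p : ℝ) - n) / 2)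
      have b2 := bump_le hη (x - -(n : ℝ) / 2)
      have b3 := bump_le hη (x - (p : ℝ) / 2)
      have c1 := clamp_nonneg (1 + y / η)
      have c2 := clamp_nonneg (1 - y / η)
      have d1 := clamp_le_one (1 + y / η)
      have d2 := clamp_le_one (1 - y / η)
      rw [add_sub_cancel_left, abs_le]
      constructor <;> nlinarith)
  refine ⟨F, hF, fun t z => ?_⟩
  rw [hFz]
  congr 1
  ring

end

section

variable {η : ℝ}

theorem gauge_sub_mk (c x y : ℝ) :
    gauge η ((⟨x, y⟩ : ℂ) - (c : ℂ)) = |x - c| + max (|y| - η) 0 := by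
  simp [gauge]

theorem gauge_zero_sub (c : ℝ) (z : ℂ) : gauge 0 (z - (c : ℂ)) = |z.re - c| + |z.im| := by
  simp [gauge]

/-- Spreading and lifting takes the square snail to the fat one. -/
theorem mem_fat_iff (hη : 0 < η) (hη' : η ≤ 1 / 16) {n p : ℕ} (hn : 1 ≤ n) (hp : 1 ≤ p)
    {x y x' : ℝ}
    (hx' : x' = x + min (max y 0) η * softSign (x - ((p : ℝ) - n) / 2) +
        min (max (-y) 0) η * (softSign (x - -(n : ℝ) / 2) + softSign (x - (p : ℝ) / 2) -
          softSign x)) :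
    (⟨x', y + (bump η (x' - ((p : ℝ) - n) / 2) * clamp (1 + y / η) -
        (bump η (x' - -(n : ℝ) / 2) + bump η (x' - (p : ℝ) / 2)) * clamp (1 - y / η))⟩ : ℂ) ∈
      snailSet (gauge η) n p ↔ (⟨x, y⟩ : ℂ) ∈ snailSet (gauge 0) n p := by
  have hn' : (1 : ℝ) ≤ n := by exact_mod_cast hn
  have hp' : (1 : ℝ) ≤ p := by exact_mod_cast hp
  have hγ0 := gauge_of_im_eq_zero (le_refl (0 : ℝ))
  have hγ := gauge_of_im_eq_zero hη.le
  have b1 := bump_nonneg hη (x' - -(n : ℝ) / 2)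
  have b2 := bump_nonneg hη (x' - ((p : ℝ) - n) / 2)
  have b3 := bump_nonneg hη (x' - (p : ℝ) / 2)
  have d1 := bump_le hη (x' - -(n : ℝ) / 2)
  have d2 := bump_le hη (x' - ((p : ℝ) - n) / 2)
  have d3 := bump_le hη (x' - (p : ℝ) / 2)
  have zero_of : ∀ u : ℝ, 3 / 16 ≤ |u| → bump η u = 0 := fun u hu => bump_of_ge hη (by linarith)
  have walls : ∀ w : ℝ, |w| ≤ η → ((⟨x', w⟩ : ℂ) ∈ snailSet (gauge η) n p ↔
      |x' - ((p : ℝ) - n) / 2| ∈ radii (n + p)) := fun w hw => mem_fat_wall hη.le hn hp hw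
  -- The two lower bumps have disjoint supports.
  have hsum : bump η (x' - -(n : ℝ) / 2) + bump η (x' - (p : ℝ) / 2) ≤ η := by
    rcases le_or_gt (3 / 16) |x' - -(n : ℝ) / 2| with h | h
    · rw [zero_of _ h]; linarith
    · have := abs_lt.1 h
      rw [zero_of (x' - (p : ℝ) / 2) (by rw [le_abs]; right; linarith)]
      linarith
  rcases le_total 0 y with hy | hy
  · have hxs : x' - ((p : ℝ) - n) / 2 = spread η (x - ((p : ℝ) - n) / 2) y := by
      rw [hx', max_eq_left hy, max_eq_right (by linarith), min_eq_left hη.le, spread]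
      ring
    have c1 : clamp (1 + y / η) = 1 := clamp_of_one_le (by
      have := div_nonneg hy hη.le; linarith)
    rw [mem_snailSet_upper (z := ⟨x, y⟩) hn hp hγ0 hy, gauge_zero_sub, c1, mul_one]
    simp only [abs_of_nonneg hy]
    -- At height η or near the pole the gauges are compared by `fat_iff`; otherwise the image stays
    -- in the strip |im| ≤ η, where the fat snail consists of vertical segments.
    by_cases hu : η ≤ y ∨ |spread η (x - ((p : ℝ) - n) / 2) y| < 3 / 16
    · have e : (bump η (x' - -(n : ℝ) / 2) + bump η (x' - (p : ℝ) / 2)) * clamp (1 - y / η) = 0 := by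
        rcases hu with h | h
        · rw [clamp_of_nonpos, mul_zero]
          have := (one_le_div hη).2 h
          linarith
        · rw [← hxs] at h
          have := abs_lt.1 h
          rw [zero_of (x' - -(n : ℝ) / 2) (by rw [le_abs]; left; linarith),
            zero_of (x' - (p : ℝ) / 2) (by rw [le_abs]; right; linarith)]
          ring
      rw [e, sub_zero, mem_snailSet_upper hn hp hγ (by simp only; linarith), gauge_sub_mk,
        abs_of_nonneg (by linarith : 0 ≤ y + bump η (x' - ((p : ℝ) - n) / 2)), hxs]
      exact fat_iff hη hη' (by omega) hy hu
    · rw [not_or, not_le, not_lt] at hu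
      obtain ⟨f1, f2⟩ := spread_far hη hη' hy hu.1.le hu.2
      rw [← hxs] at f1 f2
      have c2 : clamp (1 - y / η) = 1 - y / η := clamp_of_mem
        (sub_nonneg.2 ((div_le_one hη).2 hu.1.le)) (by have := div_nonneg hy hη.le; linarith)
      have c3 : η * (1 - y / η) = η - y := by field_simp
      have c4 : 0 ≤ 1 - y / η := sub_nonneg.2 ((div_le_one hη).2 hu.1.le)
      rw [walls, f1]
      rw [f2, c2]
      have := mul_le_mul_of_nonneg_right hsum c4
      have := mul_nonneg (add_nonneg b1 b3) c4
      rw [abs_le]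
      constructor <;> linarith
  · have hh : 0 ≤ -y := by linarith
    have hxs : x' = x + min (-y) η * (softSign (x - -(n : ℝ) / 2) + softSign (x - (p : ℝ) / 2) -
          softSign x) := by
      rw [hx', max_eq_right hy, max_eq_left hh, min_eq_left hη.le]
      ring
    have hm0 : 0 ≤ min (-y) η := le_min hh hη.le
    have hm1 : min (-y) η ≤ 1 / 16 := (min_le_right _ _).trans hη'
    have c1 : clamp (1 - y / η) = 1 := clamp_of_one_le (by
      have := div_nonneg hh hη.le
      rw [neg_div] at this
      linarith)
    have c5 := clamp_nonneg (1 + y / η)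
    have hcl : η ≤ -y → clamp (1 + y / η) = 0 := fun h => clamp_of_nonpos (by
      have := (one_le_div hη).2 h
      rw [neg_div] at this
      linarith)
    have c2 : -y ≤ η → bump η (x' - ((p : ℝ) - n) / 2) * clamp (1 + y / η) ≤ η + y := fun h => by
      have c4 : 0 ≤ 1 + y / η := by
        have := (div_le_one hη).2 h
        rw [neg_div] at this
        linarith
      rw [clamp_of_mem c4 (by have := div_nonneg hh hη.le; rw [neg_div] at this; linarith)]
      have c3 : η * (1 + y / η) = η + y := by field_simp
      have := mul_le_mul_of_nonneg_right d2 c4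
      linarith
    have c6 := mul_nonneg b2 c5
    rw [mem_snailSet_lower (z := ⟨x, y⟩) hn hp hγ0 hy, gauge_zero_sub, gauge_zero_sub, c1, mul_one]
    simp only [abs_of_nonpos hy]
    have far : ∀ {m : ℕ} (_ : 1 ≤ m) {u v : ℝ}, 0 ≤ v → ((m : ℝ) - 1) / 2 < u →
        ¬ (u + v ∈ radii m) := by
      intro m hm u v hv hu h
      have := le_of_mem_radii hm h
      linarith
    rcases le_or_gt x (-(1 / 8)) with hx1 | hx1
    · have hxs' : x' - -(n : ℝ) / 2 = spread η (x - -(n : ℝ) / 2) (-y) := by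
        rw [hxs, softSign_of_le hx1, softSign_of_le (by linarith : x - (p : ℝ) / 2 ≤ _), spread]
        ring
      have hx'0 : x' ≤ -(1 / 16) := by
        have := (abs_le.1 (abs_softSign_le (x - -(n : ℝ) / 2))).2
        have e : x' = x + min (-y) η * softSign (x - -(n : ℝ) / 2) := by
          rw [spread] at hxs'; linarith
        nlinarith
      have z3 : bump η (x' - (p : ℝ) / 2) = 0 := zero_of _ (by rw [le_abs]; right; linarith)
      rw [z3, add_zero, or_iff_left (far hp hh (by rw [lt_abs]; right; linarith))]
      by_cases hu : η ≤ -y ∨ |spread η (x - -(n : ℝ) / 2) (-y)| < 3 / 16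
      · have e : bump η (x' - ((p : ℝ) - n) / 2) * clamp (1 + y / η) = 0 := by
          rcases hu with h | h
          · rw [hcl h, mul_zero]
          · rw [← hxs'] at h
            have := abs_lt.1 h
            rw [zero_of (x' - ((p : ℝ) - n) / 2) (by rw [le_abs]; right; linarith), zero_mul]
        have hle : y + (0 - bump η (x' - -(n : ℝ) / 2)) ≤ 0 := by linarith
        rw [e, mem_snailSet_lower hn hp hγ hle, gauge_sub_mk, gauge_sub_mk, abs_of_nonpos hle,
          or_iff_left (far hp (le_max_right _ _) (by rw [lt_abs]; right; linarith)), hxs',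
          ← fat_iff hη hη' hn hh hu]
        ring_nf
      · rw [not_or, not_le, not_lt] at hu
        obtain ⟨f1, f2⟩ := spread_far hη hη' hh hu.1.le hu.2
        rw [← hxs'] at f1 f2
        have := c2 hu.1.le
        rw [walls _ (by rw [f2, abs_le]; constructor <;> linarith), radii_blocks hn hp, f1,
          or_iff_left]
        have := far hp (u := |x' - (p : ℝ) / 2|) le_rfl (by rw [lt_abs]; right; linarith)
        rwa [add_zero] at this
    rcases le_or_gt (1 / 8) x with hx2 | hx2
    · have hxs' : x' - (p : ℝ) / 2 = spread η (x - (p : ℝ) / 2) (-y) := by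
        rw [hxs, softSign_of_ge hx2, softSign_of_ge (by linarith : _ ≤ x - -(n : ℝ) / 2), spread]
        ring
      have hx'0 : 1 / 16 ≤ x' := by
        have := (abs_le.1 (abs_softSign_le (x - (p : ℝ) / 2))).1
        have e : x' = x + min (-y) η * softSign (x - (p : ℝ) / 2) := by
          rw [spread] at hxs'; linarith
        nlinarith
      have z1 : bump η (x' - -(n : ℝ) / 2) = 0 := zero_of _ (by rw [le_abs]; left; linarith)
      rw [z1, zero_add, or_iff_right (far hn hh (by rw [lt_abs]; left; linarith))]
      by_cases hu : η ≤ -y ∨ |spread η (x - (p : ℝ) / 2) (-y)| < 3 / 16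
      · have e : bump η (x' - ((p : ℝ) - n) / 2) * clamp (1 + y / η) = 0 := by
          rcases hu with h | h
          · rw [hcl h, mul_zero]
          · rw [← hxs'] at h
            have := abs_lt.1 h
            rw [zero_of (x' - ((p : ℝ) - n) / 2) (by rw [le_abs]; left; linarith), zero_mul]
        have hle : y + (0 - bump η (x' - (p : ℝ) / 2)) ≤ 0 := by linarith
        rw [e, mem_snailSet_lower hn hp hγ hle, gauge_sub_mk, gauge_sub_mk, abs_of_nonpos hle,
          or_iff_right (far hn (le_max_right _ _) (by rw [lt_abs]; left; linarith)), hxs',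
          ← fat_iff hη hη' hp hh hu]
        ring_nf
      · rw [not_or, not_le, not_lt] at hu
        obtain ⟨f1, f2⟩ := spread_far hη hη' hh hu.1.le hu.2
        rw [← hxs'] at f1 f2
        have := c2 hu.1.le
        rw [walls _ (by rw [f2, abs_le]; constructor <;> linarith), radii_blocks hn hp, f1,
          or_iff_right]
        have := far hn (u := |x' - -(n : ℝ) / 2|) le_rfl (by rw [lt_abs]; left; linarith)
        rwa [add_zero] at this
    -- In the gap between the two lower blocks neither snail has points.
    · have hs := abs_le.1 (abs_softSign_le x)
      have e : x' = x + min (-y) η * (-softSign x) := by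
        rw [hxs, softSign_of_ge (by linarith : _ ≤ x - -(n : ℝ) / 2),
          softSign_of_le (by linarith : x - (p : ℝ) / 2 ≤ _)]
        ring
      have hx'1 : x' ≤ 3 / 16 := by nlinarith
      have hx'2 : -(3 / 16) ≤ x' := by nlinarith
      have far1 : ((n : ℝ) - 1) / 2 < |x' - -(n : ℝ) / 2| := by rw [lt_abs]; left; linarith
      have far3 : ((p : ℝ) - 1) / 2 < |x' - (p : ℝ) / 2| := by rw [lt_abs]; right; linarith
      rw [zero_of (x' - -(n : ℝ) / 2) (by rw [le_abs]; left; linarith),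
        zero_of (x' - (p : ℝ) / 2) (by rw [le_abs]; right; linarith)]
      refine iff_of_false (fun h => ?_) (not_or.2
        ⟨far hn hh (by rw [lt_abs]; left; linarith), far hp hh (by rw [lt_abs]; right; linarith)⟩)
      rcases le_or_gt η (-y) with h1 | h1
      · rw [hcl h1] at h
        have hle : y + (bump η (x' - ((p : ℝ) - n) / 2) * 0 - (0 + 0)) ≤ 0 := by linarith
        rw [mem_snailSet_lower hn hp hγ hle, gauge_sub_mk, gauge_sub_mk] at h
        rcases h with h | h
        · exact far hn (le_max_right _ _) far1 h
        · exact far hp (le_max_right _ _) far3 h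
      · have := c2 h1.le
        rw [walls _ (by rw [abs_le]; constructor <;> linarith), radii_blocks hn hp] at h
        rcases h with h | h
        · exact far hn le_rfl far1 (by rwa [add_zero])
        · exact far hp le_rfl far3 (by rwa [add_zero])

/-- The fat snail is a model of the snail, with poles moved away from the axis. -/
theorem exists_fattening (hη : 0 < η) (hη' : η ≤ 1 / 16) {n p : ℕ} (hn : 1 ≤ n) (hp : 1 ≤ p) :
    ∃ F : unitInterval → ℂ ≃ₜ ℂ, IsIsotopy F ∧
      F 1 '' snailCurve n p = snailSet (gauge η) n p ∧
      ∀ (t : unitInterval) i, F t (snailCenters n p i) =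
        ⟨snailCenters n p i, (![-1, 1, -1] : Fin 3 → ℝ) i * (t * η)⟩ := by
  have hn' : (1 : ℝ) ≤ n := by exact_mod_cast hn
  have hp' : (1 : ℝ) ≤ p := by exact_mod_cast hp
  obtain ⟨Q, hQ, hQx, hQz⟩ := exists_squaring hn hp
  obtain ⟨S, hS, hSx, hSz⟩ := exists_spreading hη hη' n p
  obtain ⟨L, hL, hLz⟩ := exists_lifting hη n p
  refine ⟨_, (hQ.trans hS).trans hL, ?_, fun t i => ?_⟩
  · have key : ∀ z, L 1 (S 1 (Q 1 z)) ∈ snailSet (gauge η) n p ↔ z ∈ snailCurve n p := by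
      intro z
      rw [snailCurve_eq, ← hQz, hLz, hSz, Set.Icc.coe_one, one_mul]
      exact mem_fat_iff hη hη' hn hp rfl
    ext w
    constructor
    · rintro ⟨z, hz, rfl⟩
      exact (key z).2 hz
    · intro hw
      refine ⟨(((Q 1).trans (S 1)).trans (L 1)).symm w, (key _).1 ?_,
        Homeomorph.apply_symm_apply _ _⟩
      have : L 1 (S 1 (Q 1 ((((Q 1).trans (S 1)).trans (L 1)).symm w))) = w :=
        Homeomorph.apply_symm_apply (((Q 1).trans (S 1)).trans (L 1)) w
      rw [this]
      exact hw
  · have zero_of : ∀ u : ℝ, 3 / 16 ≤ |u| → bump η u = 0 := fun u hu => bump_of_ge hη (by linarith)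
    have h1 : clamp 1 = 1 := clamp_of_one_le le_rfl
    simp only [Homeomorph.trans_apply, hQx, hSx, hLz, Complex.ofReal_re, Complex.ofReal_im,
      zero_div, add_zero, sub_zero, zero_add, h1, mul_one]
    congr 1
    fin_cases i
    · simp only [snailCenters]
      rw [zero_of _ (by rw [le_abs]; right; simp; linarith)]
      simp
      rw [zero_of _ (by rw [le_abs]; right; linarith), bump_zero]
      ring
    · simp only [snailCenters]
      simp
      rw [zero_of (_ - -(n : ℝ) / 2) (by rw [le_abs]; left; linarith),
        zero_of (_ - (p : ℝ) / 2) (by rw [le_abs]; right; linarith), bump_zero]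
      simp
    · simp only [snailCenters]
      simp
      rw [zero_of (_ - -(n : ℝ) / 2) (by rw [le_abs]; left; linarith),
        zero_of (_ - ((p : ℝ) - n) / 2) (by rw [le_abs]; left; linarith), bump_zero]
      ring

end

/-! ### The half-twist on the fat snail -/

/-- Positivity of the height, with the quotient v/d multiplied by |d|²; one hypothesis for each of
the two terms of `roof`. -/
theorem admissible_of_pos {c : Fin 3 → ℂ} {d v : ℂ} (hd : c 2 - c 0 = d) (hv : c 1 - c 0 = v)
    (h0 : d ≠ 0) (h1 : 0 < v.im * d.re - v.re * d.im + |v.re * d.re + v.im * d.im|)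
    (h2 : 0 < v.im * d.re - v.re * d.im + |v.re * d.re + v.im * d.im - normSq d|) :
    Admissible c := by
  have hN : 0 < normSq d := normSq_pos.2 h0
  have hs : shape c = v / d := by rw [shape, hd, hv]
  have him : (v / d).im = (v.im * d.re - v.re * d.im) / normSq d := by rw [div_im]; ring
  have hre : (v / d).re = (v.re * d.re + v.im * d.im) / normSq d := by rw [div_re]; ring
  refine ⟨fun h => h0 (by rw [← hd, h, sub_self]), ?_⟩
  rw [height, hs, him, hre, ← neg_lt_iff_pos_add', roof, lt_min_iff]
  constructor
  · rw [abs_div, abs_of_pos hN, neg_lt_iff_pos_add', ← add_div]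
    exact div_pos (by linarith) hN
  · rw [div_sub_one hN.ne', abs_div, abs_of_pos hN, neg_lt_iff_pos_add', ← add_div]
    exact div_pos (by linarith) hN

theorem strictMono_snailCenters {n p : ℕ} (hn : 1 ≤ n) (hp : 1 ≤ p) :
    StrictMono (snailCenters n p) := by
  have hn' : (1 : ℝ) ≤ n := by exact_mod_cast hn
  have hp' : (1 : ℝ) ≤ p := by exact_mod_cast hp
  rw [Fin.strictMono_iff_lt_succ]
  intro i
  fin_cases i <;> simp [snailCenters] <;> linarith

section

variable {n p : ℕ} {η : ℝ}

theorem abs_mem_radii_right {k : ℕ} (hk : k < p) {x : ℝ} (hx : x = ((n : ℝ) + 1) / 2 + k) :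
    |x - ((n : ℝ) + p) / 2| ∈ radii p :=
  (abs_mem_radii (by omega)).2 ⟨k, hk, by linarith⟩

theorem abs_mem_radii_middle {k : ℕ} (hk : k < p) {x : ℝ} (hx : x = ((n : ℝ) + 1) / 2 + k) :
    |x - (p : ℝ) / 2| ∈ radii (n + p) :=
  (abs_mem_radii (by omega)).2 ⟨n + k, by omega, by push_cast; linarith⟩

/-- The upper block of the fat snail outside the twisted disc consists of vertical segments and of
points which are dragged along. -/
theorem upper_block_cases (hn : 1 ≤ n) {z : ℂ} (hz : 0 ≤ z.im)
    (h : gauge η (z - ((p / 2 : ℝ) : ℂ)) ∈ radii (n + p)) :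
    (gauge η z ≤ ((n : ℝ) - 1) / 2 ∨ 0 < z.re ∧ η ≤ z.im) ∨
      |z.im| ≤ η ∧ ∃ k : ℕ, k < p ∧ z.re = ((n : ℝ) + 1) / 2 + k := by
  rcases le_or_gt η z.im with h1 | h1
  · left
    rcases lt_or_ge 0 z.re with h2 | h2
    · exact Or.inr ⟨h2, h1⟩
    · left
      have h3 := le_of_mem_radii (by omega) h
      have h4 : η ≤ |z.im| := by rwa [abs_of_nonneg hz]
      have hp0 : (0 : ℝ) ≤ p := Nat.cast_nonneg p
      rw [gauge_of_le_abs_im (by simpa using h4)] at h3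
      rw [gauge_of_le_abs_im h4, abs_of_nonpos h2]
      simp only [sub_re, ofReal_re, sub_im, ofReal_im, sub_zero] at h3
      rw [abs_of_nonpos (by linarith)] at h3
      push_cast at h3
      linarith
  · have h4 : |z.im| ≤ η := by rw [abs_of_nonneg hz]; exact h1.le
    rw [gauge_of_abs_im_le (by simpa using h4), abs_mem_radii (by omega)] at h
    obtain ⟨k, hk, h⟩ := h
    simp only [sub_re, ofReal_re] at h
    push_cast at h
    rcases Nat.lt_or_ge k n with h' | h'
    · left; left
      rw [gauge_of_abs_im_le h4, abs_le]
      have : (k : ℝ) + 1 ≤ n := by exact_mod_cast h'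
      have : (0 : ℝ) ≤ k := Nat.cast_nonneg k
      constructor <;> linarith
    · refine Or.inr ⟨h4, k - n, by omega, ?_⟩
      rw [Nat.cast_sub h']
      linarith

/-- The lower right block of the fat snail consists of vertical segments and of points which do
not move. -/
theorem lower_block_cases (hp : 1 ≤ p) {z : ℂ} (hz : z.im ≤ 0)
    (h : gauge η (z - ((((n : ℝ) + p) / 2 : ℝ) : ℂ)) ∈ radii p) (hη : 0 < η) (hη' : η ≤ 1 / 2) :
    (0 < z.re ∧ z.im ≤ -η ∧ -z.im ≤ z.re ∧ (n : ℝ) / 2 ≤ gauge η z) ∨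
      |z.im| ≤ η ∧ ∃ k : ℕ, k < p ∧ z.re = ((n : ℝ) + 1) / 2 + k := by
  have hn0 : (0 : ℝ) ≤ n := Nat.cast_nonneg n
  rcases le_or_gt z.im (-η) with h1 | h1
  · left
    have h3 := le_of_mem_radii hp h
    have h4 : η ≤ |z.im| := by rw [abs_of_nonpos hz]; linarith
    rw [gauge_of_le_abs_im (by simpa using h4)] at h3
    simp only [sub_re, ofReal_re, sub_im, ofReal_im, sub_zero] at h3
    rw [abs_of_nonpos hz] at h3
    have h5 := neg_le_abs (z.re - ((n : ℝ) + p) / 2)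
    refine ⟨by linarith, h1, by linarith, ?_⟩
    have := (le_abs_self _).trans (abs_re_le_gauge (η := η) z)
    linarith
  · right
    have h4 : |z.im| ≤ η := by rw [abs_of_nonpos hz]; linarith
    rw [gauge_of_abs_im_le (by simpa using h4), abs_mem_radii hp] at h
    obtain ⟨k, hk, h⟩ := h
    simp only [sub_re, ofReal_re] at h
    exact ⟨h4, k, hk, by linarith⟩

/-- The effect on fat snails of the half-twist around a block, in coordinates centred there. -/
theorem image_fat_of_drag (hη : 0 < η) (hη' : η ≤ 1 / 2) (hn : 1 ≤ n) (hp : 1 ≤ p) (T : ℂ ≃ₜ ℂ)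
    (h1 : ∀ z, (gauge η z ≤ ((n : ℝ) - 1) / 2 ∨ 0 < z.re ∧ η ≤ z.im) → T z = -z)
    (h2 : ∀ z, 0 < z.re → z.im ≤ -η → -z.im ≤ z.re → (n : ℝ) / 2 ≤ gauge η z → T z = z)
    (h3 : ∀ r : ℝ, (n : ℝ) / 2 ≤ r →
      T '' {z | z.re = r ∧ |z.im| ≤ η} = {z | gauge η z = r ∧ -η ≤ z.im}) :
    T '' {z | (z.im ≤ 0 ∧ gauge η z ∈ radii n) ∨
      (z.im ≤ 0 ∧ gauge η (z - ((((n : ℝ) + p) / 2 : ℝ) : ℂ)) ∈ radii p) ∨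
      (0 ≤ z.im ∧ gauge η (z - ((p / 2 : ℝ) : ℂ)) ∈ radii (n + p))} =
    {z | (z.im ≤ 0 ∧ gauge η (z + ((p / 2 : ℝ) : ℂ)) ∈ radii (n + p)) ∨
      (z.im ≤ 0 ∧ gauge η (z - ((((n : ℝ) + p) / 2 : ℝ) : ℂ)) ∈ radii p) ∨
      (0 ≤ z.im ∧ gauge η z ∈ radii (n + p + p))} := by
  have hr : ∀ k : ℕ, (n : ℝ) / 2 ≤ ((n : ℝ) + 1) / 2 + k := fun k => by
    have : (0 : ℝ) ≤ k := Nat.cast_nonneg k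
    linarith
  have eqp : ∀ z : ℂ, gauge η (-z + ((p / 2 : ℝ) : ℂ)) = gauge η (z - ((p / 2 : ℝ) : ℂ)) :=
    fun z => by rw [← gauge_neg]; congr 1; ring
  have gre : ∀ (z : ℂ) (c : ℝ), |z.im| ≤ η → gauge η (z - (c : ℂ)) = |z.re - c| :=
    fun z c h => by rw [gauge_of_abs_im_le (by simpa using h)]; simp
  -- Near the axis the lower right block and the last p strands of the upper block join into full
  -- vertical segments, which `h3` carries onto the full arcs treated next.
  have wall : ∀ (z : ℂ) (k : ℕ), k < p → |z.im| ≤ η → z.re = ((n : ℝ) + 1) / 2 + k →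
      (z.im ≤ 0 ∧ gauge η (z - ((((n : ℝ) + p) / 2 : ℝ) : ℂ)) ∈ radii p) ∨
      (0 ≤ z.im ∧ gauge η (z - ((p / 2 : ℝ) : ℂ)) ∈ radii (n + p)) := by
    intro z k hk hz hz'
    rw [gre _ _ hz, gre _ _ hz]
    rcases le_total z.im 0 with h | h
    · exact Or.inl ⟨h, abs_mem_radii_right hk hz'⟩
    · exact Or.inr ⟨h, abs_mem_radii_middle hk hz'⟩
  have arc : ∀ (z : ℂ) (k : ℕ), k < p → gauge η z = ((n : ℝ) + 1) / 2 + k → -η ≤ z.im →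
      (z.im ≤ 0 ∧ gauge η (z + ((p / 2 : ℝ) : ℂ)) ∈ radii (n + p)) ∨
      (z.im ≤ 0 ∧ gauge η (z - ((((n : ℝ) + p) / 2 : ℝ) : ℂ)) ∈ radii p) ∨
      (0 ≤ z.im ∧ gauge η z ∈ radii (n + p + p)) := by
    intro z k hk hz hz'
    rcases le_total 0 z.im with h | h
    · exact Or.inr (Or.inr ⟨h, (mem_radii_add hn).2 (Or.inr ⟨k, hk, hz⟩)⟩)
    · have h4 : |z.im| ≤ η := by rw [abs_of_nonpos h]; linarith
      rw [gauge_of_abs_im_le h4] at hz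
      rcases abs_choice z.re with h5 | h5 <;> rw [h5] at hz
      · refine Or.inr (Or.inl ⟨h, ?_⟩)
        rw [gre _ _ h4]
        exact abs_mem_radii_right hk hz
      · refine Or.inl ⟨h, ?_⟩
        rw [← neg_neg z, eqp, gre _ _ (by simpa using h4)]
        exact abs_mem_radii_middle hk (by simpa using hz)
  have arc' : ∀ (z : ℂ) (k : ℕ), k < p → gauge η z = ((n : ℝ) + 1) / 2 + k → -η ≤ z.im →
      ∃ w, T w = z ∧ ((w.im ≤ 0 ∧ gauge η (w - ((((n : ℝ) + p) / 2 : ℝ) : ℂ)) ∈ radii p) ∨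
        (0 ≤ w.im ∧ gauge η (w - ((p / 2 : ℝ) : ℂ)) ∈ radii (n + p))) := by
    intro z k hk hz hz'
    obtain ⟨w, ⟨hw, hw'⟩, rfl⟩ := (h3 _ (hr k)).ge ⟨hz, hz'⟩
    exact ⟨w, rfl, wall w k hk hw' hw⟩
  have walle : ∀ (z : ℂ) (k : ℕ), |z.im| ≤ η → z.re = ((n : ℝ) + 1) / 2 + k →
      gauge η z = ((n : ℝ) + 1) / 2 + k := fun z k h h' => by
    rw [gauge_of_abs_im_le h, h', abs_of_nonneg (by positivity)]
  ext w
  constructor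
  · rintro ⟨z, hz, rfl⟩
    have onwall : (|z.im| ≤ η ∧ ∃ k : ℕ, k < p ∧ z.re = ((n : ℝ) + 1) / 2 + k) →
        T z ∈ {z : ℂ | (z.im ≤ 0 ∧ gauge η (z + ((p / 2 : ℝ) : ℂ)) ∈ radii (n + p)) ∨
          (z.im ≤ 0 ∧ gauge η (z - ((((n : ℝ) + p) / 2 : ℝ) : ℂ)) ∈ radii p) ∨
          (0 ≤ z.im ∧ gauge η z ∈ radii (n + p + p))} := by
      rintro ⟨h, k, hk, hk'⟩
      have : T z ∈ T '' {z | z.re = ((n : ℝ) + 1) / 2 + k ∧ |z.im| ≤ η} :=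
        mem_image_of_mem _ ⟨hk', h⟩
      rw [h3 _ (hr k)] at this
      exact arc _ k hk this.1 this.2
    -- The left block turns into the core of the new upper block, the right block stays, and the old
    -- upper block turns into the new left block; the walls are handled as wholes.
    rcases hz with ⟨h, h'⟩ | ⟨h, h'⟩ | ⟨h, h'⟩
    · rw [h1 z (Or.inl (le_of_mem_radii hn h'))]
      refine Or.inr (Or.inr ⟨by simpa using h, ?_⟩)
      rw [gauge_neg]
      exact (mem_radii_add hn).2 (Or.inl h')
    · rcases lower_block_cases hp h h' hη hη' with h4 | h4
      · rw [h2 z h4.1 h4.2.1 h4.2.2.1 h4.2.2.2]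
        exact Or.inr (Or.inl ⟨h, h'⟩)
      · exact onwall h4
    · rcases upper_block_cases hn h h' with h4 | h4
      · rw [h1 z h4]
        exact Or.inl ⟨by simpa using h, by rwa [eqp]⟩
      · exact onwall h4
  · rintro (⟨h, h'⟩ | ⟨h, h'⟩ | ⟨h, h'⟩)
    · rw [← neg_neg w, eqp] at h'
      have h0 : 0 ≤ (-w).im := by simpa using h
      rcases upper_block_cases hn h0 h' with h4 | ⟨h4, k, hk, hk'⟩
      · exact ⟨-w, Or.inr (Or.inr ⟨h0, h'⟩), by rw [h1 _ h4, neg_neg]⟩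
      · have := walle (-w) k h4 hk'
        rw [gauge_neg] at this
        rw [neg_im, abs_neg] at h4
        obtain ⟨z, hz, hz'⟩ := arc' w k hk this (abs_le.1 h4).1
        exact ⟨z, Or.inr hz', hz⟩
    · rcases lower_block_cases hp h h' hη hη' with h4 | ⟨h4, k, hk, hk'⟩
      · exact ⟨w, Or.inr (Or.inl ⟨h, h'⟩), h2 w h4.1 h4.2.1 h4.2.2.1 h4.2.2.2⟩
      · obtain ⟨z, hz, hz'⟩ := arc' w k hk (walle w k h4 hk') (abs_le.1 h4).1
        exact ⟨z, Or.inr hz', hz⟩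
    · rcases (mem_radii_add hn).1 h' with h4 | ⟨k, hk, h4⟩
      · refine ⟨-w, Or.inl ⟨by simpa using h, by rwa [gauge_neg]⟩, ?_⟩
        rw [h1 _ (Or.inl (by rw [gauge_neg]; exact le_of_mem_radii hn h4)), neg_neg]
      · obtain ⟨z, hz, hz'⟩ := arc' w k hk h4 (by linarith)
        exact ⟨z, Or.inr hz', hz⟩

end

/-- The centres of the fat snail. -/
noncomputable def fatCenters (η : ℝ) (n p : ℕ) (i : Fin 3) : ℂ :=
  ⟨snailCenters n p i, (![-1, 1, -1] : Fin 3 → ℝ) i * η⟩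

section

variable {n p : ℕ} {η : ℝ}

theorem admissible_fatCenters (hn : 1 ≤ n) (hp : 1 ≤ p) (hη : 0 ≤ η) :
    Admissible (fatCenters η n p) := by
  have hn' : (1 : ℝ) ≤ n := by exact_mod_cast hn
  have hp' : (1 : ℝ) ≤ p := by exact_mod_cast hp
  refine admissible_of_im_nonneg (fun i j h => ?_) ?_
  · exact (strictMono_snailCenters hn hp).injective (congrArg Complex.re h)
  · have e : fatCenters η n p 2 - fatCenters η n p 0 = ((((n : ℝ) + p) / 2 : ℝ) : ℂ) := by
      apply Complex.ext <;> simp [fatCenters, snailCenters]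
      ring
    rw [shape, e, Complex.div_ofReal_im]
    simp only [fatCenters, snailCenters, sub_im]
    simp
    positivity

/-- The centres of the fat snail are a model of those of the snail. -/
theorem isMove_fattening (hn : 1 ≤ n) (hp : 1 ≤ p) (hη : 0 ≤ η)
    {F : unitInterval → ℂ ≃ₜ ℂ} (hF : IsIsotopy F)
    (h : ∀ (t : unitInterval) i, F t (snailCenters n p i) = fatCenters (t * η) n p i) :
    IsMove (realTriple (snailCenters n p)) (F 1) (fatCenters η n p) := by
  refine hF.isMove (fun t => ?_) fun i => ?_
  · rw [show (fun i => F t (realTriple (snailCenters n p) i)) = fatCenters (t * η) n p from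
      funext (h t)]
    exact admissible_fatCenters hn hp (mul_nonneg t.2.1 hη)
  · rw [realTriple, h, Set.Icc.coe_one, one_mul]

/-- For η > 0 the exchanged second point lies slightly below the line through the outer ones, away
from both. This is why the admissible region has to extend below the real axis. -/
theorem admissible_fatCenters_swap (hn : 1 ≤ n) (hp : 1 ≤ p) (hη : 0 ≤ η) (hη' : η ≤ 1 / 40) :
    Admissible (fatCenters η (n + p) p ∘ Equiv.swap 0 1) := by
  have hn' : (1 : ℝ) ≤ n := by exact_mod_cast hn
  have hp' : (1 : ℝ) ≤ p := by exact_mod_cast hp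
  have h2 : Equiv.swap (0 : Fin 3) 1 2 = 2 := by decide
  have ha : 0 ≤ (p : ℝ) * (n + p) / 4 - 2 * η * (n + p) - 4 * η ^ 2 - 1 / 10 := by nlinarith
  have hb : 0 ≤ η * n := by positivity
  refine admissible_of_pos (d := ⟨((n : ℝ) + p) / 2, -(2 * η)⟩) (v := ⟨-(p : ℝ) / 2, -(2 * η)⟩)
    ?_ ?_ (fun h => ?_) ?_ ?_
  · apply Complex.ext <;> simp [fatCenters, snailCenters, h2] <;> ring
  · apply Complex.ext <;> simp [fatCenters, snailCenters] <;> ring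
  · have := congrArg Complex.re h
    simp only [zero_re] at this
    linarith
  · simp only
    refine lt_of_lt_of_le ?_ (add_le_add le_rfl (neg_le_abs _))
    nlinarith
  · simp only [normSq_mk]
    refine lt_of_lt_of_le ?_ (add_le_add le_rfl (neg_le_abs _))
    nlinarith

theorem isMove_fattening_swap (hn : 1 ≤ n) (hp : 1 ≤ p) (hη : 0 ≤ η) (hη' : η ≤ 1 / 40)
    {F : unitInterval → ℂ ≃ₜ ℂ} (hF : IsIsotopy F)
    (h : ∀ (t : unitInterval) i,
      F t (snailCenters (n + p) p i) = fatCenters (t * η) (n + p) p i) :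
    IsMove (realTriple (snailCenters (n + p) p ∘ Equiv.swap 0 1)) (F 1)
      (fatCenters η (n + p) p ∘ Equiv.swap 0 1) := by
  refine hF.isMove (fun t => ?_) fun i => ?_
  · rw [show (fun i => F t (realTriple (snailCenters (n + p) p ∘ Equiv.swap 0 1) i)) =
      fatCenters (t * η) (n + p) p ∘ Equiv.swap 0 1 from funext fun i => h t _]
    refine admissible_fatCenters_swap hn hp (mul_nonneg t.2.1 hη) ?_
    have := mul_le_mul_of_nonneg_right t.2.2 hη
    linarith
  · simp only [realTriple, Function.comp]
    rw [h, Set.Icc.coe_one, one_mul]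

/-- A triple with first point near `0`, second point almost on the upper half of a circle around
`0`, and third point further away. -/
theorem admissible_of_gauge {c : Fin 3 → ℂ} {l r : ℝ} (hη : 0 < η) (hη' : η ≤ 1 / 40)
    (hr : 1 / 2 ≤ r) (hl : r + 1 / 2 ≤ l) (h0 : ‖c 0‖ ≤ η) (h1 : gauge η (c 1) = r)
    (h1' : 0 ≤ (c 1).im ∨ -η ≤ (c 1).im ∧ (c 1).re ≤ 0) (h2 : c 2 = ⟨l, -η⟩) :
    Admissible c := by
  set a := c 0
  set w := c 1
  have ha := abs_le.1 ((abs_re_le_norm a).trans h0)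
  have hb := abs_le.1 ((abs_im_le_norm a).trans h0)
  have hw : |w.re| ≤ r := h1 ▸ abs_re_le_gauge w
  have hw' : |w.im| ≤ r + η := by
    have := le_max_left (|w.im| - η) 0
    have := abs_nonneg w.re
    rw [gauge] at h1
    linarith
  -- `hw1` and `hw2` treat the two terms of `roof` with the outer points taken to be exactly 0 and
  -- l.
  have hw1 : 1 / 2 - η ≤ w.im + |w.re| := by
    rcases h1' with h | ⟨h, -⟩
    · have := gauge_le_norm_one hη.le w
      rw [abs_of_nonneg h] at this
      linarith
    · have := norm_le_gauge_add (η := η) w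
      rcases le_total 0 w.im with h' | h'
      · have := gauge_le_norm_one hη.le w
        rw [abs_of_nonneg h'] at this
        linarith
      · rw [gauge_of_abs_im_le (by rw [abs_of_nonpos h']; linarith)] at h1
        linarith
  have hw2 : 1 / 2 - η ≤ w.im + |w.re - l| := by
    have := neg_le_abs (w.re - l)
    have := (abs_le.1 hw).2
    rcases h1' with h | ⟨h, h'⟩ <;> linarith
  have hwr := abs_le.1 hw
  have hwi := abs_le.1 hw'
  have hl0 : 0 < l := by linarith
  have p1 : |a.im * l| ≤ η * l := by
    rw [abs_mul, abs_of_pos hl0]; exact mul_le_mul_of_nonneg_right (abs_le.2 hb) hl0.le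
  have p2 : |a.re * l| ≤ η * l := by
    rw [abs_mul, abs_of_pos hl0]; exact mul_le_mul_of_nonneg_right (abs_le.2 ha) hl0.le
  have bd : ∀ x y : ℝ, |x| ≤ l → |y| ≤ 2 * η → |x * y| ≤ 2 * (η * l) := fun x y hx hy => by
    rw [abs_mul]
    calc |x| * |y| ≤ l * (2 * η) := mul_le_mul hx hy (abs_nonneg _) hl0.le
      _ = _ := by ring
  have bd1 : ∀ x y : ℝ, |x| ≤ l → |y| ≤ η → |x * y| ≤ η * l := fun x y hx hy => by
    rw [abs_mul]
    calc |x| * |y| ≤ l * η := mul_le_mul hx hy (abs_nonneg _) hl0.le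
      _ = _ := by ring
  have hvr : |w.re - a.re| ≤ l := by rw [abs_le]; constructor <;> linarith
  have hvi : |w.im - a.im| ≤ l := by rw [abs_le]; constructor <;> linarith
  have hdi : |-η - a.im| ≤ 2 * η := by rw [abs_le]; constructor <;> linarith
  have q1 := abs_le.1 (bd1 (w.im - a.im) a.re hvi (abs_le.2 ha))
  have q2 := abs_le.1 (bd (w.re - a.re) (-η - a.im) hvr hdi)
  have q3 := abs_le.1 (bd1 (w.re - a.re) a.re hvr (abs_le.2 ha))
  have q4 := abs_le.1 (bd (w.im - a.im) (-η - a.im) hvi hdi)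
  have p1' := abs_le.1 p1
  have p2' := abs_le.1 p2
  -- The errors made by moving the outer points away from 0 and l are small multiples of ηl; with η
  -- ≤ 1/40 they stay below the margin.
  have hll : 1 / 40 * l ≤ l * (1 / 2 - η) - 12 * (η * l) := by nlinarith
  have hηl : 0 < η * l := mul_pos hη hl0
  have him : l * w.im - 4 * (η * l) ≤
      (w.im - a.im) * (l - a.re) - (w.re - a.re) * (-η - a.im) := by linarith
  refine admissible_of_pos (d := ⟨l - a.re, -η - a.im⟩) (v := ⟨w.re - a.re, w.im - a.im⟩)
    ?_ ?_ (fun h => ?_) ?_ ?_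
  · rw [h2]; apply Complex.ext <;> simp [a]
  · apply Complex.ext <;> simp [a, w]
  · have := congrArg Complex.re h
    simp only [zero_re] at this
    linarith
  · simp only
    have e : (w.re - a.re) * (l - a.re) + (w.im - a.im) * (-η - a.im) = l * w.re -
      (a.re * l + (w.re - a.re) * a.re - (w.im - a.im) * (-η - a.im)) := by ring
    have h5 : |a.re * l + (w.re - a.re) * a.re - (w.im - a.im) * (-η - a.im)| ≤ 4 * (η * l) := by
      rw [abs_le]; constructor <;> linarith
    have h6 := abs_sub_abs_le_abs_sub (l * w.re)
      (a.re * l + (w.re - a.re) * a.re - (w.im - a.im) * (-η - a.im))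
    rw [abs_mul, abs_of_pos hl0] at h6
    rw [e]
    have := mul_le_mul_of_nonneg_left hw1 hl0.le
    linarith
  · simp only [normSq_mk]
    have e : (w.re - a.re) * (l - a.re) + (w.im - a.im) * (-η - a.im) -
      ((l - a.re) * (l - a.re) + (-η - a.im) * (-η - a.im)) = l * (w.re - l) -
      ((w.re - l) * a.re - (w.im + η) * (-η - a.im)) := by ring
    have h5 : |(w.re - l) * a.re - (w.im + η) * (-η - a.im)| ≤ 4 * (η * l) := by
      have t1 := abs_le.1 (bd1 ((w.re - l) / 2) a.re
        (by rw [abs_le]; constructor <;> linarith) (abs_le.2 ha))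
      have t2 := abs_le.1 (bd (w.im + η) (-η - a.im)
        (by rw [abs_le]; constructor <;> linarith) hdi)
      rw [abs_le]; constructor <;> linarith
    have h6 := abs_sub_abs_le_abs_sub (l * (w.re - l))
      ((w.re - l) * a.re - (w.im + η) * (-η - a.im))
    rw [abs_mul, abs_of_pos hl0] at h6
    rw [e]
    have := mul_le_mul_of_nonneg_left hw2 hl0.le
    linarith

end

/-- A model of the homeomorphisms of type `A` takes `SN(n;p)` to `SN(n+p;p)`. -/
theorem exists_twist_snail {n p : ℕ} (hn : 1 ≤ n) (hp : 1 ≤ p) : ∃ K : ℂ ≃ₜ ℂ,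
    IsMove (realTriple (snailCenters n p)) K
      (realTriple (snailCenters (n + p) p ∘ Equiv.swap 0 1)) ∧
    K '' snailCurve n p = snailCurve (n + p) p := by
  have hn' : (1 : ℝ) ≤ n := by exact_mod_cast hn
  have hp' : (1 : ℝ) ≤ p := by exact_mod_cast hp
  have hnp : 1 ≤ n + p := by omega
  obtain ⟨η, hη, hη'⟩ : ∃ η : ℝ, 0 < η ∧ η ≤ 1 / 40 := ⟨1 / 40, by norm_num, le_rfl⟩
  obtain ⟨C, hC, hCs, hCt⟩ := exists_fattening hη (by linarith) hn hp
  obtain ⟨C', hC', hCs', hCt'⟩ := exists_fattening hη (by linarith) hnp hp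
  obtain ⟨F, hF, h1, h2, h3, h4, h5⟩ := exists_drag hη (by linarith) hn
  -- The left lower centre -n/2 is brought to the origin, the centre of the drag map.
  set τ : ℂ ≃ₜ ℂ := Homeomorph.addRight (((n : ℝ) / 2 : ℝ) : ℂ) with hτ
  have hτ1 : ∀ z, τ z = z + (((n : ℝ) / 2 : ℝ) : ℂ) := fun z => rfl
  set E : unitInterval → ℂ ≃ₜ ℂ := fun t => (τ.symm.symm.trans (F t)).trans τ.symm with hEdef
  have hE : IsIsotopy E := hF.conj τ.symm
  have hτE : ∀ t z, τ (E t z) = F t (τ z) := fun t z => by simp [hEdef]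
  have hset : E 1 '' snailSet (gauge η) n p = snailSet (gauge η) (n + p) p := by
    have key := image_fat_of_drag hη (by linarith) hn hp (F 1) h1
      (fun z a b c d => h2 z a b c d 1) h3
    have e1 : snailSet (gauge η) n p = τ ⁻¹' {z | (z.im ≤ 0 ∧ gauge η z ∈ radii n) ∨
      (z.im ≤ 0 ∧ gauge η (z - ((((n : ℝ) + p) / 2 : ℝ) : ℂ)) ∈ radii p) ∨
      (0 ≤ z.im ∧ gauge η (z - ((p / 2 : ℝ) : ℂ)) ∈ radii (n + p))} := by
      ext z
      simp only [snailSet, mem_preimage, mem_ofPred_eq, hτ1, add_im, ofReal_im, add_zero]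
      have a1 : z - ((-(n : ℝ) / 2 : ℝ) : ℂ) = z + (((n : ℝ) / 2 : ℝ) : ℂ) := by push_cast; ring
      have a2 : z - (((p : ℝ) / 2 : ℝ) : ℂ) =
        z + (((n : ℝ) / 2 : ℝ) : ℂ) - ((((n : ℝ) + p) / 2 : ℝ) : ℂ) := by push_cast; ring
      have a3 : z - ((((p : ℝ) - n) / 2 : ℝ) : ℂ) =
        z + (((n : ℝ) / 2 : ℝ) : ℂ) - (((p : ℝ) / 2 : ℝ) : ℂ) := by push_cast; ring
      rw [a1, a2, a3]
    have e2 : snailSet (gauge η) (n + p) p = τ ⁻¹' {z |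
      (z.im ≤ 0 ∧ gauge η (z + ((p / 2 : ℝ) : ℂ)) ∈ radii (n + p)) ∨
      (z.im ≤ 0 ∧ gauge η (z - ((((n : ℝ) + p) / 2 : ℝ) : ℂ)) ∈ radii p) ∨
      (0 ≤ z.im ∧ gauge η z ∈ radii (n + p + p))} := by
      ext z
      simp only [snailSet, mem_preimage, mem_ofPred_eq, hτ1, add_im, ofReal_im, add_zero]
      have a1 : z - ((-((n + p : ℕ) : ℝ) / 2 : ℝ) : ℂ) =
        z + (((n : ℝ) / 2 : ℝ) : ℂ) + (((p : ℝ) / 2 : ℝ) : ℂ) := by push_cast; ring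
      have a2 : z - (((p : ℝ) / 2 : ℝ) : ℂ) =
        z + (((n : ℝ) / 2 : ℝ) : ℂ) - ((((n : ℝ) + p) / 2 : ℝ) : ℂ) := by push_cast; ring
      have a3 : z - ((((p : ℝ) - ((n + p : ℕ) : ℝ)) / 2 : ℝ) : ℂ) =
        z + (((n : ℝ) / 2 : ℝ) : ℂ) := by push_cast; ring
      rw [a1, a2, a3]
    rw [e1, e2, ← key, ← τ.image_symm, image_image, image_image]
    refine image_congr fun z _ => ?_
    rw [← τ.injective.eq_iff, hτE]
    simp
  have hmove : IsMove (fatCenters η n p) (E 1) (fatCenters η (n + p) p ∘ Equiv.swap 0 1) := by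
    have s2 : Equiv.swap (0 : Fin 3) 1 2 = 2 := by decide
    have c0 : τ (fatCenters η n p 0) = -(η * I) := by
      rw [hτ1]; apply Complex.ext <;> simp [fatCenters, snailCenters]; ring
    have c1 : τ (fatCenters η n p 1) = ⟨p / 2, η⟩ := by
      rw [hτ1]; apply Complex.ext <;> simp [fatCenters, snailCenters]; ring
    have c2 : τ (fatCenters η n p 2) = ⟨((n : ℝ) + p) / 2, -η⟩ := by
      rw [hτ1]; apply Complex.ext <;> simp [fatCenters, snailCenters]; ring
    have hfix : ∀ t, F t ⟨((n : ℝ) + p) / 2, -η⟩ = ⟨((n : ℝ) + p) / 2, -η⟩ := by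
      refine h2 _ ?_ le_rfl ?_ ?_
      · simp only; linarith
      · simp only; linarith
      · refine le_trans ?_ ((le_abs_self _).trans (abs_re_le_gauge _))
        simp only; linarith
    refine hE.isMove (fun t => ?_) fun i => ?_
    · have a : Admissible fun i => F t (τ (fatCenters η n p i)) := by
        obtain ⟨g1, g2⟩ := h5 (p / 2) (by linarith) t
        refine admissible_of_gauge (l := ((n : ℝ) + p) / 2) (r := p / 2) hη hη' (by linarith)
          (by linarith) ?_ ?_ ?_ ?_
        · rw [c0]; exact h4 t
        · rw [c1]; exact g1
        · rw [c1]; exact g2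
        · rw [c2]; exact hfix t
      -- Admissibility involves only differences of the points, so the translation does not affect
      -- it.
      have e : ∀ i j, F t (τ (fatCenters η n p i)) - F t (τ (fatCenters η n p j)) =
          E t (fatCenters η n p i) - E t (fatCenters η n p j) := fun i j => by
        rw [← hτE, ← hτE, hτ1, hτ1]; ring
      refine ⟨fun h => a.1 ?_, ?_⟩
      · change E t _ = E t _ at h
        rw [← sub_eq_zero, e, h, sub_self]
      · have := a.2
        simp only [height, shape] at this ⊢
        rwa [e, e] at this
    · rw [← τ.injective.eq_iff, hτE]
      fin_cases i
      · simp only [Fin.zero_eta, Function.comp, Equiv.swap_apply_left]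
        rw [c0, h1 _ (Or.inl ?_), hτ1]
        · apply Complex.ext <;> simp [fatCenters, snailCenters]; ring
        · rw [gauge_neg, gauge_of_abs_im_le (by simp [abs_of_pos hη])]
          simp
          linarith
      · simp only [Fin.mk_one, Function.comp, Equiv.swap_apply_right]
        rw [c1, h1 _ (Or.inr ⟨by simp only; linarith, le_rfl⟩), hτ1]
        apply Complex.ext <;> simp [fatCenters, snailCenters]; ring
      · simp only [Fin.reduceFinMk, Function.comp, s2]
        rw [c2, hfix, hτ1]
        apply Complex.ext <;> simp [fatCenters, snailCenters]; ring
  -- Fatten, twist, then slim down to the round snail of the new size.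
  refine ⟨((C 1).trans (E 1)).trans (C' 1).symm, ?_, ?_⟩
  · exact ((isMove_fattening hn hp hη.le hC hCt).trans hmove).trans
      (isMove_fattening_swap hn hp hη.le hη' hC' hCt').symm
  · have : snailCurve (n + p) p = (C' 1).symm '' (E 1 '' (C 1 '' snailCurve n p)) := by
      rw [hCs, hset, ← hCs', image_image]
      simp
    rw [this, image_image, image_image]
    rfl

/-! ### Models for the two segments -/

theorem segment_ofReal {a b : ℝ} (h : a ≤ b) :
    segment ℝ (a : ℂ) (b : ℂ) = (fun s : ℝ => (s : ℂ)) '' Icc a b := by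
  rw [← segment_eq_Icc h]
  exact (image_segment ℝ Complex.ofRealCLM.toLinearMap.toAffineMap a b).symm

theorem IsIsotopy.isMove_of_im_nonneg {F : unitInterval → ℂ ≃ₜ ℂ} (hF : IsIsotopy F)
    {c c' : Fin 3 → ℂ} (hc : Function.Injective c)
    (h : ∀ t, 0 ≤ (shape fun i => F t (c i)).im) (h1 : ∀ i, F 1 (c i) = c' i) :
    IsMove c (F 1) c' :=
  hF.isMove (fun t => admissible_of_im_nonneg ((F t).injective.comp hc) (h t)) h1

theorem injective_realTriple {x : Fin 3 → ℝ} (hx : Function.Injective x) :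
    Function.Injective (realTriple x) :=
  Complex.ofReal_injective.comp hx

/-- A half-twist of a real segment is a model of the homeomorphisms of type `A`. -/
theorem exists_twist_segment {x : Fin 3 → ℝ} (hx : StrictMono x) : ∃ K : ℂ ≃ₜ ℂ,
    IsMove (realTriple x) K (realTriple (x ∘ Equiv.swap 0 1)) ∧
    K '' segment ℝ (x 0 : ℂ) (x 1 : ℂ) = segment ℝ (x 0 : ℂ) (x 1 : ℂ) := by
  have h01 : x 0 < x 1 := hx (by decide)
  have h12 : x 1 < x 2 := hx (by decide)
  set m := (x 0 + x 1) / 2 with hm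
  set d := (x 1 - x 0) / 2 with hd
  set R := x 2 - m with hR
  have hd0 : 0 < d := by simp only [hd]; linarith
  have hdR : 0 < R - d := by simp only [hd, hR, hm]; linarith
  have hR0 : 0 < R := by linarith
  obtain ⟨F, hF, hFz⟩ := exists_twist_isotopy
    -- A half-turn on the disc with the segment as diameter, damped to the identity at radius `R`,
    -- where the third point lies.
    (fun z => Real.pi * clamp ((R - ‖z‖) / (R - d)))
    ((continuous_const.mul (continuous_clamp.comp (by fun_prop))).continuousOn)
    (fun r hr θ _ θ' _ h => by
      have hn : ∀ θ : ℝ, ‖(r * exp (θ * I) : ℂ)‖ = r := fun θ => by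
        rw [norm_mul, norm_exp_ofReal_mul_I, mul_one, Complex.norm_of_nonneg hr.le]
      simp only [hn]
      linarith)
  set τ : ℂ ≃ₜ ℂ := Homeomorph.addRight (-(m : ℂ)) with hτ
  have hτ1 : ∀ z, τ z = z - m := fun z => (sub_eq_add_neg z (m : ℂ)).symm
  set E : unitInterval → ℂ ≃ₜ ℂ := fun t => (τ.symm.symm.trans (F t)).trans τ.symm with hEdef
  have hE : IsIsotopy E := hF.conj τ.symm
  have hτE : ∀ t z, E t z = F t (z - m) + m := fun t z => by
    rw [← τ.injective.eq_iff, hτ1, hτ1, add_sub_cancel_right, ← hτ1, ← hτ1]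
    simp [hEdef]
  have near : ∀ t z, ‖z‖ ≤ d → F t z = z * exp ((t * Real.pi : ℝ) * I) := fun t z hz => by
    rw [hFz, clamp_of_one_le (by rw [one_le_div hdR]; linarith), mul_one]
  have far : ∀ t z, ‖z‖ = R → F t z = z := fun t z hz => by
    rw [hFz, clamp_of_nonpos (by rw [hz, sub_self, zero_div])]
    simp
  have flip : ∀ s ∈ Icc (x 0) (x 1), E 1 (s : ℂ) = ((x 0 + x 1 - s : ℝ) : ℂ) := fun s hs => by
    rw [hτE, near _ _ ?_, Set.Icc.coe_one, one_mul, exp_pi_mul_I]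
    · simp only [hm]
      push_cast
      ring
    · rw [← ofReal_sub, norm_real, Real.norm_eq_abs, abs_le]
      constructor <;> simp only [hm, hd] <;> linarith [hs.1, hs.2]
  have s2 : Equiv.swap (0 : Fin 3) 1 2 = 2 := by decide
  have e2 : ∀ t, E t (x 2) = x 2 := fun t => by
    rw [hτE, far _ _ ?_, sub_add_cancel]
    rw [← ofReal_sub, norm_real, Real.norm_of_nonneg hR0.le]
  refine ⟨E 1, hE.isMove_of_im_nonneg (injective_realTriple hx.injective) (fun t => ?_)
    fun i => ?_, ?_⟩
  · have e0 : E t (x 0) = m - d * exp ((t * Real.pi : ℝ) * I) := by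
      have : (x 0 : ℂ) - m = ((-d : ℝ) : ℂ) := by simp only [hm, hd]; push_cast; ring
      rw [hτE, this, near _ _ (by rw [norm_real, norm_neg, Real.norm_of_nonneg hd0.le])]
      push_cast
      ring
    have e1 : E t (x 1) = m + d * exp ((t * Real.pi : ℝ) * I) := by
      have : (x 1 : ℂ) - m = (d : ℂ) := by simp only [hm, hd]; push_cast; ring
      rw [hτE, this, near _ _ (by rw [norm_real, Real.norm_of_nonneg hd0.le])]
      ring
    simp only [shape, realTriple]
    rw [e2, e0, e1, div_im]
    have hs : 0 ≤ Real.sin (t * Real.pi) := Real.sin_nonneg_of_nonneg_of_le_pi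
      (mul_nonneg t.2.1 Real.pi_pos.le) (mul_le_of_le_one_left Real.pi_pos.le t.2.2)
    rw [← sub_div]
    refine div_nonneg ?_ (normSq_nonneg _)
    simp only [add_im, sub_im, add_re, sub_re, re_ofReal_mul, im_ofReal_mul, ofReal_re, ofReal_im,
      exp_ofReal_mul_I_re, exp_ofReal_mul_I_im]
    -- With c the moving triple, the imaginary part of (c₁ - c₀) times the conjugate of c₂ - c₀ is
    -- 2dR sin(tπ).
    have : 0 ≤ d * R * Real.sin (t * Real.pi) := by positivity
    simp only [hR] at this
    linarith
  · fin_cases i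
    · exact (flip _ ⟨le_rfl, h01.le⟩).trans (by simp [realTriple])
    · exact (flip _ ⟨h01.le, le_rfl⟩).trans (by simp [realTriple])
    · simpa [realTriple, s2] using e2 1
  · rw [segment_ofReal h01.le, image_image]
    ext z
    constructor
    · rintro ⟨s, hs, rfl⟩
      exact ⟨x 0 + x 1 - s, ⟨by linarith [hs.2], by linarith [hs.1]⟩, (flip s hs).symm⟩
    · rintro ⟨s, hs, rfl⟩
      refine ⟨x 0 + x 1 - s, ⟨by linarith [hs.2], by linarith [hs.1]⟩, ?_⟩
      simp only
      rw [flip _ ⟨by linarith [hs.2], by linarith [hs.1]⟩, sub_sub_cancel]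

/-- Real affine maps are ends of isotopies. -/
theorem exists_affine_isotopy {s : ℝ} (hs : 0 < s) (b : ℝ) :
    ∃ F : unitInterval → ℂ ≃ₜ ℂ, IsIsotopy F ∧
      ∀ (t : unitInterval) z, F t z = ((1 - t + t * s : ℝ) : ℂ) * z + (t * b : ℝ) := by
  have hl : ∀ t : unitInterval, min 1 s ≤ 1 - t + t * s := fun t => by
    have a := mul_le_mul_of_nonneg_left (min_le_right 1 s) t.2.1
    have b := mul_le_mul_of_nonneg_left (min_le_left 1 s) (sub_nonneg.2 t.2.2)
    linarith
  have hm : 0 < min 1 s := lt_min one_pos hs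
  refine exists_isotopy (fun t z => ((1 - t + t * s : ℝ) : ℂ) * z + (t * b : ℝ)) ?_ (fun t => ?_)
    (fun z => by simp) fun R => ⟨(R + |b|) / min 1 s, fun t z h => ?_⟩
  · fun_prop
  · have h0 : ((1 - t + t * s : ℝ) : ℂ) ≠ 0 := ofReal_ne_zero.2 (hm.trans_le (hl t)).ne'
    refine ⟨fun z w h => mul_left_cancel₀ h0 (add_right_cancel h), fun w =>
      ⟨(w - (t * b : ℝ)) / ((1 - t + t * s : ℝ) : ℂ), ?_⟩⟩
    simp only
    rw [mul_div_cancel₀ _ h0, sub_add_cancel]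
  · rw [le_div_iff₀ hm]
    have h1 := norm_sub_le (((1 - t + t * s : ℝ) : ℂ) * z + (t * b : ℝ)) ((t * b : ℝ) : ℂ)
    rw [add_sub_cancel_right, norm_mul, norm_real, norm_real,
      Real.norm_of_nonneg (hm.trans_le (hl t)).le, norm_mul, Real.norm_of_nonneg t.2.1,
      Real.norm_eq_abs] at h1
    have h2 := mul_le_of_le_one_left (abs_nonneg b) t.2.2
    have h3 := mul_le_mul_of_nonneg_right (hl t) (norm_nonneg z)
    linarith

/-- Both lower half-circles have radius 0 and are the ends of the upper half-circle. -/
theorem snailCurve_one_one :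
    snailCurve 1 1 = (fun θ : ℝ => (1 / 2 : ℝ) * exp (θ * I)) '' Icc 0 Real.pi := by
  have h1 : ∀ s : ℝ, s ∈ radii 1 ↔ s = 0 := fun s => by
    simp [radii, circleRadius]
  have h2 : ∀ s : ℝ, s ∈ radii (1 + 1) ↔ s = 1 / 2 := fun s => by
    simp [radii, circleRadius]
  have key : ∀ z : ℂ, z ∈ snailCurve 1 1 ↔ 0 ≤ z.im ∧ ‖z‖ = 1 / 2 := fun z => by
    have e : ∀ c : ℝ, |c| = 1 / 2 → ‖z - c‖ = 0 → 0 ≤ z.im ∧ ‖z‖ = 1 / 2 := fun c hc h => by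
      rw [norm_eq_zero, sub_eq_zero] at h
      subst h
      simpa using hc
    rw [snailCurve_eq]
    simp only [snailSet, mem_ofPred_eq, h1, h2]
    constructor
    · rintro (⟨-, h⟩ | ⟨-, h⟩ | ⟨h, h'⟩)
      · exact e _ (by norm_num) h
      · exact e _ (by norm_num) h
      · exact ⟨h, by simpa using h'⟩
    · rintro ⟨h, h'⟩
      exact Or.inr (Or.inr ⟨h, by simpa using h'⟩)
  ext z
  rw [key]
  constructor
  · rintro ⟨h, h'⟩
    refine ⟨arg z, ⟨arg_nonneg_iff.2 h, arg_le_pi z⟩, ?_⟩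
    simp only
    rw [← h', norm_mul_exp_arg_mul_I]
  · rintro ⟨θ, hθ, rfl⟩
    constructor
    · rw [im_ofReal_mul, exp_ofReal_mul_I_im]
      exact mul_nonneg (by norm_num) (Real.sin_nonneg_of_mem_Icc hθ)
    · rw [norm_mul, norm_exp_ofReal_mul_I, norm_real]
      norm_num

/-- Lifting a segment of the axis to an arc of circle. -/
theorem exists_lift_to_arc {q : ℝ} (hq : 0 < q) (hq' : q < 1 / 2) :
    ∃ F : unitInterval → ℂ ≃ₜ ℂ, IsIsotopy F ∧ (∀ t, F t 0 = 0) ∧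
      (∀ t, F t ((1 / 2 : ℝ) : ℂ) = ((1 / 2 : ℝ) : ℂ)) ∧ (∀ t, 0 ≤ (F t (q : ℂ)).im) ∧
      ∀ s ∈ Icc q (1 / 2), F 1 (s : ℂ) = (1 / 2 : ℝ) * exp (Real.arccos (2 * s) * I) := by
  -- Over [q, 1/2] the graph of `Q` is the arc of radius 1/2; to the left it follows the chord to
  -- the origin and then the axis, so that 0 is fixed.
  set Q : ℝ → ℝ := fun x => min (√(1 / 4 - x ^ 2)) (√(1 / 4 - q ^ 2) / q * max x 0) with hQ
  have hQc : Continuous Q := by fun_prop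
  obtain ⟨F, hF, hFz⟩ := exists_vertical_isotopy (fun x y => y + Q x) (by fun_prop)
    (fun x y y' h => by simpa using h) (fun x => |Q x|) (by fun_prop) (fun x y => by simp)
  have hF' : ∀ (t : unitInterval) (s : ℝ), F t (s : ℂ) = ⟨s, t * Q s⟩ := fun t s => by
    rw [hFz]; simp
  have hQ0 : Q 0 = 0 := by simp [hQ]
  have hQ1 : Q (1 / 2) = 0 := by
    have : 0 ≤ √(1 / 4 - q ^ 2) / q * max (1 / 2) 0 := by positivity
    simp only [hQ]
    rw [show (1 / 4 - (1 / 2) ^ 2 : ℝ) = 0 by norm_num, Real.sqrt_zero, min_eq_left this]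
  have hQs : ∀ s ∈ Icc q (1 / 2), Q s = √(1 / 4 - s ^ 2) := fun s hs => by
    refine min_eq_left ?_
    rw [max_eq_left (by linarith [hs.1]), div_mul_eq_mul_div, le_div_iff₀ hq]
    exact mul_le_mul (Real.sqrt_le_sqrt (by nlinarith [hs.1])) hs.1 hq.le (Real.sqrt_nonneg _)
  refine ⟨F, hF, fun t => ?_, fun t => ?_, fun t => ?_, fun s hs => ?_⟩
  · have := hF' t 0
    rw [hQ0, mul_zero, ofReal_zero] at this
    exact this
  · rw [hF', hQ1, mul_zero]
    rfl
  · rw [hF', hQs q ⟨le_rfl, hq'.le⟩]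
    exact mul_nonneg t.2.1 (Real.sqrt_nonneg _)
  · have e : √(1 - (2 * s) ^ 2) = 2 * √(1 / 4 - s ^ 2) := by
      rw [show 1 - (2 * s) ^ 2 = 2 ^ 2 * (1 / 4 - s ^ 2) by ring, Real.sqrt_mul (by norm_num),
        Real.sqrt_sq (by norm_num)]
    rw [hF', hQs s hs]
    apply Complex.ext
    · rw [re_ofReal_mul, exp_ofReal_mul_I_re, Real.cos_arccos (by linarith [hs.1])
        (by linarith [hs.2])]
      ring
    · rw [im_ofReal_mul, exp_ofReal_mul_I_im, Real.sin_arccos, e, Set.Icc.coe_one]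
      ring

/-- Stretching an arc of circle to a half-circle. -/
theorem exists_arc_stretch {φ : ℝ} (hφ : 0 < φ) (hφ' : φ ≤ Real.pi / 2) :
    ∃ F : unitInterval → ℂ ≃ₜ ℂ, IsIsotopy F ∧
      ∀ (t : unitInterval) (r θ : ℝ), 0 ≤ r → θ ∈ Icc 0 φ →
        F t (r * exp (θ * I)) = r * exp ((θ + t * ((Real.pi / φ - 1) * θ) : ℝ) * I) := by
  have hpi := Real.pi_pos
  -- The descending branch must bring the added angle from π - φ at angle φ back to 0 at 2π.
  set k := (Real.pi - φ) / (2 * Real.pi - φ) with hkdef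
  set B : ℝ → ℝ → ℝ := fun _ θ => (Real.pi / φ - 1) * max θ 0 with hB
  have hden : 0 < 2 * Real.pi - φ := by linarith
  have hk : 0 ≤ k := div_nonneg (by linarith) hden.le
  have hk1 : k < 1 := (div_lt_one hden).2 (by linarith)
  have hkφ : k * (2 * Real.pi - φ) = (Real.pi / φ - 1) * φ := by
    rw [hkdef, div_mul_cancel₀ _ hden.ne']
    field_simp
  have hb : 0 ≤ Real.pi / φ - 1 := by
    rw [sub_nonneg, one_le_div hφ]; linarith
  have h1 : ∀ r θ : ℝ, 0 < r → Real.pi / 2 ≤ θ → θ ≤ Real.pi →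
      k * (0 + 2 * Real.pi - θ) ≤ B r θ := fun r θ _ h _ => by
    simp only [hB]
    rw [max_eq_left (by linarith)]
    have a := mul_le_mul_of_nonneg_left (show φ ≤ θ by linarith) hb
    have b := mul_le_mul_of_nonneg_left (show φ ≤ θ by linarith) hk
    linarith
  have h2 : ∀ r θ : ℝ, 0 < r → -Real.pi ≤ θ → θ ≤ -(Real.pi / 2) → B r θ ≤ k * (0 - θ) :=
    fun r θ _ _ h => by
      simp only [hB]
      rw [max_eq_right (by linarith), mul_zero]
      exact mul_nonneg hk (by linarith)
  obtain ⟨F, hF, hFz⟩ := exists_twist_isotopy (sawtooth k 0 B)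
    (continuousOn_sawtooth (by fun_prop) h1 h2 hk)
    (fun r hr => strictMonoOn_sawtooth h1 h2
      (fun r _ θ θ' h => mul_le_mul_of_nonneg_left (max_le_max h le_rfl) hb) hk hk1 hr)
  refine ⟨F, hF, fun t r θ hr hθ => ?_⟩
  rcases hr.eq_or_lt with rfl | hr
  · rw [hFz]; simp
  have e : sawtooth k 0 B (r * exp (θ * I)) = (Real.pi / φ - 1) * θ := by
    rw [sawtooth_polar h1 h2 hk hr ⟨by linarith [hθ.1], by linarith [hθ.2]⟩]
    simp only [hB]
    rw [max_eq_left hθ.1, min_eq_left, max_eq_right]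
    · have := mul_nonneg hb hθ.1
      have := mul_nonneg hk hθ.1
      linarith
    · have a := mul_le_mul_of_nonneg_left hθ.2 hb
      have b := mul_le_mul_of_nonneg_left hθ.2 hk
      linarith
  rw [hFz, e, mul_assoc, ← exp_add]
  congr 2
  push_cast
  ring

/-- A model of the homeomorphisms of type `A` takes `SN(0;1)` to `SN(1;1)`. -/
theorem exists_twist_complement {x : Fin 3 → ℝ} (hx : StrictMono x) : ∃ K : ℂ ≃ₜ ℂ,
    IsMove (realTriple x) K (realTriple (snailCenters 1 1 ∘ Equiv.swap 0 1)) ∧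
    K '' segment ℝ (x 1 : ℂ) (x 2 : ℂ) = snailCurve 1 1 := by
  have h01 : x 0 < x 1 := hx (by decide)
  have h12 : x 1 < x 2 := hx (by decide)
  have hl : 0 < 2 * (x 2 - x 0) := by linarith
  -- This scale puts the outer points at 0 and 1/2, the final centres of the exchanged first point
  -- and of the third one in SN(1;1).
  set s := 1 / (2 * (x 2 - x 0)) with hs
  have hs0 : 0 < s := one_div_pos.2 hl
  set q := s * (x 1 - x 0) with hq
  have hq0 : 0 < q := mul_pos hs0 (by linarith)
  have hs2 : s * (x 2 - x 0) = 1 / 2 := by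
    have : x 2 - x 0 ≠ 0 := by linarith
    rw [hs]; field_simp
  have hq1 : q < 1 / 2 := by rw [← hs2]; exact mul_lt_mul_of_pos_left (by linarith) hs0
  -- The argument of the second point once lifted to the circle of radius 1/2.
  set φ := Real.arccos (2 * q) with hφ
  have hφ0 : 0 < φ := Real.arccos_pos.2 (by linarith)
  have hφ1 : φ ≤ Real.pi / 2 := Real.arccos_le_pi_div_two.2 (by linarith)
  have hpi := Real.pi_pos
  have hπφ : φ + (Real.pi / φ - 1) * φ = Real.pi := by field_simp; ring
  obtain ⟨A, hA, hAz⟩ := exists_affine_isotopy hs0 (-(s * x 0))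
  obtain ⟨L, hL, hL0, hL1, hLq, hLs⟩ := exists_lift_to_arc hq0 hq1
  obtain ⟨T, hT, hTz⟩ := exists_arc_stretch hφ0 hφ1
  have hA1 : ∀ u : ℝ, A 1 (u : ℂ) = ((s * (u - x 0) : ℝ) : ℂ) := fun u => by
    rw [hAz, Set.Icc.coe_one]; push_cast; ring
  have hT0 : ∀ t, T t 0 = 0 := fun t => by
    have := hTz t 0 0 le_rfl ⟨le_rfl, hφ0.le⟩
    simpa using this
  have hTh : ∀ t, T t ((1 / 2 : ℝ) : ℂ) = ((1 / 2 : ℝ) : ℂ) := fun t => by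
    have := hTz t (1 / 2) 0 (by norm_num) ⟨le_rfl, hφ0.le⟩
    simpa using this
  set c : Fin 3 → ℂ := ![0, (q : ℂ), ((1 / 2 : ℝ) : ℂ)] with hc
  have hcinj : Function.Injective c := by
    have : c = realTriple ![0, q, 1 / 2] := by
      funext i; fin_cases i <;> simp [hc, realTriple]
    rw [this]
    refine injective_realTriple (StrictMono.injective ?_)
    rw [Fin.strictMono_iff_lt_succ]
    intro i
    fin_cases i
    · simpa using hq0
    · simpa using hq1
  have m1 : IsMove (realTriple x) (A 1) c := by
    refine hA.isMove_of_im_nonneg (injective_realTriple hx.injective) (fun t => ?_) fun i => ?_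
    · rw [shape_im_of_real] <;> simp [realTriple, hAz]
    · simp only [realTriple]
      rw [hA1]
      fin_cases i
      · simp [hc]
      · simp [hc, hq]
      · simp only [Fin.reduceFinMk, hs2]
        simp [hc]
  have m2 : IsMove c (L 1) ![0, (1 / 2 : ℝ) * exp (φ * I), ((1 / 2 : ℝ) : ℂ)] := by
    refine hL.isMove_of_im_nonneg hcinj (fun t => ?_) fun i => ?_
    · have e0 : L t (c 0) = 0 := hL0 t
      have e2 : L t (c 2) = ((1 / 2 : ℝ) : ℂ) := hL1 t
      have e1 : c 1 = q := rfl
      rw [shape_im_of_real] <;> simp only [e0, e1, e2, zero_im, ofReal_im, zero_re, ofReal_re]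
      exact div_nonneg (hLq t) (by norm_num)
    · fin_cases i
      · exact hL0 1
      · exact hLs q ⟨le_rfl, hq1.le⟩
      · exact hL1 1
  have m3 : IsMove ![0, (1 / 2 : ℝ) * exp (φ * I), ((1 / 2 : ℝ) : ℂ)] (T 1)
      (realTriple (snailCenters 1 1 ∘ Equiv.swap 0 1)) := by
    refine hT.isMove_of_im_nonneg ?_ (fun t => ?_) fun i => ?_
    · have : ![0, (1 / 2 : ℝ) * exp (φ * I), ((1 / 2 : ℝ) : ℂ)] = L 1 ∘ c := by
        funext i
        fin_cases i
        · exact (hL0 1).symm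
        · exact (hLs q ⟨le_rfl, hq1.le⟩).symm
        · exact (hL1 1).symm
      rw [this]
      exact (L 1).injective.comp hcinj
    · have e := hTz t (1 / 2) φ (by norm_num) ⟨hφ0.le, le_rfl⟩
      rw [shape_im_of_real]
      · change 0 ≤ (T t _).im / ((T t _).re - (T t 0).re)
        rw [hT0]
        change 0 ≤ (T t ((1 / 2 : ℝ) * exp (φ * I))).im /
          ((T t ((1 / 2 : ℝ) : ℂ)).re - (0 : ℂ).re)
        rw [hTh, e, im_ofReal_mul, exp_ofReal_mul_I_im, ofReal_re, zero_re]
        have hnn : 0 ≤ (Real.pi / φ - 1) * φ := by linarith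
        have h0 := mul_nonneg t.2.1 hnn
        have h1 := mul_le_of_le_one_left hnn t.2.2
        have := Real.sin_nonneg_of_mem_Icc (x := φ + t * ((Real.pi / φ - 1) * φ))
          ⟨by linarith, by linarith⟩
        exact div_nonneg (mul_nonneg (by norm_num) this) (by norm_num)
      · change (T t 0).im = 0
        rw [hT0, zero_im]
      · change (T t ((1 / 2 : ℝ) : ℂ)).im = 0
        rw [hTh, ofReal_im]
    · have s2 : Equiv.swap (0 : Fin 3) 1 2 = 2 := by decide
      fin_cases i
      · change T 1 0 = _
        rw [hT0]
        simp [realTriple, snailCenters]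
      · change T 1 ((1 / 2 : ℝ) * exp (φ * I)) = _
        rw [hTz _ _ _ (by norm_num) ⟨hφ0.le, le_rfl⟩, Set.Icc.coe_one, one_mul, hπφ,
          exp_pi_mul_I]
        simp [realTriple, snailCenters, neg_div]
      · change T 1 ((1 / 2 : ℝ) : ℂ) = _
        rw [hTh]
        simp [realTriple, snailCenters, s2]
  refine ⟨_, (m1.trans m2).trans m3, ?_⟩
  have hfun : ∀ u ∈ Icc (x 1) (x 2), T 1 (L 1 (A 1 (u : ℂ))) =
      (1 / 2 : ℝ) * exp ((Real.pi / φ * Real.arccos (2 * (s * (u - x 0))) : ℝ) * I) := by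
    intro u hu
    have a : q ≤ s * (u - x 0) := mul_le_mul_of_nonneg_left (by linarith [hu.1]) hs0.le
    have b : s * (u - x 0) ≤ 1 / 2 := by
      rw [← hs2]; exact mul_le_mul_of_nonneg_left (by linarith [hu.2]) hs0.le
    rw [hA1, hLs _ ⟨a, b⟩, hTz _ _ _ (by norm_num)
      ⟨Real.arccos_nonneg _, Real.arccos_le_arccos (by linarith)⟩, Set.Icc.coe_one]
    congr 5
    ring
  rw [segment_ofReal h12.le, snailCurve_one_one, image_image]
  ext z
  constructor
  · rintro ⟨u, hu, rfl⟩
    refine ⟨Real.pi / φ * Real.arccos (2 * (s * (u - x 0))), ⟨?_, ?_⟩, (hfun u hu).symm⟩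
    · exact mul_nonneg (by positivity) (Real.arccos_nonneg _)
    · have : Real.arccos (2 * (s * (u - x 0))) ≤ φ := Real.arccos_le_arccos (by
        have := mul_le_mul_of_nonneg_left (show x 1 - x 0 ≤ u - x 0 by linarith [hu.1]) hs0.le
        linarith)
      calc _ ≤ Real.pi / φ * φ := mul_le_mul_of_nonneg_left this (by positivity)
        _ = _ := by field_simp
  · rintro ⟨θ, hθ, rfl⟩
    have h0 : 0 ≤ φ / Real.pi * θ := mul_nonneg (by positivity) hθ.1
    have h1 : φ / Real.pi * θ ≤ φ :=
      calc _ ≤ φ / Real.pi * Real.pi := mul_le_mul_of_nonneg_left hθ.2 (by positivity)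
        _ = _ := by field_simp
    have hcos : 2 * q ≤ Real.cos (φ / Real.pi * θ) := by
      rw [← Real.cos_arccos (x := 2 * q) (by linarith) (by linarith)]
      exact Real.cos_le_cos_of_nonneg_of_le_pi h0 (Real.arccos_le_pi _) h1
    have hcos1 := Real.cos_le_one (φ / Real.pi * θ)
    -- Running the construction backwards: angle θ is first compressed to φθ/π, then projected to
    -- the axis by its cosine.
    have hu : s * (x 0 + Real.cos (φ / Real.pi * θ) * (x 2 - x 0) - x 0) =
        Real.cos (φ / Real.pi * θ) / 2 := by
      rw [add_sub_cancel_left, mul_left_comm, hs2]; ring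
    have hmem : x 0 + Real.cos (φ / Real.pi * θ) * (x 2 - x 0) ∈ Icc (x 1) (x 2) := by
      constructor
      · have : s * (x 1 - x 0) ≤ s * (x 0 + Real.cos (φ / Real.pi * θ) * (x 2 - x 0) - x 0) := by
          rw [hu, ← hq]; linarith
        have := le_of_mul_le_mul_left this hs0
        linarith
      · nlinarith
    refine ⟨_, hmem, ?_⟩
    change T 1 (L 1 (A 1 _)) = _
    rw [hfun _ hmem, hu, mul_div_cancel₀ _ two_ne_zero, Real.arccos_cos h0 (by linarith)]
    congr 4
    field_simp

/-! ### The action of types A and B, and of words -/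

/-- The pairs of sizes for which the snail has its standard model. -/
def IsGood (n p : ℕ) : Prop := 1 ≤ n ∧ 1 ≤ p ∨ n = 1 ∧ p = 0 ∨ n = 0 ∧ p = 1

theorem IsGood.swap {n p : ℕ} (h : IsGood n p) : IsGood p n := by
  unfold IsGood at *; omega

theorem IsGood.add {n p : ℕ} (h : IsGood n p) : IsGood (n + p) p := by
  unfold IsGood at *; omega

theorem SN_of_pos {n p : ℕ} (hn : 1 ≤ n) (hp : 1 ≤ p) (x : Fin 3 → ℝ) :
    SN x n p = topType (snailCenters n p) x (snailCurve n p) := by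
  rw [SN, if_neg (by omega), if_neg (by omega)]

theorem SN_one_zero (x : Fin 3 → ℝ) : SN x 1 0 = topType x x (segment ℝ (x 0 : ℂ) (x 1 : ℂ)) := by
  rw [SN, if_pos rfl]

theorem SN_zero_one (x : Fin 3 → ℝ) : SN x 0 1 = topType x x (segment ℝ (x 1 : ℂ) (x 2 : ℂ)) := by
  rw [SN, if_neg one_ne_zero, if_pos rfl]

theorem mapType_trans (f g : ℂ ≃ₜ ℂ) (T : Set (Set ℂ)) :
    mapType (f.trans g) T = mapType g (mapType f T) := by
  simp only [mapType, image_image]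
  rfl

theorem mapType_refl (T : Set (Set ℂ)) : mapType (Homeomorph.refl ℂ) T = T := by
  simp [mapType]

theorem IsTypeA.mapType_SN {x : Fin 3 → ℝ} (hx : StrictMono x) {f : ℂ ≃ₜ ℂ} (hf : IsTypeA x f)
    {n p : ℕ} (h : IsGood n p) : mapType f (SN x n p) = SN x (n + p) p := by
  rcases h with ⟨hn, hp⟩ | ⟨rfl, rfl⟩ | ⟨rfl, rfl⟩
  · obtain ⟨K, hK, hS⟩ := exists_twist_snail hn hp
    rw [SN_of_pos hn hp, SN_of_pos (by omega) hp, hf.mapType_topType hx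
      (strictMono_snailCenters hn hp) (strictMono_snailCenters (by omega) hp) hK, hS]
  · obtain ⟨K, hK, hS⟩ := exists_twist_segment hx
    rw [SN_one_zero, hf.mapType_topType hx hx hx hK, hS]
  · obtain ⟨K, hK, hS⟩ := exists_twist_complement hx
    rw [SN_zero_one, zero_add, SN_of_pos le_rfl le_rfl, hf.mapType_topType hx hx
      (strictMono_snailCenters le_rfl le_rfl) hK, hS]

/-- The reflection in the imaginary axis. -/
def reflection : ℂ ≃ₜ ℂ where
  toFun z := ⟨-z.re, z.im⟩
  invFun z := ⟨-z.re, z.im⟩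
  left_inv z := by simp
  right_inv z := by simp
  continuous_toFun := continuous_complex_mk Complex.continuous_re.neg Complex.continuous_im
  continuous_invFun := continuous_complex_mk Complex.continuous_re.neg Complex.continuous_im

theorem reflection_apply (z : ℂ) : reflection z = ⟨-z.re, z.im⟩ := rfl

theorem reflection_ofReal (s : ℝ) : reflection (s : ℂ) = ((-s : ℝ) : ℂ) :=
  Complex.ext (by simp [reflection_apply]) (by simp [reflection_apply])

theorem reflection_reflection (z : ℂ) : reflection (reflection z) = z := by
  simp [reflection_apply]

theorem reflection_symm : reflection.symm = reflection := rfl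

/-- The reflection of an increasing triple. -/
def reflectTriple (x : Fin 3 → ℝ) : Fin 3 → ℝ := fun i => -x i.rev

theorem reflectTriple_reflectTriple (x : Fin 3 → ℝ) : reflectTriple (reflectTriple x) = x := by
  funext i; simp [reflectTriple]

theorem strictMono_reflectTriple {x : Fin 3 → ℝ} (hx : StrictMono x) :
    StrictMono (reflectTriple x) :=
  fun _ _ h => neg_lt_neg (hx (Fin.rev_lt_rev.2 h))

theorem reflection_reflectTriple (x : Fin 3 → ℝ) (i : Fin 3) :
    reflection (reflectTriple x i : ℂ) = x i.rev := by
  rw [reflection_ofReal, reflectTriple, neg_neg]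

/-- The reflection reverses the order of the marked points but preserves the upper half-plane, so
the exchange on the right becomes one on the left. -/
theorem IsTypeB.reflect {x : Fin 3 → ℝ} {f : ℂ ≃ₜ ℂ} (hf : IsTypeB x f) :
    IsTypeA (reflectTriple x) ((reflection.trans f).trans reflection) := by
  obtain ⟨h0, h1, h2, F, hF, rfl, hFt⟩ := hf
  have e : ∀ (t : unitInterval) (i : Fin 3), ((reflection.trans (F t)).trans reflection)
      (reflectTriple x i) = reflection (F t (x i.rev)) := fun t i => by
    rw [Homeomorph.trans_apply, Homeomorph.trans_apply, reflection_reflectTriple]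
  have r0 : Fin.rev (0 : Fin 3) = 2 := by decide
  have r1 : Fin.rev (1 : Fin 3) = 1 := by decide
  have r2 : Fin.rev (2 : Fin 3) = 0 := by decide
  refine ⟨?_, ?_, ?_, fun t => (reflection.trans (F t)).trans reflection, hF.conj reflection,
    rfl, fun t ht ht' => ?_⟩
  · rw [e, r0, h2, reflection_ofReal, reflectTriple, r1]
  · rw [e, r1, h1, reflection_ofReal, reflectTriple, r0]
  · rw [e, r2, h0, reflection_ofReal, reflectTriple, r2]
  · obtain ⟨a, b, c⟩ := hFt t ht ht'
    rw [e, e, e, r0, r1, r2]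
    exact ⟨b, a, c⟩

theorem image_reflection_eq {S T : Set ℂ} (h : ∀ z, reflection z ∈ S ↔ z ∈ T) :
    reflection '' S = T := by
  rw [← reflection_symm, Homeomorph.image_symm]
  exact Set.ext h

theorem mapType_reflection_subset (y x : Fin 3 → ℝ) (S : Set ℂ) :
    mapType reflection (topType y x S) ⊆
      topType (reflectTriple y) (reflectTriple x) (reflection '' S) := by
  rintro _ ⟨_, ⟨F, hF, him, hr, rfl⟩, rfl⟩
  have hrange : ∀ z : Fin 3 → ℝ, range (fun i => (reflectTriple z i : ℂ)) =
      reflection '' range (fun i => (z i : ℂ)) := fun z => by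
    rw [← range_comp, ← Fin.rev_surjective.range_comp]
    congr 1
    funext i
    simp only [Function.comp, reflectTriple, Fin.rev_rev, reflection_ofReal]
  refine ⟨fun t => (reflection.trans (F t)).trans reflection, hF.conj reflection,
    fun t i => ?_, ?_, ?_⟩
  · rw [Homeomorph.trans_apply, Homeomorph.trans_apply, reflection_reflectTriple]
    exact him t _
  · rw [hrange, hrange, ← hr]
    simp only [image_image, Homeomorph.trans_apply, reflection_reflection]
  · simp only [image_image, Homeomorph.trans_apply, reflection_reflection]

theorem mapType_reflection_topType (y x : Fin 3 → ℝ) (S : Set ℂ) :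
    mapType reflection (topType y x S) =
      topType (reflectTriple y) (reflectTriple x) (reflection '' S) := by
  refine (mapType_reflection_subset y x S).antisymm fun H hH => ?_
  -- The reflection is an involution, so one inclusion applied to the reflected data gives the
  -- other.
  have h := mapType_reflection_subset (reflectTriple y) (reflectTriple x) (reflection '' S)
    (mem_image_of_mem _ hH)
  simp only [reflectTriple_reflectTriple, image_image, reflection_reflection, image_id'] at h
  exact ⟨_, h, by simp only [image_image, reflection_reflection, image_id']⟩

theorem image_reflection_snailCurve (n p : ℕ) :
    reflection '' snailCurve n p = snailCurve p n := by
  refine image_reflection_eq fun z => ?_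
  have e : ∀ c : ℝ, ‖reflection z - (c : ℂ)‖ = ‖z - ((-c : ℝ) : ℂ)‖ := fun c => by
    rw [norm_eq_sqrt_sq_add_sq, norm_eq_sqrt_sq_add_sq]
    simp only [reflection_apply, sub_re, sub_im, ofReal_re, ofReal_im]
    congr 2
    ring
  rw [snailCurve_eq, snailCurve_eq]
  simp only [snailSet, mem_ofPred_eq, e, ← neg_div, neg_neg, neg_sub, add_comm n p]
  simp only [reflection_apply]
  tauto

theorem reflectTriple_snailCenters (n p : ℕ) :
    reflectTriple (snailCenters n p) = snailCenters p n := by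
  funext i
  fin_cases i <;> simp [reflectTriple, snailCenters] <;> ring

theorem image_reflection_segment {a b : ℝ} (h : a ≤ b) :
    reflection '' segment ℝ (a : ℂ) (b : ℂ) = segment ℝ ((-b : ℝ) : ℂ) ((-a : ℝ) : ℂ) := by
  rw [segment_ofReal h, segment_ofReal (neg_le_neg h), image_image, ← image_neg_Icc, image_image]
  simp only [reflection_ofReal]

theorem mapType_reflection_SN {x : Fin 3 → ℝ} (hx : StrictMono x) {n p : ℕ} (h : IsGood n p) :
    mapType reflection (SN x n p) = SN (reflectTriple x) p n := by
  rcases h with ⟨hn, hp⟩ | ⟨rfl, rfl⟩ | ⟨rfl, rfl⟩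
  · rw [SN_of_pos hn hp, SN_of_pos hp hn, mapType_reflection_topType, reflectTriple_snailCenters,
      image_reflection_snailCurve]
  · rw [SN_one_zero, SN_zero_one, mapType_reflection_topType,
      image_reflection_segment (hx.monotone (by decide))]
    rfl
  · rw [SN_one_zero, SN_zero_one, mapType_reflection_topType,
      image_reflection_segment (hx.monotone (by decide))]
    rfl

/-- Conjugation by the reflection exchanges n and p, and turns the rule for A into the rule for B.
-/
theorem IsTypeB.mapType_SN {x : Fin 3 → ℝ} (hx : StrictMono x) {f : ℂ ≃ₜ ℂ} (hf : IsTypeB x f)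
    {n p : ℕ} (h : IsGood n p) : mapType f (SN x n p) = SN x n (n + p) := by
  have hx' := strictMono_reflectTriple hx
  have hg := hf.reflect.mapType_SN hx' h.swap
  have e : (reflection.trans ((reflection.trans f).trans reflection)).trans reflection = f :=
    Homeomorph.ext fun z => by simp [reflection_reflection]
  rw [← e, mapType_trans, mapType_trans, mapType_reflection_SN hx h, hg,
    mapType_reflection_SN hx' h.swap.add, reflectTriple_reflectTriple, add_comm]

/-- The turbulence matrix describes the action on the snails. -/
theorem HasTurbulenceMatrix.mapType_SN {x : Fin 3 → ℝ} (hx : StrictMono x) {f : ℂ ≃ₜ ℂ}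
    {M : Matrix (Fin 2) (Fin 2) ℕ} (hf : HasTurbulenceMatrix x f M) {n p : ℕ} (h : IsGood n p) :
    IsGood (M 0 0 * n + M 0 1 * p) (M 1 0 * n + M 1 1 * p) ∧
      mapType f (SN x n p) = SN x (M 0 0 * n + M 0 1 * p) (M 1 0 * n + M 1 1 * p) := by
  -- `IsGood` is carried along because `SN` has conventional values outside these pairs, for
  -- instance when p = 0 and n ≠ 1.
  induction hf with
  | id => simpa [mapType_refl] using h
  | @compA f a M _ ha ih =>
    have e : ∀ j, ((!![1, 1; 0, 1] : Matrix (Fin 2) (Fin 2) ℕ) * M) 0 j = M 0 j + M 1 j ∧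
      ((!![1, 1; 0, 1] : Matrix (Fin 2) (Fin 2) ℕ) * M) 1 j = M 1 j :=
      fun j => by simp [Matrix.mul_apply, Fin.sum_univ_two]
    have e' : (M 0 0 + M 1 0) * n + (M 0 1 + M 1 1) * p =
      (M 0 0 * n + M 0 1 * p) + (M 1 0 * n + M 1 1 * p) := by ring
    rw [(e 0).1, (e 0).2, (e 1).1, (e 1).2, e', mapType_trans, ih.2, ha.mapType_SN hx ih.1]
    exact ⟨ih.1.add, rfl⟩
  | @compB f b M _ hb ih =>
    have e : ∀ j, ((!![1, 0; 1, 1] : Matrix (Fin 2) (Fin 2) ℕ) * M) 0 j = M 0 j ∧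
      ((!![1, 0; 1, 1] : Matrix (Fin 2) (Fin 2) ℕ) * M) 1 j = M 0 j + M 1 j :=
      fun j => by simp [Matrix.mul_apply, Fin.sum_univ_two]
    have e' : (M 0 0 + M 1 0) * n + (M 0 1 + M 1 1) * p =
      (M 0 0 * n + M 0 1 * p) + (M 1 0 * n + M 1 1 * p) := by ring
    rw [(e 0).1, (e 0).2, (e 1).1, (e 1).2, e', mapType_trans, ih.2, hb.mapType_SN hx ih.1]
    refine ⟨?_, rfl⟩
    rw [add_comm (M 0 0 * n + M 0 1 * p)]
    exact ih.1.swap.add.swap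

end Snail

theorem mainTheorem6 (x : Fin 3 → ℝ) (hx : StrictMono x) (f : ℂ ≃ₜ ℂ) (g₁ r₁ g₂ r₂ : ℕ)
    (hf : Snail.HasTurbulenceMatrix x f !![g₁, r₁; g₂, r₂]) :
    Snail.mapType f (Snail.SN x 1 1) = Snail.SN x (g₁ + r₁) (g₂ + r₂) ∧
    Snail.mapType f (Snail.SN x 1 0) = Snail.SN x g₁ g₂ ∧
    Snail.mapType f (Snail.SN x 0 1) = Snail.SN x r₁ r₂ := by
  refine ⟨?_, ?_, ?_⟩
  · simpa using (hf.mapType_SN hx (n := 1) (p := 1) (by simp [Snail.IsGood])).2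
  · simpa using (hf.mapType_SN hx (n := 1) (p := 0) (by simp [Snail.IsGood])).2
  · simpa using (hf.mapType_SN hx (n := 0) (p := 1) (by simp [Snail.IsGood])).2
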